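/- Fix $\gamma\ge 1$. For $0<v_+<1$ put $a=-\frac{v_+-1}{v_+^{-\gamma}-1}$, $H(v)=v\big(v-1+a(v^{-\gamma}-1)\big)$, $h(w)=-w^{\gamma+1}+a(\gamma-1)+(a+1)w^{\gamma}$, $f(w)=w-w^{-\gamma}h(w)$, and, for $w>0$, $\lambda\in\mathbb C$, $$A_{v_+}(w,\lambda)=\begin{pmatrix}0&\lambda&1\\0&0&1\\ \lambda w&\lambda w&f(w)-\lambda\end{pmatrix},\qquad A^0(w,\lambda)=\begin{pmatrix}0&\lambda&1\\0&0&1\\ \lambda w&\lambda w&2w-1-\lambda\end{pmatrix}\ (w\ge 0).$$ A shock profile is a strictly decreasing solution $\hat v$ of $\hat v'=H(\hat v)$ on $\mathbb R$ with $\hat v(-\infty)=1$, $\hat v(+\infty)=v_+$. For every $v_+\in(0,1)$ and $c\in(v_+,1)$ there is one with $\hat v(0)=c$. Write $\overline{\mathbb C}_+=\{\operatorname{Re}\lambda\ge 0\}$; a scaling is a continuous nowhere vanishing function $\overline{\mathbb C}_+\to\mathbb C$. Evans function. Given $v_+$, a profile $\hat v$ and scalings $n^-,n^+$, let $V^-(\lambda)$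 be the eigenvector of $A_{v_+}(1,\lambda)$ for its eigenvalue $\mu^-(\lambda)$ of positive real part, with second entry $n^-(\lambda)$; let $\widetilde V^+(\lambda)$ be the eigenvector of $-A_{v_+}(v_+,\lambda)^*$ for its eigenvalue $\tilde\mu^+(\lambda)$ of negative real part ($\lambda\neq0$), with second entry $n^+(\lambda)$, where $\tilde\mu^+$ and $\widetilde V^+$ are extended continuously to $\lambda=0$. Let $W_1^-$ solve $W'=A_{v_+}(\hat v(x),\lambda)W$ with $e^{-\mu^-x}W_1^-(x)\to V^-$ as $x\to-\infty$, let $\widetilde W_1^+$ solve $\widetilde W'=-A_{v_+}(\hat v(x),\lambda)^*\widetilde W$ with $e^{-\tilde\mu^+x}\widetilde W_1^+(x)\to\widetilde V^+$ as $x\to+\infty$, and set $D_{v_+}(\lambda)=\widetilde W_1^+(0)^*\,W_1^-(0)$ for $\lambda\in\overline{\mathbb C}_+$. Limiting Evans function. Given $x_0\in\mathbb R$ and a scaling $n^-_0$, let $\hat v_0(x)=\frac12\big(1-\tanh\frac{x-x_0}{2}\big)$. Let $V_0^-(\lambda)$ be the eigenvector of $A^0(1,\lambda)$ for its eigenvalue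 $\mu_0^-(\lambda)$ of positive real part, with second entry $n_0^-(\lambda)$; let $W_1^{0-}$ solve $W'=A^0(\hat v_0(x),\lambda)W$ with $e^{-\mu_0^-x}W_1^{0-}(x)\to V_0^-$ as $x\to-\infty$, and let $\widetilde W_1^{0+}$ solve $\widetilde W'=-A^0(\hat v_0(x),\lambda)^*\widetilde W$ with $$\widetilde W_1^{0+}(x)\to\widetilde V_1:=\big(0,1,(1+\bar\lambda)^{-1}\big)^T\quad(x\to+\infty),$$ the direction orthogonal to $(1,0,0)^T$ (the extra upstream boundary condition) and to the stable eigenvector of $A^0(0,\lambda)$. Set $D^0(\lambda)=\widetilde W_1^{0+}(0)^*\,W_1^{0-}(0)$. Theorem. Let $x_0\in\mathbb R$, let $\hat v_{v_+}$, $0<v_+<1$, be shock profiles with $\hat v_{v_+}(0)\to\hat v_0(0)$ as $v_+\to0^+$, and let $n^\pm_{v_+}$ and $n^-_0$ be scalings with $n^-_{v_+}\to n_0^-$ and $n^+_{v_+}\to1$ locally uniformly on $\overline{\mathbb C}_+$ as $v_+\to0^+$. Then $D_{v_+}$ is defined on $\overline{\mathbb C}_+$ for all sufficiently small $v_+>0$,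 $D^0$ is defined on $\overline{\mathbb C}_+$, and for every compact $\Lambda\subset\overline{\mathbb C}_+$ one has $D_{v_+}\to D^0$ uniformly on $\Lambda$ as $v_+\to0^+$ (the high-Mach-number limit). -/

import Mathlib

open Filter Topology Set Matrix

noncomputable section

namespace HighMach

/-- The closed right half-plane of spectral parameters. -/
def rightHalfPlane : Set ℂ := {lam : ℂ | 0 ≤ lam.re}

/-- The pressure constant `a` given by the Rankine-Hugoniot condition (with `v₋ = 1`). -/
def rhConst (γ vp : ℝ) : ℝ := -(vp - 1) / (vp ^ (-γ) - 1)

/-- The right-hand side `H(v, v₊) = v (v - 1 + a (v^{-γ} - 1))` of the profile equation. -/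
def profileField (γ vp v : ℝ) : ℝ := v * (v - 1 + rhConst γ vp * (v ^ (-γ) - 1))

/-- `v` is a shock profile: a decreasing solution on the line of `v' = H(v, v₊)` connecting
`v₋ = 1` at `-∞` to `v₊ = vp` at `+∞`. It is determined up to translation. -/
structure IsShockProfile (γ vp : ℝ) (v : ℝ → ℝ) : Prop where
  deriv_eq : ∀ x, HasDerivAt v (profileField γ vp (v x)) x
  strictAnti : StrictAnti v
  tendsto_atBot : Tendsto v atBot (𝓝 1)
  tendsto_atTop : Tendsto v atTop (𝓝 vp)

/-- The coefficient `h` in the linearised momentum equation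
`λ u + u' - (h(v̂) / v̂^{γ+1}) v' = u'' / v̂`. -/
def hCoeff (γ vp w : ℝ) : ℝ :=
  -w ^ (γ + 1) + rhConst γ vp * (γ - 1) + (rhConst γ vp + 1) * w ^ γ

/-- `f(v̂) = v̂ - v̂^{-γ} h(v̂)`. -/
def fCoeff (γ vp w : ℝ) : ℝ := w - w ^ (-γ) * hCoeff γ vp w

/-- The integrated eigenvalue equations as a first-order system `W' = A W`, `W = (u, v, v')`,
where `w` is the value of the profile and `lam` the spectral parameter. At the end states of the
profile, `evansMatrix γ vp 1 lam = A₋` and `evansMatrix γ vp vp lam = A₊`. -/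
def evansMatrix (γ vp w : ℝ) (lam : ℂ) : Matrix (Fin 3) (Fin 3) ℂ :=
  !![0, lam, 1;
     0, 0, 1;
     lam * (w : ℂ), lam * (w : ℂ), ((fCoeff γ vp w : ℝ) : ℂ) - lam]

/-- The coefficient matrix `A⁰` of the limiting (pressureless) system, with `f₀(w) = 2 w - 1`. -/
def limitMatrix (w : ℝ) (lam : ℂ) : Matrix (Fin 3) (Fin 3) ℂ :=
  !![0, lam, 1;
     0, 0, 1;
     lam * (w : ℂ), lam * (w : ℂ), ((2 * w - 1 : ℝ) : ℂ) - lam]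

/-- The limiting profile `(1 - tanh ((x - x₀) / 2)) / 2`, which solves `v' = v (v - 1)`. -/
def limitProfile (x₀ x : ℝ) : ℝ := (1 - Real.tanh ((x - x₀) / 2)) / 2

/-- `W` solves the linear system `W' = M(x) W` on the whole line. -/
def SolvesODE (M : ℝ → Matrix (Fin 3) (Fin 3) ℂ) (W : ℝ → Fin 3 → ℂ) : Prop :=
  ∀ x, HasDerivAt W (M x *ᵥ W x) x

/-- For `Re lam ≥ 0`, `V lam` is an eigenvector of `B lam` (a matrix `A(-∞, lam)`) for an
eigenvalue `μ lam` of positive real part, scaled so that its second entry is `n lam ≠ 0`. -/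
def IsUnstablePair (B : ℂ → Matrix (Fin 3) (Fin 3) ℂ) (n : ℂ → ℂ)
    (μ : ℂ → ℂ) (V : ℂ → Fin 3 → ℂ) : Prop :=
  ∀ lam ∈ rightHalfPlane,
    B lam *ᵥ V lam = μ lam • V lam ∧ 0 < (μ lam).re ∧ V lam 1 = n lam

/-- For `Re lam ≥ 0`, `lam ≠ 0`, `V lam` is an eigenvector of `-(B lam)^*` (with `B lam` a matrix
`A(+∞, lam)`) for an eigenvalue `μ lam` of negative real part, scaled so that its second entry is
`n lam ≠ 0`; at `lam = 0`, where no such eigenvalue exists, `μ` and `V` are extended by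
continuity. -/
structure IsDualStablePair (B : ℂ → Matrix (Fin 3) (Fin 3) ℂ) (n : ℂ → ℂ)
    (μ : ℂ → ℂ) (V : ℂ → Fin 3 → ℂ) : Prop where
  continuousOn_eigenvalue : ContinuousOn μ rightHalfPlane
  continuousOn_eigenvector : ContinuousOn V rightHalfPlane
  eigen : ∀ lam ∈ rightHalfPlane, (-(B lam)ᴴ) *ᵥ V lam = μ lam • V lam
  re_neg : ∀ lam ∈ rightHalfPlane, lam ≠ 0 → (μ lam).re < 0
  normalized : ∀ lam ∈ rightHalfPlane, V lam 1 = n lam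

/-- `W` is a solution of `W' = M(x) W` asymptotic to `e^{μ x} V` as `x → -∞`. -/
def IsModeAtBot (M : ℝ → Matrix (Fin 3) (Fin 3) ℂ) (μ : ℂ) (V : Fin 3 → ℂ)
    (W : ℝ → Fin 3 → ℂ) : Prop :=
  SolvesODE M W ∧ Tendsto (fun x : ℝ => Complex.exp (-μ * (x : ℂ)) • W x) atBot (𝓝 V)

/-- `Wt` is a solution of the adjoint system `Wt' = -M(x)^* Wt` asymptotic to `e^{μ x} V`
as `x → +∞`. -/
def IsDualModeAtTop (M : ℝ → Matrix (Fin 3) (Fin 3) ℂ) (μ : ℂ) (V : Fin 3 → ℂ)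
    (Wt : ℝ → Fin 3 → ℂ) : Prop :=
  SolvesODE (fun x => -(M x)ᴴ) Wt ∧
    Tendsto (fun x : ℝ => Complex.exp (-μ * (x : ℂ)) • Wt x) atTop (𝓝 V)

/-- `D` is the Evans function `D(λ) = (W̃₁⁺ · W₁⁻)|_{x=0}` (Hermitian product) of the integrated
eigenvalue system along the profile `v`, where `W₁⁻` decays at `-∞`, `W̃₁⁺` is the adjoint solution
decaying at `+∞`, and the asymptotic eigenvectors have second entries `nm lam` and `np lam`. -/
def IsEvansFunction (γ vp : ℝ) (v : ℝ → ℝ) (nm np : ℂ → ℂ) (D : ℂ → ℂ) : Prop :=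
  ∃ (μm μp : ℂ → ℂ) (Vm Vp : ℂ → Fin 3 → ℂ),
    IsUnstablePair (evansMatrix γ vp 1) nm μm Vm ∧
    IsDualStablePair (evansMatrix γ vp vp) np μp Vp ∧
    ∀ lam ∈ rightHalfPlane, ∃ W Wt : ℝ → Fin 3 → ℂ,
      IsModeAtBot (fun x => evansMatrix γ vp (v x) lam) (μm lam) (Vm lam) W ∧
      IsDualModeAtTop (fun x => evansMatrix γ vp (v x) lam) (μp lam) (Vp lam) Wt ∧
      D lam = star (Wt 0) ⬝ᵥ W 0

/-- The direction `Ṽ₁ = (0, 1, (1 + conj λ)⁻¹)`. Up to scale it is the unique vector orthogonal to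
the imposed slow direction `(1, 0, 0)` and to the stable eigenvector
`(b⁻¹ (λ / b + 1), b⁻¹, 1)`, `b = -1 - λ`, of `A⁰(+∞, λ) = limitMatrix 0 λ`. -/
def limitDualVector (lam : ℂ) : Fin 3 → ℂ := ![0, 1, (1 + star lam)⁻¹]

/-- `D0` is the limiting Evans function: `W₁⁰⁻` is the solution of the limiting system
decaying at `-∞`, and `W̃₁⁰⁺` the solution of the limiting adjoint system that tends to `Ṽ₁` at
`+∞`. -/
def IsLimitEvansFunction (x₀ : ℝ) (nm : ℂ → ℂ) (D0 : ℂ → ℂ) : Prop :=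
  ∃ (μm : ℂ → ℂ) (Vm : ℂ → Fin 3 → ℂ),
    IsUnstablePair (limitMatrix 1) nm μm Vm ∧
    ∀ lam ∈ rightHalfPlane, ∃ W Wt : ℝ → Fin 3 → ℂ,
      IsModeAtBot (fun x => limitMatrix (limitProfile x₀ x) lam) (μm lam) (Vm lam) W ∧
      IsDualModeAtTop (fun x => limitMatrix (limitProfile x₀ x) lam) 0 (limitDualVector lam) Wt ∧
      D0 lam = star (Wt 0) ⬝ᵥ W 0

/-- `n` is an admissible scaling: continuous and non-vanishing for `Re lam ≥ 0`. -/
def IsScaling (n : ℂ → ℂ) : Prop :=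
  ContinuousOn n rightHalfPlane ∧ ∀ lam ∈ rightHalfPlane, n lam ≠ 0

end HighMach

end

namespace HighMach

section ODE

variable {E : Type*} [NormedAddCommGroup E] [NormedSpace ℝ E]

/-- Two-sided Grönwall estimate on an interval. -/
theorem norm_le_exp_of_norm_deriv_le {d d' : ℝ → E} {A B K G : ℝ} (hK : 1 ≤ K) (hG : 0 ≤ G)
    (hd : ∀ x ∈ Icc A B, HasDerivAt d (d' x) x)
    (hb : ∀ x ∈ Icc A B, ‖d' x‖ ≤ K * ‖d x‖ + G) {x y : ℝ} (hx : x ∈ Icc A B)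
    (hy : y ∈ Icc A B) : ‖d x‖ ≤ (‖d y‖ + G) * Real.exp (K * |x - y|) := by
  have key : ∀ δ s : ℝ, 0 ≤ δ → 0 ≤ s → gronwallBound δ K G s ≤ (δ + G) * Real.exp (K * s) := by
    intro δ s hδ hs
    rw [gronwallBound_of_K_ne_0 (by positivity)]
    have h1 : 1 ≤ Real.exp (K * s) := Real.one_le_exp (by positivity)
    have h2 : G / K ≤ G := div_le_self hG hK
    have h3 : 0 ≤ G / K := by positivity
    nlinarith
  rcases le_total y x with h | h
  · have := norm_le_gronwallBound_of_norm_deriv_right_le (f := d) (f' := d') (δ := ‖d y‖) (K := K)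
      (ε := G) (a := y) (b := x)
      (fun z hz => (hd z ⟨hy.1.trans hz.1, hz.2.trans hx.2⟩).continuousAt.continuousWithinAt)
      (fun z hz => (hd z ⟨hy.1.trans hz.1, hz.2.le.trans hx.2⟩).hasDerivWithinAt) le_rfl
      (fun z hz => hb z ⟨hy.1.trans hz.1, hz.2.le.trans hx.2⟩) x ⟨h, le_rfl⟩
    rw [abs_of_nonneg (sub_nonneg.2 h)]
    exact this.trans (key _ _ (norm_nonneg _) (sub_nonneg.2 h))
  · have hd2 : ∀ z ∈ Icc (-y) (-x), HasDerivAt (fun s => d (-s)) (-(d' (-z))) z := by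
      intro z hz
      have := (hd (-z) ⟨by linarith [hx.1, hz.2], by linarith [hy.2, hz.1]⟩).scomp z (hasDerivAt_neg z)
      simpa [Function.comp_def] using this
    have := norm_le_gronwallBound_of_norm_deriv_right_le (f := fun s => d (-s))
      (f' := fun s => -(d' (-s))) (δ := ‖d y‖) (K := K)
      (ε := G) (a := -y) (b := -x)
      (fun z hz => (hd2 z hz).continuousAt.continuousWithinAt)
      (fun z hz => (hd2 z ⟨hz.1, hz.2.le⟩).hasDerivWithinAt) (by simp)
      (fun z hz => by
        rw [norm_neg]
        exact hb (-z) ⟨by linarith [hx.1, hz.2], by linarith [hy.2, hz.1]⟩) (-x)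
      ⟨neg_le_neg h, le_rfl⟩
    simp only [neg_neg] at this
    rw [abs_of_nonpos (sub_nonpos.2 h)]
    have e : -x - -y = -(x - y) := by ring
    rw [e] at this
    exact this.trans (key _ _ (norm_nonneg _) (by linarith))

/-- Solutions on all bounded intervals around `t₀` glue to a global solution. -/
theorem exists_global_of_forall_Ioo {f : ℝ → E → E} {t₀ : ℝ} {x₀ : E}
    (hf : ∀ T : ℝ, ∃ K, ∀ t ∈ Ioo (t₀ - T) (t₀ + T), LipschitzWith K (f t))
    (hα : ∀ T : ℝ, 0 < T → ∃ α : ℝ → E, α t₀ = x₀ ∧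
      ∀ t ∈ Ioo (t₀ - T) (t₀ + T), HasDerivAt α (f t (α t)) t) :
    ∃ α : ℝ → E, α t₀ = x₀ ∧ ∀ t, HasDerivAt α (f t (α t)) t := by
  have hα' : ∀ n : ℕ, ∃ α : ℝ → E, α t₀ = x₀ ∧
      ∀ t ∈ Ioo (t₀ - (n + 1 : ℝ)) (t₀ + (n + 1 : ℝ)), HasDerivAt α (f t (α t)) t :=
    fun n => hα _ (by positivity)
  choose β hβ0 hβ using hα'
  have mono : ∀ m n : ℕ, m ≤ n → ∀ t ∈ Ioo (t₀ - (m + 1 : ℝ)) (t₀ + (m + 1 : ℝ)),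
      β m t = β n t := by
    intro m n hmn
    obtain ⟨K, hK⟩ := hf (m + 1)
    have hmn' : (m : ℝ) ≤ n := by exact_mod_cast hmn
    have hm0 : (0 : ℝ) ≤ m := Nat.cast_nonneg m
    exact ODE_solution_unique_of_mem_Ioo (v := f) (s := fun _ => univ) (K := K) (t₀ := t₀)
      (fun t ht => (hK t ht).lipschitzOnWith) ⟨by linarith, by linarith⟩
      (fun t ht => ⟨hβ m t ht, trivial⟩)
      (fun t ht => ⟨hβ n t ⟨by linarith [ht.1], by linarith [ht.2]⟩, trivial⟩)
      ((hβ0 m).trans (hβ0 n).symm)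
  have eqn : ∀ m n : ℕ, ∀ t, |t - t₀| < m + 1 → |t - t₀| < n + 1 → β m t = β n t := by
    intro m n t hm hn
    rw [abs_lt] at hm hn
    rcases le_total m n with h | h
    · exact mono m n h t ⟨by linarith, by linarith⟩
    · exact (mono n m h t ⟨by linarith, by linarith⟩).symm
  refine ⟨fun t => β ⌈|t - t₀|⌉₊ t, hβ0 _, fun t => ?_⟩
  set n := ⌈|t - t₀|⌉₊ with hn
  have hlt : |t - t₀| < n + 1 := lt_of_le_of_lt (Nat.le_ceil _) (by linarith)
  have hab := abs_lt.1 hlt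
  refine (hβ n t ⟨by linarith, by linarith⟩).congr_of_eventuallyEq ?_
  have hopen : ∀ᶠ s in 𝓝 t, |s - t₀| < n + 1 :=
    (continuous_abs.comp (continuous_id.sub continuous_const)).continuousAt.eventually_lt
      continuousAt_const hlt
  filter_upwards [hopen] with s hs
  exact eqn _ _ s (lt_of_le_of_lt (Nat.le_ceil _) (by linarith)) hs

/-- Global existence for a bounded Lipschitz field on a bounded interval. -/
theorem exists_Ioo_of_bounded [CompleteSpace E] {f : ℝ → E → E} {t₀ T L : ℝ} (x₀ : E)
    {K : NNReal} (hT : 0 < T) (hK : ∀ t ∈ Icc (t₀ - T) (t₀ + T), LipschitzWith K (f t))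
    (hc : ∀ x, Continuous (f · x)) (hL : ∀ t ∈ Icc (t₀ - T) (t₀ + T), ∀ x, ‖f t x‖ ≤ L) :
    ∃ α : ℝ → E, α t₀ = x₀ ∧ ∀ t ∈ Ioo (t₀ - T) (t₀ + T), HasDerivAt α (f t (α t)) t := by
  have hL0 : 0 ≤ L := (norm_nonneg _).trans (hL t₀ ⟨by linarith, by linarith⟩ x₀)
  have hpl : IsPicardLindelof f (tmin := t₀ - T) (tmax := t₀ + T)
      ⟨t₀, by linarith, by linarith⟩ x₀ (L * T).toNNReal 0 L.toNNReal K := by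
    refine ⟨fun t ht => (hK t ht).lipschitzOnWith, fun x _ => (hc x).continuousOn, ?_, ?_⟩
    · intro t ht x _
      rw [Real.coe_toNNReal _ hL0]
      exact hL t ht x
    · rw [Real.coe_toNNReal _ hL0, Real.coe_toNNReal _ (by positivity)]
      simp
  obtain ⟨α, h0, hα⟩ := hpl.exists_eq_forall_mem_Icc_hasDerivWithinAt₀
  exact ⟨α, h0, fun t ht => (hα t (Ioo_subset_Icc_self ht)).hasDerivAt (Icc_mem_nhds ht.1 ht.2)⟩

/-- An autonomous bounded Lipschitz field has global solutions. -/
theorem exists_global_of_bounded [CompleteSpace E] {f : E → E} {K : NNReal} {L : ℝ}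
    (hK : LipschitzWith K f) (hL : ∀ x, ‖f x‖ ≤ L) (t₀ : ℝ) (x₀ : E) :
    ∃ α : ℝ → E, α t₀ = x₀ ∧ ∀ t, HasDerivAt α (f (α t)) t :=
  exists_global_of_forall_Ioo (f := fun _ => f) (fun _ => ⟨K, fun _ _ => hK⟩)
    fun _ hT => exists_Ioo_of_bounded (f := fun _ => f) x₀ hT (fun _ _ => hK)
      (fun _ => continuous_const) (fun _ _ => hL)

/-- The truncation `x ↦ (R / max R ‖x‖) • x` onto the ball of radius `R`. -/
noncomputable def truncate (R : ℝ) (x : E) : E := (R / max R ‖x‖) • x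

theorem norm_truncate_le {R : ℝ} (hR : 0 < R) (x : E) : ‖truncate R x‖ ≤ ‖x‖ := by
  have hm : 0 < max R ‖x‖ := lt_max_of_lt_left hR
  rw [truncate, norm_smul, Real.norm_of_nonneg (by positivity)]
  exact mul_le_of_le_one_left (norm_nonneg _) ((div_le_one hm).2 (le_max_left _ _))

theorem norm_truncate_le_radius {R : ℝ} (hR : 0 < R) (x : E) : ‖truncate R x‖ ≤ R := by
  have hm : 0 < max R ‖x‖ := lt_max_of_lt_left hR
  rw [truncate, norm_smul, Real.norm_of_nonneg (by positivity), div_mul_eq_mul_div,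
    div_le_iff₀ hm]
  exact mul_le_mul_of_nonneg_left (le_max_right _ _) hR.le

theorem truncate_of_norm_le {R : ℝ} (hR : 0 < R) {x : E} (hx : ‖x‖ ≤ R) : truncate R x = x := by
  rw [truncate, max_eq_left hx, div_self hR.ne', one_smul]

theorem norm_truncate_sub_le {R : ℝ} (hR : 0 < R) (x y : E) :
    ‖truncate R x - truncate R y‖ ≤ 2 * ‖x - y‖ := by
  have hx : 0 < max R ‖x‖ := lt_max_of_lt_left hR
  have hy : 0 < max R ‖y‖ := lt_max_of_lt_left hR
  have e : truncate R x - truncate R y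
      = (R / max R ‖x‖) • (x - y) + (R / max R ‖x‖ - R / max R ‖y‖) • y := by
    simp only [truncate, smul_sub, sub_smul]; abel
  have h1 : ‖(R / max R ‖x‖) • (x - y)‖ ≤ ‖x - y‖ := by
    rw [norm_smul, Real.norm_of_nonneg (by positivity)]
    exact mul_le_of_le_one_left (norm_nonneg _) ((div_le_one hx).2 (le_max_left _ _))
  have h2 : ‖(R / max R ‖x‖ - R / max R ‖y‖) • y‖ ≤ ‖x - y‖ := by
    have e2 : R / max R ‖x‖ - R / max R ‖y‖
        = (R / max R ‖x‖) * ((max R ‖y‖ - max R ‖x‖) / max R ‖y‖) := by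
      field_simp
    have h3 : |max R ‖y‖ - max R ‖x‖| ≤ ‖x - y‖ := by
      refine (abs_max_sub_max_le_max R ‖y‖ R ‖x‖).trans ?_
      rw [sub_self, abs_zero, max_le_iff, norm_sub_rev x y]
      exact ⟨norm_nonneg _, abs_norm_sub_norm_le _ _⟩
    rw [norm_smul, e2, norm_mul, Real.norm_of_nonneg (by positivity : 0 ≤ R / max R ‖x‖),
      norm_div, Real.norm_of_nonneg hy.le, mul_assoc]
    rw [div_mul_eq_mul_div (‖max R ‖y‖ - max R ‖x‖‖)]
    calc R / max R ‖x‖ * (‖max R ‖y‖ - max R ‖x‖‖ * ‖y‖ / max R ‖y‖)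
        ≤ 1 * (‖max R ‖y‖ - max R ‖x‖‖ * ‖y‖ / max R ‖y‖) :=
          mul_le_mul_of_nonneg_right ((div_le_one hx).2 (le_max_left _ _)) (by positivity)
      _ ≤ ‖x - y‖ := by
          rw [one_mul, div_le_iff₀ hy]
          exact mul_le_mul h3 (le_max_right _ _) (norm_nonneg _) (norm_nonneg _)
  rw [e]
  exact (norm_add_le _ _).trans (by linarith)

end ODE

section Linear

attribute [local instance] Matrix.linftyOpNormedAddCommGroup Matrix.linftyOpNormedSpace

variable {n : Type*} [Fintype n]

theorem hasDerivAt_mulVec (C : Matrix n n ℂ) {z : ℝ → n → ℂ} {z' : n → ℂ} {x : ℝ}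
    (h : HasDerivAt z z' x) : HasDerivAt (fun s => C *ᵥ z s) (C *ᵥ z') x :=
  (((Matrix.mulVecLin C).restrictScalars ℝ).toContinuousLinearMap.hasFDerivAt.comp_hasDerivAt x h :)

/-- Linear systems with continuous coefficients have global solutions. -/
theorem exists_solution_linear {N : ℝ → Matrix n n ℂ} (hN : Continuous N) (t₀ : ℝ) (x₀ : n → ℂ) :
    ∃ α : ℝ → n → ℂ, α t₀ = x₀ ∧ ∀ t, HasDerivAt α (N t *ᵥ α t) t := by
  have bound : ∀ T : ℝ, ∃ K : ℝ, 1 ≤ K ∧ ∀ t ∈ Icc (t₀ - T) (t₀ + T), ‖N t‖ ≤ K := by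
    intro T
    obtain ⟨C, hC⟩ := isCompact_Icc.exists_bound_of_continuousOn
      (s := Icc (t₀ - T) (t₀ + T)) hN.continuousOn
    exact ⟨max 1 C, le_max_left _ _, fun t ht => (hC t ht).trans (le_max_right _ _)⟩
  refine exists_global_of_forall_Ioo (f := fun t x => N t *ᵥ x) (fun T => ?_) (fun T hT => ?_)
  · obtain ⟨K, hK1, hK⟩ := bound T
    refine ⟨K.toNNReal, fun t ht => LipschitzWith.of_dist_le_mul fun x y => ?_⟩
    rw [dist_eq_norm, dist_eq_norm, ← Matrix.mulVec_sub, Real.coe_toNNReal _ (by linarith)]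
    exact (Matrix.linfty_opNorm_mulVec _ _).trans
      (mul_le_mul_of_nonneg_right (hK t (Ioo_subset_Icc_self ht)) (norm_nonneg _))
  · obtain ⟨K, hK1, hK⟩ := bound T
    set R : ℝ := (‖x₀‖ + 1) * Real.exp (K * T) with hR
    have hR0 : 0 < R := by positivity
    obtain ⟨α, h0, hα⟩ := exists_Ioo_of_bounded (f := fun t x => N t *ᵥ truncate R x) (t₀ := t₀)
      (T := T) (L := K * R) (K := (K * 2).toNNReal) x₀ hT
      (fun t ht => LipschitzWith.of_dist_le_mul fun x y => by
        rw [dist_eq_norm, dist_eq_norm, ← Matrix.mulVec_sub, Real.coe_toNNReal _ (by linarith)]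
        refine (Matrix.linfty_opNorm_mulVec _ _).trans ?_
        rw [mul_assoc]
        exact mul_le_mul (hK t ht) (norm_truncate_sub_le hR0 x y) (norm_nonneg _) (by linarith))
      (fun x => hN.matrix_mulVec continuous_const)
      (fun t ht x => (Matrix.linfty_opNorm_mulVec _ _).trans
        (mul_le_mul (hK t ht) (norm_truncate_le_radius hR0 x) (norm_nonneg _) (by linarith)))
    refine ⟨α, h0, fun t ht => ?_⟩
    have hle : ‖α t‖ ≤ R := by
      set r := |t - t₀| with hr
      have hrT : r < T := abs_lt.2 ⟨by linarith [ht.1], by linarith [ht.2]⟩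
      have hab := abs_le.1 hr.symm.le
      have hsub : ∀ s ∈ Icc (t₀ - r) (t₀ + r), s ∈ Ioo (t₀ - T) (t₀ + T) :=
        fun s hs => ⟨by linarith [hs.1], by linarith [hs.2]⟩
      have := norm_le_exp_of_norm_deriv_le (d := α) (A := t₀ - r) (B := t₀ + r) (G := 0) hK1 le_rfl
        (fun s hs => hα s (hsub s hs))
        (fun s hs => by
          rw [add_zero]
          exact (Matrix.linfty_opNorm_mulVec _ _).trans
            (mul_le_mul (hK s (Ioo_subset_Icc_self (hsub s hs))) (norm_truncate_le hR0 _)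
              (norm_nonneg _) (by linarith)))
        (x := t) (y := t₀) ⟨by linarith, by linarith⟩
        ⟨by linarith [abs_nonneg (t - t₀)], by linarith [abs_nonneg (t - t₀)]⟩
      rw [h0, add_zero] at this
      refine this.trans (mul_le_mul (by linarith) (Real.exp_le_exp.2 ?_) (by positivity)
        (by positivity))
      exact mul_le_mul_of_nonneg_left hrT.le (by linarith)
    have := hα t ht
    rwa [truncate_of_norm_le hR0 hle] at this

end Linear

section Decay

variable {E : Type*} [NormedAddCommGroup E] [NormedSpace ℂ E]

/-- `J` is a set on which one can integrate from any of its points up to the limit `l`. -/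
def ReachesLimit (J : Set ℝ) (l : Filter ℝ) : Prop :=
  ∀ x ∈ J, ∀ᶠ s in l, x ≤ s ∧ Icc x s ⊆ J

theorem reachesLimit_Ici (X : ℝ) : ReachesLimit (Ici X) atTop := fun x hx => by
  filter_upwards [eventually_ge_atTop x] with s hs
  exact ⟨hs, fun y hy => le_trans hx hy.1⟩

theorem reachesLimit_Icc (X T : ℝ) : ReachesLimit (Icc X T) (pure T) := fun _ hx =>
  eventually_pure.2 ⟨hx.2, fun _ hy => ⟨hx.1.trans hy.1, hy.2⟩⟩

/-- A solution of `y' = k y + p` with `Re k ≥ κ` that is determined by its behaviour at the upper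
end inherits the exponential weight of the forcing. -/
theorem norm_le_of_forcing {k : ℝ → ℂ} (hk : Continuous k) {κ η G : ℝ} {J : Set ℝ} {l : Filter ℝ}
    [l.NeBot] (hJ : ReachesLimit J l) {y p : ℝ → E}
    (hy : ∀ x ∈ J, HasDerivAt y (k x • y x + p x) x) (hκ : ∀ x ∈ J, κ ≤ (k x).re)
    (hp : ∀ x ∈ J, ‖p x‖ ≤ G * Real.exp (-η * x)) (hη : 0 < κ + η)
    (hlim : Tendsto (fun s => Real.exp (-κ * s) * ‖y s‖) l (𝓝 0)) :
    ∀ x ∈ J, ‖y x‖ ≤ G / (κ + η) * Real.exp (-η * x) := by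
  intro x hx
  set K : ℝ → ℂ := fun s => ∫ τ in (0 : ℝ)..s, k τ with hKdef
  have hK : ∀ s, HasDerivAt K (k s) s := fun s => hk.integral_hasStrictDerivAt 0 s |>.hasDerivAt
  have main : ∀ s, x ≤ s → Icc x s ⊆ J →
      ‖y x‖ ≤ G / (κ + η) * Real.exp (-η * x) + Real.exp (κ * x) * (Real.exp (-κ * s) * ‖y s‖) := by
    intro s hxs hsub
    have hmono : MonotoneOn (fun τ => (K τ).re - κ * τ) (Icc x s) := by
      have hd : ∀ τ, HasDerivAt (fun τ => (K τ).re - κ * τ) ((k τ).re - κ) τ := fun τ => by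
        have h1 : HasDerivAt (fun τ => (K τ).re) (k τ).re τ :=
          Complex.reCLM.hasFDerivAt.comp_hasDerivAt τ (hK τ)
        exact (h1.sub ((hasDerivAt_id τ).const_mul κ)).congr_deriv (by simp)
      refine monotoneOn_of_deriv_nonneg (convex_Icc _ _)
        (fun τ _ => (hd τ).continuousAt.continuousWithinAt)
        (fun τ _ => (hd τ).differentiableAt.differentiableWithinAt) fun τ hτ => ?_
      rw [interior_Icc] at hτ
      rw [(hd τ).deriv]
      linarith [hκ τ (hsub (Ioo_subset_Icc_self hτ))]
    have hexp : ∀ τ ∈ Icc x s, ‖Complex.exp (K x - K τ)‖ ≤ Real.exp (-κ * (τ - x)) := by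
      intro τ hτ
      rw [Complex.norm_exp, Real.exp_le_exp, Complex.sub_re]
      have := hmono (left_mem_Icc.2 hxs) hτ hτ.1
      simp only at this
      linarith
    set u : ℝ → E := fun τ => Complex.exp (K x - K τ) • y τ with hu
    have hud : ∀ τ ∈ Icc x s, HasDerivAt u (Complex.exp (K x - K τ) • p τ) τ := by
      intro τ hτ
      have h1 : HasDerivAt (fun τ => Complex.exp (K x - K τ))
          (Complex.exp (K x - K τ) * (-k τ)) τ := by
        simpa using ((hK τ).const_sub (K x)).cexp
      have h2 := h1.smul (hy τ (hsub hτ))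
      refine h2.congr_deriv ?_
      rw [smul_add, smul_smul, mul_neg, neg_smul]
      abel
    set B : ℝ → ℝ := fun τ => G / (κ + η) * (Real.exp (-η * x)
      - Real.exp (κ * x) * Real.exp (-(κ + η) * τ)) with hB
    have hBd : ∀ τ, HasDerivAt B (G * (Real.exp (κ * x) * Real.exp (-(κ + η) * τ))) τ := by
      intro τ
      have h1 : HasDerivAt (fun τ : ℝ => Real.exp (-(κ + η) * τ))
          (Real.exp (-(κ + η) * τ) * (-(κ + η))) τ := by
        simpa using ((hasDerivAt_id τ).const_mul (-(κ + η))).exp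
      have h2 := ((h1.const_mul (Real.exp (κ * x))).const_sub (Real.exp (-η * x))).const_mul
        (G / (κ + η))
      refine h2.congr_deriv ?_
      have := hη.ne'
      field_simp
    have hBx : B x = 0 := by
      simp only [hB, ← Real.exp_add]
      rw [show κ * x + -(κ + η) * x = -η * x by ring]; simp
    have hle := image_norm_le_of_norm_deriv_right_le_deriv_boundary (f := fun τ => u τ - u x)
      (a := x) (b := s)
      (fun τ hτ => ((hud τ hτ).sub_const _).continuousAt.continuousWithinAt)
      (fun τ hτ => ((hud τ (Ico_subset_Icc_self hτ)).sub_const _).hasDerivWithinAt)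
      (B := B) (by simp [hBx]) hBd
      (fun τ hτ => by
        rw [norm_smul]
        have h1 := hexp τ (Ico_subset_Icc_self hτ)
        have h2 := hp τ (hsub (Ico_subset_Icc_self hτ))
        calc ‖Complex.exp (K x - K τ)‖ * ‖p τ‖
            ≤ Real.exp (-κ * (τ - x)) * (G * Real.exp (-η * τ)) :=
              mul_le_mul h1 h2 (norm_nonneg _) (Real.exp_pos _).le
          _ = G * (Real.exp (κ * x) * Real.exp (-(κ + η) * τ)) := by
              rw [mul_left_comm, ← Real.exp_add, ← Real.exp_add]; congr 2; ring)
      (right_mem_Icc.2 hxs)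
    have hux : u x = y x := by simp [hu]
    have hG : 0 ≤ G := by
      have := (norm_nonneg _).trans (hp x hx)
      exact nonneg_of_mul_nonneg_left this (Real.exp_pos _)
    have hBs : B s ≤ G / (κ + η) * Real.exp (-η * x) := by
      refine mul_le_mul_of_nonneg_left ?_ (by positivity)
      have : 0 ≤ Real.exp (κ * x) * Real.exp (-(κ + η) * s) := by positivity
      linarith
    have hus : ‖u s‖ ≤ Real.exp (κ * x) * (Real.exp (-κ * s) * ‖y s‖) := by
      rw [hu, norm_smul, ← mul_assoc, ← Real.exp_add]
      refine mul_le_mul_of_nonneg_right ((hexp s (right_mem_Icc.2 hxs)).trans (le_of_eq ?_))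
        (norm_nonneg _)
      congr 1; ring
    calc ‖y x‖ = ‖u s - (u s - u x)‖ := by rw [sub_sub_cancel, hux]
      _ ≤ ‖u s‖ + ‖u s - u x‖ := norm_sub_le _ _
      _ ≤ _ := by linarith
  refine ge_of_tendsto (f := fun s => G / (κ + η) * Real.exp (-η * x)
    + Real.exp (κ * x) * (Real.exp (-κ * s) * ‖y s‖)) (x := l) ?_
    ((hJ x hx).mono fun s hs => main s hs.1 hs.2)
  simpa using (hlim.const_mul (Real.exp (κ * x))).const_add (G / (κ + η) * Real.exp (-η * x))

end Decay

section Triangular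

attribute [local instance] Matrix.linftyOpNormedRing Matrix.linftyOpNormedAlgebra

variable {n : Type*} [Fintype n] [DecidableEq n]

/-- The constant in the weighted bound for triangular systems. -/
noncomputable def decayConst (b η : ℝ) : ℝ := (b + 1) ^ 2 * (1 / η + 1) ^ 2 / η

theorem decayConst_nonneg {b η : ℝ} (hη : 0 < η) : 0 ≤ decayConst b η := by
  unfold decayConst; positivity

/-- If `B` is annihilated by `(B - β) (B - α) B` with `Re α, Re β ≥ 0`, solutions of `d' = B d + p`
that vanish at the upper end inherit the exponential weight of the forcing. -/
theorem norm_le_of_annihilated {B : Matrix n n ℂ} {α β : ℂ} {b η G : ℝ} (hη : 0 < η)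
    (hBann : (B - β • (1 : Matrix n n ℂ)) * ((B - α • (1 : Matrix n n ℂ)) * B) = 0)
    (hα : 0 ≤ α.re) (hβ : 0 ≤ β.re) (hb : ‖B‖ ≤ b) (hbα : ‖B - α • (1 : Matrix n n ℂ)‖ ≤ b)
    {J : Set ℝ} {l : Filter ℝ} [l.NeBot] (hJ : ReachesLimit J l) {d p : ℝ → n → ℂ}
    (hd : ∀ x ∈ J, HasDerivAt d (B *ᵥ d x + p x) x)
    (hp : ∀ x ∈ J, ‖p x‖ ≤ G * Real.exp (-η * x)) (hlim : Tendsto d l (𝓝 0)) :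
    ∀ x ∈ J, ‖d x‖ ≤ decayConst b η * G * Real.exp (-η * x) := by
  have hb0 : 0 ≤ b := (norm_nonneg _).trans hb
  have tend : ∀ C : Matrix n n ℂ,
      Tendsto (fun s => Real.exp (-0 * s) * ‖C *ᵥ d s‖) l (𝓝 0) := by
    intro C
    have hc : Continuous fun v : n → ℂ => C *ᵥ v := continuous_const.matrix_mulVec continuous_id
    have := ((hc.tendsto 0).comp hlim).norm
    simpa using this
  have e3 : ∀ x ∈ J, ‖((B - α • (1 : Matrix n n ℂ)) * B) *ᵥ d x‖
      ≤ (b * b * G) / (0 + η) * Real.exp (-η * x) := by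
    refine norm_le_of_forcing (k := fun _ => β) continuous_const hJ
      (p := fun x => ((B - α • (1 : Matrix n n ℂ)) * B) *ᵥ p x) (fun x hx => ?_) (fun _ _ => hβ)
      (fun x hx => ?_) (by linarith) (tend _)
    · refine (hasDerivAt_mulVec ((B - α • (1 : Matrix n n ℂ)) * B) (hd x hx)).congr_deriv ?_
      rw [Matrix.mulVec_add, Matrix.mulVec_mulVec]
      congr 1
      have hcomm : (B - α • (1 : Matrix n n ℂ)) * B * B = β • ((B - α • (1 : Matrix n n ℂ)) * B) := by
        have h2 : (B - α • (1 : Matrix n n ℂ)) * B * B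
            = B * ((B - α • (1 : Matrix n n ℂ)) * B) := by
          simp [sub_mul, mul_sub, mul_assoc]
        rw [h2, ← sub_eq_zero, ← hBann, sub_mul _ _ ((B - α • (1 : Matrix n n ℂ)) * B), smul_mul_assoc,
          one_mul]
      rw [hcomm, Matrix.smul_mulVec]
    · refine (Matrix.linfty_opNorm_mulVec _ _).trans ?_
      rw [mul_assoc (b * b)]
      exact mul_le_mul ((norm_mul_le _ _).trans (mul_le_mul hbα hb (norm_nonneg _) hb0)) (hp x hx)
        (norm_nonneg _) (by positivity)
  have e2 : ∀ x ∈ J, ‖B *ᵥ d x‖ ≤ ((b * b * G) / (0 + η) + b * G) / (0 + η) * Real.exp (-η * x) := by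
    refine norm_le_of_forcing (k := fun _ => α) continuous_const hJ
      (p := fun x => ((B - α • (1 : Matrix n n ℂ)) * B) *ᵥ d x + B *ᵥ p x) (fun x hx => ?_)
      (fun _ _ => hα) (fun x hx => ?_) (by linarith) (tend _)
    · refine (hasDerivAt_mulVec B (hd x hx)).congr_deriv ?_
      rw [Matrix.mulVec_add, Matrix.mulVec_mulVec, sub_mul, Matrix.sub_mulVec, smul_mul_assoc, one_mul,
        Matrix.smul_mulVec]
      abel
    · refine (norm_add_le _ _).trans ?_
      rw [add_mul, mul_assoc b G]
      exact add_le_add (e3 x hx) ((Matrix.linfty_opNorm_mulVec _ _).trans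
        (mul_le_mul hb (hp x hx) (norm_nonneg _) hb0))
  have e1 : ∀ x ∈ J, ‖d x‖ ≤ (((b * b * G) / (0 + η) + b * G) / (0 + η) + G) / (0 + η)
      * Real.exp (-η * x) := by
    refine norm_le_of_forcing (k := fun _ => 0) continuous_const hJ
      (p := fun x => B *ᵥ d x + p x) (fun x hx => ?_)
      (fun _ _ => by simp) (fun x hx => ?_) (by linarith) ?_
    · simpa using hd x hx
    · refine (norm_add_le _ _).trans ?_
      rw [add_mul]
      exact add_le_add (e2 x hx) (hp x hx)
    · simpa using tend 1
  intro x hx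
  refine (e1 x hx).trans (mul_le_mul_of_nonneg_right ?_ (Real.exp_pos _).le)
  have hG : 0 ≤ G := nonneg_of_mul_nonneg_left ((norm_nonneg _).trans (hp x hx)) (Real.exp_pos _)
  have : (((b * b * G) / (0 + η) + b * G) / (0 + η) + G) / (0 + η)
      = ((b / η) ^ 2 + b / η + 1) / η * G := by
    rw [zero_add]; field_simp
  rw [this, decayConst]
  refine mul_le_mul_of_nonneg_right ?_ hG
  refine div_le_div_of_nonneg_right ?_ hη.le
  have h1 : 0 ≤ 1 / η := by positivity
  rw [← mul_pow, div_eq_mul_one_div b η]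
  generalize 1 / η = r at *
  have : 0 ≤ b * r := by positivity
  nlinarith

/-- Weighted bound for perturbations of triangular systems. -/
theorem norm_le_of_perturbed {B : Matrix n n ℂ} {α β : ℂ} {b η C G X : ℝ} (hη : 0 < η)
    (hBann : (B - β • (1 : Matrix n n ℂ)) * ((B - α • (1 : Matrix n n ℂ)) * B) = 0)
    (hα : 0 ≤ α.re) (hβ : 0 ≤ β.re) (hb : ‖B‖ ≤ b) (hbα : ‖B - α • (1 : Matrix n n ℂ)‖ ≤ b)
    (hC : 0 ≤ C) (hG : 0 ≤ G)
    (hsmall : decayConst b η * C * Real.exp (-η * X) ≤ 1 / 2)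
    {J : Set ℝ} {l : Filter ℝ} [l.NeBot] (hJ : ReachesLimit J l) (hJX : ∀ x ∈ J, X ≤ x)
    {Θ : ℝ → Matrix n n ℂ} {d p : ℝ → n → ℂ}
    (hd : ∀ x ∈ J, HasDerivAt d ((B + Θ x) *ᵥ d x + p x) x)
    (hΘ : ∀ x ∈ J, ‖Θ x‖ ≤ C * Real.exp (-η * x))
    (hp : ∀ x ∈ J, ‖p x‖ ≤ G * Real.exp (-η * x)) (hlim : Tendsto d l (𝓝 0))
    (hbdd : ∃ S, ∀ x ∈ J, ‖d x‖ ≤ S) :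
    ∀ x ∈ J, ‖d x‖ ≤ 2 * decayConst b η * G * Real.exp (-η * x) := by
  set κ := decayConst b η with hκ
  have hκ0 : 0 ≤ κ := decayConst_nonneg hη
  have step : ∀ S, (∀ x ∈ J, ‖d x‖ ≤ S) → ∀ x ∈ J, ‖d x‖ ≤ κ * (C * S + G) * Real.exp (-η * x) := by
    intro S hS
    refine norm_le_of_annihilated (p := fun x => Θ x *ᵥ d x + p x) hη hBann hα hβ hb hbα hJ
      (fun x hx => ?_) (fun x hx => ?_) hlim
    · refine (hd x hx).congr_deriv ?_
      rw [Matrix.add_mulVec, add_assoc]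
    · have h1 := (Matrix.linfty_opNorm_mulVec (Θ x) (d x)).trans
        (mul_le_mul (hΘ x hx) (hS x hx) (norm_nonneg _) (by positivity))
      refine (norm_add_le _ _).trans ((add_le_add h1 (hp x hx)).trans (le_of_eq ?_))
      ring
  obtain ⟨S₀, hS₀⟩ := hbdd
  rcases J.eq_empty_or_nonempty with hJe | ⟨x₁, hx₁⟩
  · simp [hJe]
  set e := Real.exp (-η * X) with he
  have hle : ∀ x ∈ J, Real.exp (-η * x) ≤ e := fun x hx => Real.exp_le_exp.2 (by
    nlinarith [hJX x hx])
  have hbd : BddAbove ((fun x => ‖d x‖) '' J) := ⟨S₀, by rintro _ ⟨x, hx, rfl⟩; exact hS₀ x hx⟩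
  set S := sSup ((fun x => ‖d x‖) '' J) with hSdef
  have hS : ∀ x ∈ J, ‖d x‖ ≤ S := fun x hx => le_csSup hbd ⟨x, hx, rfl⟩
  have hS0 : 0 ≤ S := (norm_nonneg _).trans (hS x₁ hx₁)
  have hS2 : S ≤ κ * (C * S + G) * e := by
    refine csSup_le ⟨_, x₁, hx₁, rfl⟩ ?_
    rintro _ ⟨x, hx, rfl⟩
    exact (step S hS x hx).trans (mul_le_mul_of_nonneg_left (hle x hx) (by positivity))
  have hS3 : S ≤ 2 * κ * G * e := by nlinarith
  intro x hx
  refine (step S hS x hx).trans (mul_le_mul_of_nonneg_right ?_ (Real.exp_pos _).le)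
  have : C * S ≤ C * (2 * κ * G * e) := mul_le_mul_of_nonneg_left hS3 hC
  have h2 : C * (2 * κ * G * e) ≤ G := by nlinarith
  nlinarith

/-- A function that converges at `+∞` and is continuous is bounded on half-lines. -/
theorem exists_bound_Ici {F : Type*} [NormedAddCommGroup F] {d : ℝ → F} {v : F} {X : ℝ}
    (hc : ContinuousOn d (Ici X)) (hlim : Tendsto d atTop (𝓝 v)) : ∃ S, ∀ x ∈ Ici X, ‖d x‖ ≤ S := by
  have h1 : ∀ᶠ x in atTop, ‖d x‖ ≤ ‖v‖ + 1 :=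
    (hlim.norm.eventually (gt_mem_nhds (lt_add_one ‖v‖))).mono fun _ h => le_of_lt h
  obtain ⟨T, hT⟩ := eventually_atTop.1 h1
  obtain ⟨S, hS⟩ := isCompact_Icc.exists_bound_of_continuousOn
    (hc.mono (Icc_subset_Ici_self : Icc X T ⊆ Ici X))
  refine ⟨max S (‖v‖ + 1), fun x hx => ?_⟩
  rcases le_total x T with h | h
  · exact (hS x ⟨hx, h⟩).trans (le_max_left _ _)
  · exact (hT x h).trans (le_max_right _ _)

end Triangular

section Modes

attribute [local instance] Matrix.linftyOpNormedRing Matrix.linftyOpNormedAlgebra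

/-- `W` is a solution of `W' = N(x) W` asymptotic to `e^{μ x} V` as `x → +∞`. -/
def IsModeAtTop (N : ℝ → Matrix (Fin 3) (Fin 3) ℂ) (μ : ℂ) (V : Fin 3 → ℂ)
    (W : ℝ → Fin 3 → ℂ) : Prop :=
  SolvesODE N W ∧ Tendsto (fun x : ℝ => Complex.exp (-μ * (x : ℂ)) • W x) atTop (𝓝 V)

theorem hasDerivAt_exp_smul {W : ℝ → Fin 3 → ℂ} {M : Matrix (Fin 3) (Fin 3) ℂ} {x : ℝ} (μ : ℂ)
    (h : HasDerivAt W (M *ᵥ W x) x) :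
    HasDerivAt (fun x : ℝ => Complex.exp (μ * (x : ℂ)) • W x)
      ((M + μ • (1 : Matrix (Fin 3) (Fin 3) ℂ)) *ᵥ (Complex.exp (μ * (x : ℂ)) • W x)) x := by
  have h1 : HasDerivAt (fun x : ℝ => Complex.exp (μ * (x : ℂ))) (Complex.exp (μ * x) * μ) x := by
    have := ((Complex.ofRealCLM.hasDerivAt (x := x)).const_mul μ).cexp
    simpa using this
  refine (h1.smul h).congr_deriv ?_
  rw [Matrix.add_mulVec, Matrix.mulVec_smul, Matrix.smul_mulVec, Matrix.one_mulVec, smul_smul,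
    mul_comm (Complex.exp _) μ]

theorem tendsto_exp_neg_mul {η : ℝ} (hη : 0 < η) :
    Tendsto (fun x : ℝ => Real.exp (-η * x)) atTop (𝓝 0) := by
  refine Real.tendsto_exp_atBot.comp ?_
  exact tendsto_id.const_mul_atTop_of_neg (by linarith)

theorem exists_nonneg_exp_le {η : ℝ} (hη : 0 < η) (C : ℝ) {ε : ℝ} (hε : 0 < ε) (X : ℝ) :
    ∃ T, X ≤ T ∧ 0 ≤ T ∧ ∀ x, T ≤ x → C * Real.exp (-η * x) ≤ ε := by
  have h : Tendsto (fun x : ℝ => C * Real.exp (-η * x)) atTop (𝓝 0) := by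
    simpa using (tendsto_exp_neg_mul hη).const_mul C
  obtain ⟨T, hT⟩ := eventually_atTop.1 (h.eventually (ge_mem_nhds hε))
  exact ⟨max T (max X 0), (le_max_left _ _).trans (le_max_right _ _),
    (le_max_right _ _).trans (le_max_right _ _), fun x hx => hT x ((le_max_left _ _).trans hx)⟩

/-- A solution asymptotic to a prescribed eigenvector exists when the coefficients converge
exponentially and no eigenvalue has smaller real part. -/
theorem exists_modeAtTop {N : ℝ → Matrix (Fin 3) (Fin 3) ℂ} (hN : Continuous N)
    {A : Matrix (Fin 3) (Fin 3) ℂ} {μ α β : ℂ} {C η : ℝ} (hη : 0 < η) (hC : 0 ≤ C)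
    (hΘ : ∀ x, 0 ≤ x → ‖N x - A‖ ≤ C * Real.exp (-η * x))
    (hann : (A - β • (1 : Matrix (Fin 3) (Fin 3) ℂ)) *
      ((A - α • (1 : Matrix (Fin 3) (Fin 3) ℂ)) * (A - μ • (1 : Matrix (Fin 3) (Fin 3) ℂ))) = 0)
    (hα : μ.re ≤ α.re) (hβ : μ.re ≤ β.re) {V : Fin 3 → ℂ} (hV : A *ᵥ V = μ • V) :
    ∃ W, IsModeAtTop N μ V W := by
  set B : Matrix (Fin 3) (Fin 3) ℂ := A - μ • (1 : Matrix (Fin 3) (Fin 3) ℂ) with hB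
  have hBα : ∀ τ : ℂ, B - (τ - μ) • (1 : Matrix (Fin 3) (Fin 3) ℂ) = A - τ • (1 : Matrix (Fin 3) (Fin 3) ℂ) := by
    intro τ; rw [hB, sub_smul]; abel
  have hBV : B *ᵥ V = 0 := by
    rw [hB, Matrix.sub_mulVec, hV, Matrix.smul_mulVec, Matrix.one_mulVec, sub_self]
  set b := max ‖B‖ ‖B - (α - μ) • (1 : Matrix (Fin 3) (Fin 3) ℂ)‖ with hb
  obtain ⟨X, -, hX0, hX⟩ := exists_nonneg_exp_le hη (decayConst b η * C)
    (by norm_num : (0 : ℝ) < 1 / 2) 0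
  set N' : ℝ → Matrix (Fin 3) (Fin 3) ℂ := fun x => N x + (-μ) • (1 : Matrix (Fin 3) (Fin 3) ℂ) with hN'
  have hN'c : Continuous N' := hN.add continuous_const
  have hN'eq : ∀ x, N' x = B + (N x - A) := fun x => by
    simp only [hN', hB, neg_smul]; abel
  choose z hzT hz using fun T : ℝ => exists_solution_linear hN'c T V
  have bound : ∀ T, ∀ x ∈ Icc X T,
      ‖z T x - V‖ ≤ 2 * decayConst b η * (C * ‖V‖) * Real.exp (-η * x) := by
    intro T
    have hder : ∀ x, HasDerivAt (fun x => z T x - V)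
        ((B + (N x - A)) *ᵥ (z T x - V) + (N x - A) *ᵥ V) x := fun x => by
      refine ((hz T x).sub_const V).congr_deriv ?_
      rw [hN'eq, Matrix.mulVec_sub, Matrix.add_mulVec _ _ V, hBV]; abel
    refine norm_le_of_perturbed (X := X) (C := C) (p := fun x => (N x - A) *ᵥ V) hη
      (α := α - μ) (β := β - μ) (B := B) ?_
      (by rw [Complex.sub_re]; linarith) (by rw [Complex.sub_re]; linarith) (le_max_left _ _)
      (le_max_right _ _) hC (by positivity) (hX X le_rfl) (reachesLimit_Icc X T)
      (fun x hx => hx.1) (fun x _ => hder x) (fun x hx => hΘ x (hX0.trans hx.1)) (fun x hx => ?_) ?_ ?_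
    · rw [hBα, hBα]; exact hann
    · refine (Matrix.linfty_opNorm_mulVec _ _).trans ?_
      rw [mul_right_comm]
      exact mul_le_mul_of_nonneg_right (hΘ x (hX0.trans hx.1)) (norm_nonneg _)
    · rw [tendsto_pure_left]
      intro s hs
      rw [hzT, sub_self]
      exact mem_of_mem_nhds hs
    · exact isCompact_Icc.exists_bound_of_continuousOn
        (fun x _ => (hder x).continuousAt.continuousWithinAt)
  set R := 2 * decayConst b η * (C * ‖V‖) * Real.exp (-η * X) with hR
  obtain ⟨c, -, hc⟩ := (isCompact_closedBall V R).ultrafilter_le_nhds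
    ((Ultrafilter.of (atTop : Filter ℝ)).map fun T => z T X) (by
      rw [Ultrafilter.coe_map, le_principal_iff, mem_map]
      refine Ultrafilter.of_le _ ?_
      filter_upwards [eventually_ge_atTop X] with T hT
      rw [mem_preimage, Metric.mem_closedBall, dist_eq_norm]
      exact bound T X ⟨le_rfl, hT⟩)
  obtain ⟨y, hyX, hy⟩ := exists_solution_linear hN'c X c
  have hconv : ∀ x, X ≤ x → Tendsto (fun T => z T x) (Ultrafilter.of (atTop : Filter ℝ))
      (𝓝 (y x)) := by
    intro x hx
    obtain ⟨K, hK⟩ := isCompact_Icc.exists_bound_of_continuousOn (s := Icc X x) hN'c.continuousOn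
    have hle : ∀ T, ‖z T x - y x‖ ≤ ‖z T X - y X‖ * Real.exp (max 1 K * |x - X|) := by
      intro T
      have := norm_le_exp_of_norm_deriv_le (d := fun s => z T s - y s) (K := max 1 K) (G := 0)
        (A := X) (B := x) (le_max_left _ _) le_rfl (fun s _ => (hz T s).sub (hy s))
        (fun s hs => by
          rw [add_zero, ← Matrix.mulVec_sub]
          exact (Matrix.linfty_opNorm_mulVec _ _).trans
            (mul_le_mul_of_nonneg_right ((hK s hs).trans (le_max_right _ _)) (norm_nonneg _)))
        (x := x) (y := X) ⟨hx, le_rfl⟩ ⟨le_rfl, hx⟩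
      simpa using this
    rw [tendsto_iff_norm_sub_tendsto_zero]
    have hc' : Tendsto (fun T => z T X) (Ultrafilter.of (atTop : Filter ℝ)) (𝓝 (y X)) := by
      rw [hyX]; exact hc
    refine squeeze_zero (fun _ => norm_nonneg _) hle ?_
    simpa using (tendsto_iff_norm_sub_tendsto_zero.1 hc').mul_const (Real.exp (max 1 K * |x - X|))
  have hybound : ∀ x, X ≤ x → ‖y x - V‖ ≤ 2 * decayConst b η * (C * ‖V‖) * Real.exp (-η * x) := by
    intro x hx
    refine le_of_tendsto (((hconv x hx).sub_const V).norm) ?_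
    refine Ultrafilter.of_le _ ?_
    filter_upwards [eventually_ge_atTop x] with T hT
    exact bound T x ⟨hx, hT⟩
  have hylim : Tendsto y atTop (𝓝 V) := by
    rw [tendsto_iff_norm_sub_tendsto_zero]
    refine squeeze_zero' (Eventually.of_forall fun _ => norm_nonneg _)
      ((eventually_ge_atTop X).mono hybound) ?_
    simpa using (tendsto_exp_neg_mul hη).const_mul (2 * decayConst b η * (C * ‖V‖))
  refine ⟨fun x => Complex.exp (μ * (x : ℂ)) • y x, fun x => ?_, ?_⟩
  · refine (hasDerivAt_exp_smul μ (hy x)).congr_deriv ?_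
    rw [hN']; simp
  · refine hylim.congr fun x => ?_
    rw [smul_smul, ← Complex.exp_add]
    simp

variable {ι : Type*} {l : Filter ι}

/-- Uniform convergence on compact intervals and a common exponential bound give convergence in
a weaker exponential weight. -/
theorem eventually_weighted_le {F : Type*} [NormedAddCommGroup F] {D : ι → ℝ → F} {C η η' X : ℝ}
    (hη : η' < η) (hC : ∀ᶠ i in l, ∀ x, X ≤ x → ‖D i x‖ ≤ C * Real.exp (-η * x))
    (hloc : ∀ T, ∀ ε > 0, ∀ᶠ i in l, ∀ x ∈ Icc X T, ‖D i x‖ ≤ ε) {ε : ℝ} (hε : 0 < ε) :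
    ∀ᶠ i in l, ∀ x, X ≤ x → ‖D i x‖ ≤ ε * Real.exp (-η' * x) := by
  obtain ⟨T, -, -, hT⟩ := exists_nonneg_exp_le (sub_pos.2 hη) C hε 0
  have hM : ∃ m > 0, ∀ x ∈ Icc X T, m ≤ Real.exp (-η' * x) := by
    refine ⟨Real.exp (-(|η'| * max |X| |T|)), Real.exp_pos _, fun x hx => Real.exp_le_exp.2 ?_⟩
    have h1 : |x| ≤ max |X| |T| := abs_le_max_abs_abs hx.1 hx.2
    have h2 : |η' * x| ≤ |η'| * max |X| |T| := by
      rw [abs_mul]; exact mul_le_mul_of_nonneg_left h1 (abs_nonneg _)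
    linarith [le_abs_self (η' * x)]
  obtain ⟨m, hm0, hm⟩ := hM
  filter_upwards [hC, hloc T (ε * m) (by positivity)] with i hi hi' x hx
  rcases le_total x T with h | h
  · exact (hi' x ⟨hx, h⟩).trans (mul_le_mul_of_nonneg_left (hm x ⟨hx, h⟩) hε.le)
  · refine (hi x hx).trans ?_
    have := mul_le_mul_of_nonneg_right (hT x h) (Real.exp_pos (-η' * x)).le
    rw [mul_assoc, ← Real.exp_add] at this
    convert this using 3
    ring

/-- Continuous dependence of solutions on coefficients and data, on a bounded interval. -/
theorem tendsto_solution_of_approx {N : ι → ℝ → Matrix (Fin 3) (Fin 3) ℂ}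
    {N₀ : ℝ → Matrix (Fin 3) (Fin 3) ℂ} (hN₀ : Continuous N₀) {Y : ι → ℝ → Fin 3 → ℂ}
    {Y₀ : ℝ → Fin 3 → ℂ} (hY : ∀ᶠ i in l, SolvesODE (N i) (Y i)) (hY₀ : SolvesODE N₀ Y₀)
    {A B : ℝ} (hloc : ∀ ε > 0, ∀ᶠ i in l, ∀ x ∈ Icc A B, ‖N i x - N₀ x‖ ≤ ε) {x y : ℝ}
    (hx : x ∈ Icc A B) (hy : y ∈ Icc A B) (hlim : Tendsto (fun i => Y i y) l (𝓝 (Y₀ y))) :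
    Tendsto (fun i => Y i x) l (𝓝 (Y₀ x)) := by
  obtain ⟨K, hK⟩ := isCompact_Icc.exists_bound_of_continuousOn (s := Icc A B) hN₀.continuousOn
  obtain ⟨S, hS⟩ := isCompact_Icc.exists_bound_of_continuousOn (s := Icc A B) (f := Y₀)
    (fun s _ => (hY₀ s).continuousAt.continuousWithinAt)
  have hS0 : 0 ≤ S := (norm_nonneg _).trans (hS x hx)
  have hK0 : 0 ≤ K := (norm_nonneg _).trans (hK x hx)
  set E := Real.exp ((K + 1) * |x - y|) with hE
  have hE0 : 0 < E := Real.exp_pos _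
  rw [Metric.tendsto_nhds]
  intro ε hε
  rw [Metric.tendsto_nhds] at hlim
  set ε₁ := ε / (2 * E * (S + 1)) with hε₁
  have hε₁0 : 0 < ε₁ := by positivity
  filter_upwards [hY, hloc 1 one_pos, hloc ε₁ hε₁0, hlim (ε / (2 * E)) (by positivity)]
    with i h1 h2 h3 h4
  have := norm_le_exp_of_norm_deriv_le (d := fun s => Y i s - Y₀ s) (K := K + 1) (G := ε₁ * S)
    (A := A) (B := B) (by linarith) (by positivity) (fun s _ => (h1 s).sub (hY₀ s))
    (fun s hs => by
      have e : N i s *ᵥ Y i s - N₀ s *ᵥ Y₀ s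
          = N i s *ᵥ (Y i s - Y₀ s) + (N i s - N₀ s) *ᵥ Y₀ s := by
        rw [Matrix.mulVec_sub, Matrix.sub_mulVec]; abel
      rw [e]
      refine (norm_add_le _ _).trans (add_le_add ?_ ?_)
      · refine (Matrix.linfty_opNorm_mulVec _ _).trans
          (mul_le_mul_of_nonneg_right ?_ (norm_nonneg _))
        calc ‖N i s‖ = ‖N₀ s + (N i s - N₀ s)‖ := by rw [add_sub_cancel]
          _ ≤ K + 1 := (norm_add_le _ _).trans (add_le_add (hK s hs) (h2 s hs))
      · exact (Matrix.linfty_opNorm_mulVec _ _).trans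
          (mul_le_mul (h3 s hs) (hS s hs) (norm_nonneg _) hε₁0.le)) hx hy
  rw [dist_eq_norm] at h4 ⊢
  refine this.trans_lt ?_
  have h5 : ε₁ * S * E ≤ ε / 2 := by
    have : ε₁ * ((S + 1) * E) = ε / 2 := by rw [hε₁]; field_simp
    have h6 : ε₁ * S * E ≤ ε₁ * ((S + 1) * E) := by
      rw [mul_assoc]
      exact mul_le_mul_of_nonneg_left (mul_le_mul_of_nonneg_right (by linarith) hE0.le) hε₁0.le
    linarith
  have h7 : ‖Y i y - Y₀ y‖ * E < ε / 2 := by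
    have := mul_lt_mul_of_pos_right h4 hE0
    have e : ε / (2 * E) * E = ε / 2 := by field_simp
    linarith
  rw [add_mul]
  linarith

/-- Modes at `+∞` depend continuously on the coefficients. -/
theorem tendsto_modeAtTop {N : ι → ℝ → Matrix (Fin 3) (Fin 3) ℂ}
    {N₀ : ℝ → Matrix (Fin 3) (Fin 3) ℂ} (hN₀ : Continuous N₀)
    {A : ι → Matrix (Fin 3) (Fin 3) ℂ} {A₀ : Matrix (Fin 3) (Fin 3) ℂ}
    {μ α β : ι → ℂ} {μ₀ α₀ β₀ : ℂ} {C η a : ℝ} (hη : 0 < η) (hC : 0 ≤ C)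
    (hΘ : ∀ᶠ i in l, ∀ x, 0 ≤ x → ‖N i x - A i‖ ≤ C * Real.exp (-η * x))
    (hΘ₀ : ∀ x, 0 ≤ x → ‖N₀ x - A₀‖ ≤ C * Real.exp (-η * x))
    (hann : ∀ᶠ i in l, (A i - β i • (1 : Matrix (Fin 3) (Fin 3) ℂ)) *
      ((A i - α i • (1 : Matrix (Fin 3) (Fin 3) ℂ)) * (A i - μ i • (1 : Matrix (Fin 3) (Fin 3) ℂ))) = 0)
    (hann₀ : (A₀ - β₀ • (1 : Matrix (Fin 3) (Fin 3) ℂ)) *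
      ((A₀ - α₀ • (1 : Matrix (Fin 3) (Fin 3) ℂ)) * (A₀ - μ₀ • (1 : Matrix (Fin 3) (Fin 3) ℂ))) = 0)
    (hα : ∀ᶠ i in l, (μ i).re ≤ (α i).re) (hβ : ∀ᶠ i in l, (μ i).re ≤ (β i).re)
    (hα₀ : μ₀.re ≤ α₀.re) (hβ₀ : μ₀.re ≤ β₀.re) (ha : ∀ᶠ i in l, ‖α i‖ ≤ a)
    {V : ι → Fin 3 → ℂ} {V₀ : Fin 3 → ℂ} (hV : ∀ᶠ i in l, A i *ᵥ V i = μ i • V i)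
    (hV₀ : A₀ *ᵥ V₀ = μ₀ • V₀) (hA : Tendsto A l (𝓝 A₀)) (hμ : Tendsto μ l (𝓝 μ₀))
    (hVlim : Tendsto V l (𝓝 V₀))
    (hloc : ∀ T, ∀ ε > 0, ∀ᶠ i in l, ∀ x ∈ Icc 0 T, ‖N i x - N₀ x‖ ≤ ε)
    {W : ι → ℝ → Fin 3 → ℂ} {W₀ : ℝ → Fin 3 → ℂ}
    (hW : ∀ᶠ i in l, IsModeAtTop (N i) (μ i) (V i) (W i)) (hW₀ : IsModeAtTop N₀ μ₀ V₀ W₀) :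
    Tendsto (fun i => W i 0) l (𝓝 (W₀ 0)) := by
  have a0 : ∀ i, ‖α i‖ ≤ a → 0 ≤ a := fun i hi => (norm_nonneg _).trans hi
  set B : ι → Matrix (Fin 3) (Fin 3) ℂ := fun i => A i - μ i • (1 : Matrix (Fin 3) (Fin 3) ℂ) with hB
  set B₀ : Matrix (Fin 3) (Fin 3) ℂ := A₀ - μ₀ • (1 : Matrix (Fin 3) (Fin 3) ℂ) with hB₀
  have hBlim : Tendsto B l (𝓝 B₀) := hA.sub (hμ.smul_const _)
  set b := max (‖A₀‖ + 1 + (|a| + 1) * ‖(1 : Matrix (Fin 3) (Fin 3) ℂ)‖)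
    (max (‖B₀‖ + 1) ‖A₀ - α₀ • (1 : Matrix (Fin 3) (Fin 3) ℂ)‖) with hb
  have hBb : ∀ᶠ i in l, ‖B i‖ ≤ b := by
    filter_upwards [hBlim.norm.eventually (gt_mem_nhds (lt_add_one ‖B₀‖))] with i hi
    exact hi.le.trans ((le_max_left _ _).trans (le_max_right _ _))
  have hBα : ∀ᶠ i in l, ‖A i - α i • (1 : Matrix (Fin 3) (Fin 3) ℂ)‖ ≤ b := by
    filter_upwards [hA.norm.eventually (gt_mem_nhds (lt_add_one ‖A₀‖)), ha] with i hi hi'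
    refine (norm_sub_le _ _).trans (le_trans (add_le_add hi.le ?_) (le_max_left _ _))
    rw [norm_smul]
    exact mul_le_mul_of_nonneg_right (hi'.trans (by linarith [le_abs_self a])) (norm_nonneg _)
  set η' := η / 2 with hη'
  have hη'0 : 0 < η' := by positivity
  have hweak : ∀ x : ℝ, 0 ≤ x → Real.exp (-η * x) ≤ Real.exp (-η' * x) := fun x hx =>
    Real.exp_le_exp.2 (by nlinarith)
  obtain ⟨X, -, hX0, hX⟩ := exists_nonneg_exp_le hη'0 (decayConst b η' * C)
    (by norm_num : (0 : ℝ) < 1 / 2) 0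
  set z : ι → ℝ → Fin 3 → ℂ := fun i x => Complex.exp (-μ i * (x : ℂ)) • W i x with hz
  set z₀ : ℝ → Fin 3 → ℂ := fun x => Complex.exp (-μ₀ * (x : ℂ)) • W₀ x with hz₀
  have shift : ∀ τ : ℂ, ∀ M A' : Matrix (Fin 3) (Fin 3) ℂ,
      M + (-τ) • (1 : Matrix (Fin 3) (Fin 3) ℂ) = (A' - τ • (1 : Matrix (Fin 3) (Fin 3) ℂ)) + (M - A') := by
    intro τ M A'; rw [neg_smul]; abel
  have shift2 : ∀ τ σ : ℂ, ∀ A' : Matrix (Fin 3) (Fin 3) ℂ,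
      (A' - τ • (1 : Matrix (Fin 3) (Fin 3) ℂ)) - (σ - τ) • (1 : Matrix (Fin 3) (Fin 3) ℂ)
        = A' - σ • (1 : Matrix (Fin 3) (Fin 3) ℂ) := by
    intro τ σ A'; rw [sub_smul]; abel
  have kill : ∀ (A' : Matrix (Fin 3) (Fin 3) ℂ) (τ : ℂ) (v : Fin 3 → ℂ), A' *ᵥ v = τ • v →
      (A' - τ • (1 : Matrix (Fin 3) (Fin 3) ℂ)) *ᵥ v = 0 := by
    intro A' τ v h
    rw [Matrix.sub_mulVec, h, Matrix.smul_mulVec, Matrix.one_mulVec, sub_self]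
  have hz₀d : ∀ x, HasDerivAt z₀ ((B₀ + (N₀ x - A₀)) *ᵥ z₀ x) x := fun x => by
    rw [hB₀, ← shift]; exact hasDerivAt_exp_smul (-μ₀) (hW₀.1 x)
  have hBV₀ : B₀ *ᵥ V₀ = 0 := kill _ _ _ hV₀
  -- decay of the limiting deviation
  have hy₀d : ∀ x, HasDerivAt (fun x => z₀ x - V₀)
      ((B₀ + (N₀ x - A₀)) *ᵥ (z₀ x - V₀) + (N₀ x - A₀) *ᵥ V₀) x := fun x => by
    refine ((hz₀d x).sub_const V₀).congr_deriv ?_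
    rw [Matrix.mulVec_sub, Matrix.add_mulVec _ _ V₀, hBV₀]; abel
  have hy₀lim : Tendsto (fun x => z₀ x - V₀) atTop (𝓝 0) := by
    have := hW₀.2.sub_const V₀
    rwa [sub_self] at this
  set C₁ := 2 * decayConst b η' * (C * ‖V₀‖) with hC₁
  have hC₁0 : 0 ≤ C₁ := by
    have := decayConst_nonneg (b := b) hη'0
    positivity
  have hy₀ : ∀ x ∈ Ici X, ‖z₀ x - V₀‖ ≤ C₁ * Real.exp (-η' * x) := by
    refine norm_le_of_perturbed (X := X) (C := C) (p := fun x => (N₀ x - A₀) *ᵥ V₀) hη'0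
      (α := α₀ - μ₀) (β := β₀ - μ₀) (B := B₀) ?_
      (by rw [Complex.sub_re]; linarith) (by rw [Complex.sub_re]; linarith) ?_
      ?_ hC (by positivity) (hX X le_rfl) (reachesLimit_Ici X)
      (fun x hx => hx) (fun x _ => hy₀d x)
      (fun x hx => (hΘ₀ x (hX0.trans hx)).trans
        (mul_le_mul_of_nonneg_left (hweak x (hX0.trans hx)) hC)) (fun x hx => ?_) hy₀lim ?_
    · rw [shift2, shift2]; exact hann₀
    · exact (le_add_of_nonneg_right zero_le_one).trans ((le_max_left _ _).trans (le_max_right _ _))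
    · rw [shift2]; exact (le_max_right _ _).trans (le_max_right _ _)
    · refine (Matrix.linfty_opNorm_mulVec _ _).trans ?_
      rw [mul_right_comm]
      exact mul_le_mul_of_nonneg_right ((hΘ₀ x (hX0.trans hx)).trans
        (mul_le_mul_of_nonneg_left (hweak x (hX0.trans hx)) hC)) (norm_nonneg _)
    · exact exists_bound_Ici (fun x _ => (hy₀d x).continuousAt.continuousWithinAt) hy₀lim
  -- the coefficient differences are small in the weaker weight
  have hD : ∀ ε > 0, ∀ᶠ i in l, ∀ x, 0 ≤ x →
      ‖(N i x - A i) - (N₀ x - A₀)‖ ≤ ε * Real.exp (-η' * x) := by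
    intro ε hε
    refine eventually_weighted_le (C := 2 * C) (η := η) (by rw [hη']; linarith) ?_ ?_ hε
    · filter_upwards [hΘ] with i hi x hx
      refine (norm_sub_le _ _).trans ((add_le_add (hi x hx) (hΘ₀ x hx)).trans (le_of_eq ?_))
      ring
    · intro T ε hε
      have h2 : ∀ᶠ i in l, ‖A i - A₀‖ < ε / 2 :=
        (tendsto_iff_norm_sub_tendsto_zero.1 hA).eventually (gt_mem_nhds (by positivity))
      filter_upwards [hloc T (ε / 2) (by positivity), h2] with i h3 h4 x hx
      have e : (N i x - A i) - (N₀ x - A₀) = (N i x - N₀ x) - (A i - A₀) := by abel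
      rw [e]
      exact (norm_sub_le _ _).trans (by linarith [h3 x hx])
  have hVb : ∀ᶠ i in l, ‖V i‖ ≤ ‖V₀‖ + 1 :=
    (hVlim.norm.eventually (gt_mem_nhds (lt_add_one ‖V₀‖))).mono fun _ h => le_of_lt h
  have hXlim : Tendsto (fun i => z i X) l (𝓝 (z₀ X)) := by
    rw [tendsto_iff_norm_sub_tendsto_zero, Metric.tendsto_nhds]
    intro ε hε
    set κ := 2 * decayConst b η' with hκ
    have hκ0 : 0 ≤ κ := by
      have := decayConst_nonneg (b := b) hη'0
      positivity
    set ε₁ := ε / 2 / ((κ + 1) * (2 * C₁ + (‖V₀‖ + 1) + C + 1)) with hε₁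
    have hε₁0 : 0 < ε₁ := by positivity
    have hBs : ∀ᶠ i in l, ‖B i - B₀‖ < ε₁ :=
      (tendsto_iff_norm_sub_tendsto_zero.1 hBlim).eventually (gt_mem_nhds hε₁0)
    have hVs : ∀ δ > 0, ∀ᶠ i in l, ‖V i - V₀‖ < δ := fun δ hδ =>
      (tendsto_iff_norm_sub_tendsto_zero.1 hVlim).eventually (gt_mem_nhds hδ)
    filter_upwards [hBs, hVs ε₁ hε₁0, hVs (ε / 2) (by positivity), hD ε₁ hε₁0, hVb, hΘ, hann, hα, hβ, hV,
      hBb, hBα, hW] with i h1 h2 h2' h3 h4 h5 h6 h7 h8 h9 h10 h11 h12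
    have hzd : ∀ x, HasDerivAt (z i) ((B i + (N i x - A i)) *ᵥ z i x) x := fun x => by
      simp only [hB]; rw [← shift]; exact hasDerivAt_exp_smul (-μ i) (h12.1 x)
    have hBV : B i *ᵥ V i = 0 := kill _ _ _ h9
    set p : ℝ → Fin 3 → ℂ := fun x => (B i - B₀) *ᵥ (z₀ x - V₀)
      + ((N i x - A i) - (N₀ x - A₀)) *ᵥ (z₀ x - V₀)
      + (((N i x - A i) - (N₀ x - A₀)) *ᵥ V i + (N₀ x - A₀) *ᵥ (V i - V₀)) with hp
    have hdd : ∀ x, HasDerivAt (fun x => (z i x - V i) - (z₀ x - V₀))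
        ((B i + (N i x - A i)) *ᵥ ((z i x - V i) - (z₀ x - V₀)) + p x) x := fun x => by
      refine (((hzd x).sub_const (V i)).sub (hy₀d x)).congr_deriv ?_
      simp only [hp, Matrix.add_mulVec, Matrix.sub_mulVec, Matrix.mulVec_sub] at hBV ⊢
      rw [hBV]; abel
    have hlim0 : Tendsto (fun x => (z i x - V i) - (z₀ x - V₀)) atTop (𝓝 0) := by
      have := (h12.2.sub_const (V i)).sub hy₀lim
      rwa [sub_self, sub_zero] at this
    have hmain := norm_le_of_perturbed (X := X) (C := C)
      (G := ε₁ * (2 * C₁ + (‖V₀‖ + 1) + C)) (p := p) hη'0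
      (α := α i - μ i) (β := β i - μ i) (B := B i) (by rw [shift2, shift2]; exact h6)
      (by rw [Complex.sub_re]; linarith) (by rw [Complex.sub_re]; linarith) h10
      (by rw [shift2]; exact h11) hC (by positivity) (hX X le_rfl) (reachesLimit_Ici X)
      (fun x hx => hx) (fun x _ => hdd x)
      (fun x hx => (h5 x (hX0.trans hx)).trans
        (mul_le_mul_of_nonneg_left (hweak x (hX0.trans hx)) hC)) (fun x hx => by
          have hx0 : 0 ≤ x := hX0.trans hx
          have hE : Real.exp (-η' * x) ≤ 1 := Real.exp_le_one_iff.2 (by nlinarith)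
          have hE0 := Real.exp_pos (-η' * x)
          have q1 : ‖(B i - B₀) *ᵥ (z₀ x - V₀)‖ ≤ ε₁ * (C₁ * Real.exp (-η' * x)) :=
            (Matrix.linfty_opNorm_mulVec _ _).trans
              (mul_le_mul h1.le (hy₀ x hx) (norm_nonneg _) hε₁0.le)
          have q2 : ‖((N i x - A i) - (N₀ x - A₀)) *ᵥ (z₀ x - V₀)‖
              ≤ (ε₁ * Real.exp (-η' * x)) * (C₁ * 1) :=
            (Matrix.linfty_opNorm_mulVec _ _).trans
              (mul_le_mul (h3 x hx0) ((hy₀ x hx).trans (mul_le_mul_of_nonneg_left hE hC₁0))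
                (norm_nonneg _) (by positivity))
          have q3 : ‖((N i x - A i) - (N₀ x - A₀)) *ᵥ V i‖
              ≤ (ε₁ * Real.exp (-η' * x)) * (‖V₀‖ + 1) :=
            (Matrix.linfty_opNorm_mulVec _ _).trans
              (mul_le_mul (h3 x hx0) h4 (norm_nonneg _) (by positivity))
          have q4 : ‖(N₀ x - A₀) *ᵥ (V i - V₀)‖ ≤ (C * Real.exp (-η' * x)) * ε₁ :=
            (Matrix.linfty_opNorm_mulVec _ _).trans
              (mul_le_mul ((hΘ₀ x hx0).trans (mul_le_mul_of_nonneg_left (hweak x hx0) hC)) h2.le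
                (norm_nonneg _) (by positivity))
          refine (norm_add_le _ _).trans ?_
          have s1 := norm_add_le ((B i - B₀) *ᵥ (z₀ x - V₀))
            (((N i x - A i) - (N₀ x - A₀)) *ᵥ (z₀ x - V₀))
          have s2 := norm_add_le (((N i x - A i) - (N₀ x - A₀)) *ᵥ V i)
            ((N₀ x - A₀) *ᵥ (V i - V₀))
          nlinarith) hlim0
      (exists_bound_Ici (fun x _ => (hdd x).continuousAt.continuousWithinAt) hlim0) X self_mem_Ici
    have hE : Real.exp (-η' * X) ≤ 1 := Real.exp_le_one_iff.2 (by nlinarith)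
    have hmain' : ‖(z i X - V i) - (z₀ X - V₀)‖ ≤ ε / 2 := by
      refine hmain.trans ?_
      have e : ε₁ * ((κ + 1) * (2 * C₁ + (‖V₀‖ + 1) + C + 1)) = ε / 2 := by
        rw [hε₁]; field_simp
      rw [← e]
      have hQ : 0 ≤ 2 * C₁ + (‖V₀‖ + 1) + C := by positivity
      calc κ * (ε₁ * (2 * C₁ + (‖V₀‖ + 1) + C)) * Real.exp (-η' * X)
          ≤ κ * (ε₁ * (2 * C₁ + (‖V₀‖ + 1) + C)) * 1 :=
            mul_le_mul_of_nonneg_left hE (by positivity)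
        _ = ε₁ * (κ * (2 * C₁ + (‖V₀‖ + 1) + C)) := by ring
        _ ≤ _ := mul_le_mul_of_nonneg_left
            (mul_le_mul (by linarith) (by linarith) hQ (by linarith)) hε₁0.le
    have e : z i X - z₀ X = ((z i X - V i) - (z₀ X - V₀)) + (V i - V₀) := by abel
    rw [Real.dist_eq, sub_zero, abs_of_nonneg (norm_nonneg _), e]
    exact (norm_add_le _ _).trans_lt (by linarith)
  have hWX : Tendsto (fun i => W i X) l (𝓝 (W₀ X)) := by
    have h1 : Tendsto (fun i => Complex.exp (μ i * (X : ℂ)) • z i X) l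
        (𝓝 (Complex.exp (μ₀ * (X : ℂ)) • z₀ X)) :=
      ((hμ.mul_const (X : ℂ)).cexp).smul hXlim
    have e : ∀ (τ : ℂ) (v : Fin 3 → ℂ),
        Complex.exp (τ * (X : ℂ)) • Complex.exp (-τ * (X : ℂ)) • v = v := by
      intro τ v
      rw [smul_smul, ← Complex.exp_add]; simp
    simpa only [hz, hz₀, e] using h1
  exact tendsto_solution_of_approx hN₀ (hW.mono fun _ h => h.1) hW₀.1 (A := 0) (B := X)
    (fun ε hε => hloc X ε hε) ⟨le_rfl, hX0⟩ ⟨hX0, le_rfl⟩ hWX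

end Modes

section Coefficients

variable {γ vp : ℝ}

theorem rpow_neg_sub_le (hγ : 1 ≤ γ) {u w : ℝ} (hu : 0 < u) (huw : u ≤ w) :
    u ^ (-γ) - w ^ (-γ) ≤ u ^ (-γ) * (γ * (w - u) / u) := by
  have hw : 0 < w := hu.trans_le huw
  have h1 : 1 + γ * (u / w - 1) ≤ (u / w) ^ γ := by
    have h := one_add_mul_self_le_rpow_one_add (s := u / w - 1) (by
      have : 0 < u / w := by positivity
      linarith) hγ
    rwa [add_sub_cancel] at h
  have h2 : w ^ (-γ) = u ^ (-γ) * (u / w) ^ γ := by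
    rw [Real.div_rpow hu.le hw.le, Real.rpow_neg hu.le, Real.rpow_neg hw.le]
    have : 0 < u ^ γ := Real.rpow_pos_of_pos hu _
    field_simp
  have h3 : γ * (1 - u / w) ≤ γ * (w - u) / u := by
    rw [mul_div_assoc]
    refine mul_le_mul_of_nonneg_left ?_ (by linarith)
    rw [one_sub_div hw.ne']
    exact div_le_div_of_nonneg_left (by linarith) hu huw
  have h4 : 0 < u ^ (-γ) := Real.rpow_pos_of_pos hu _
  have h5 : u ^ (-γ) - w ^ (-γ) = u ^ (-γ) * (1 - (u / w) ^ γ) := by rw [h2]; ring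
  rw [h5]
  exact mul_le_mul_of_nonneg_left (by linarith) h4.le

theorem one_lt_rpow_neg (hγ : 1 ≤ γ) (hv : vp ∈ Ioo (0 : ℝ) 1) : 1 < vp ^ (-γ) :=
  Real.one_lt_rpow_of_pos_of_lt_one_of_neg hv.1 hv.2 (by linarith)

theorem rhConst_pos (hγ : 1 ≤ γ) (hv : vp ∈ Ioo (0 : ℝ) 1) : 0 < rhConst γ vp :=
  div_pos (by linarith [hv.2]) (by linarith [one_lt_rpow_neg hγ hv])

theorem rhConst_mul_rpow (hγ : 1 ≤ γ) (hv : vp ∈ Ioo (0 : ℝ) 1) :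
    rhConst γ vp * vp ^ (-γ) = 1 + rhConst γ vp - vp := by
  have h : vp ^ (-γ) - 1 ≠ 0 := by linarith [one_lt_rpow_neg hγ hv]
  have : rhConst γ vp * (vp ^ (-γ) - 1) = -(vp - 1) := div_mul_cancel₀ _ h
  linarith

theorem mul_rhConst_le (hγ : 1 ≤ γ) (hv : vp ∈ Ioo (0 : ℝ) 1) : γ * rhConst γ vp ≤ vp := by
  have h1 := one_add_mul_self_le_rpow_one_add (s := 1 / vp - 1)
    (by have : 0 < 1 / vp := by have := hv.1; positivity
        linarith) hγ
  rw [add_sub_cancel, one_div, Real.inv_rpow hv.1.le, ← Real.rpow_neg hv.1.le] at h1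
  have h2 := rhConst_mul_rpow hγ hv
  have h3 := rhConst_pos hγ hv
  have h4 : rhConst γ vp * (γ * (vp⁻¹ - 1)) ≤ 1 - vp := by nlinarith
  have h5 : rhConst γ vp * (γ * (vp⁻¹ - 1)) = γ * rhConst γ vp * (1 - vp) / vp := by
    have := hv.1.ne'
    field_simp
  rw [h5, div_le_iff₀ hv.1] at h4
  nlinarith [hv.2]

theorem rhConst_le (hγ : 1 ≤ γ) (hv : vp ∈ Ioo (0 : ℝ) 1) : rhConst γ vp ≤ vp := by
  nlinarith [mul_rhConst_le hγ hv, rhConst_pos hγ hv]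

theorem rhConst_mul_rpow_le_one (hγ : 1 ≤ γ) (hv : vp ∈ Ioo (0 : ℝ) 1) {w : ℝ} (hw : vp ≤ w) :
    rhConst γ vp * w ^ (-γ) ≤ 1 := by
  have h1 : w ^ (-γ) ≤ vp ^ (-γ) := Real.rpow_le_rpow_of_nonpos hv.1 hw (by linarith)
  have h2 := mul_le_mul_of_nonneg_left h1 (rhConst_pos hγ hv).le
  linarith [rhConst_mul_rpow hγ hv, rhConst_le hγ hv]

theorem rhConst_mul_rpow_nonneg (hγ : 1 ≤ γ) (hv : vp ∈ Ioo (0 : ℝ) 1) {w : ℝ} (hw : vp ≤ w) :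
    0 ≤ rhConst γ vp * w ^ (-γ) :=
  mul_nonneg (rhConst_pos hγ hv).le (Real.rpow_nonneg (hv.1.le.trans hw) _)

theorem profileField_eq {v : ℝ} (hv : 0 < v) : profileField γ vp v
    = v ^ 2 - (1 + rhConst γ vp) * v + rhConst γ vp * v ^ (1 - γ) := by
  have : v ^ (1 - γ) = v * v ^ (-γ) := by
    rw [sub_eq_add_neg, Real.rpow_add hv, Real.rpow_one]
  rw [profileField, this]; ring

theorem fCoeff_eq {w : ℝ} (hw : 0 < w) : fCoeff γ vp w
    = 2 * w - (1 + rhConst γ vp) - (γ - 1) * (rhConst γ vp * w ^ (-γ)) := by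
  have h1 : w ^ (-γ) * w ^ (γ + 1) = w := by
    rw [← Real.rpow_add hw]; simp
  have h2 : w ^ (-γ) * w ^ γ = 1 := by
    rw [← Real.rpow_add hw]; simp
  rw [fCoeff, hCoeff]
  linear_combination h1 - (rhConst γ vp + 1) * h2

theorem fCoeff_one : fCoeff γ vp 1 = 1 - γ * rhConst γ vp := by
  rw [fCoeff_eq one_pos, Real.one_rpow]; ring

theorem fCoeff_endpoint (hγ : 1 ≤ γ) (hv : vp ∈ Ioo (0 : ℝ) 1) :
    fCoeff γ vp vp = vp - γ * (1 + rhConst γ vp - vp) := by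
  rw [fCoeff_eq hv.1, rhConst_mul_rpow hγ hv]; ring

theorem fCoeff_le (hγ : 1 ≤ γ) (hv : vp ∈ Ioo (0 : ℝ) 1) {w : ℝ} (hw : vp ≤ w) :
    fCoeff γ vp w ≤ 2 * w - 1 := by
  rw [fCoeff_eq (hv.1.trans_le hw)]
  nlinarith [rhConst_pos hγ hv, mul_nonneg (sub_nonneg.2 hγ) (rhConst_mul_rpow_nonneg hγ hv hw)]

theorem abs_fCoeff_le (hγ : 1 ≤ γ) (hv : vp ∈ Ioo (0 : ℝ) 1) {w : ℝ} (hw : w ∈ Icc vp 1) :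
    |fCoeff γ vp w| ≤ γ + 3 := by
  rw [fCoeff_eq (hv.1.trans_le hw.1)]
  have h1 := mul_nonneg (sub_nonneg.2 hγ) (rhConst_mul_rpow_nonneg hγ hv hw.1)
  have h2 := mul_le_mul_of_nonneg_left (rhConst_mul_rpow_le_one hγ hv hw.1) (sub_nonneg.2 hγ)
  rw [abs_le]
  constructor <;> linarith [rhConst_pos hγ hv, rhConst_le hγ hv, hv.1, hv.2, hw.1, hw.2]

theorem abs_fCoeff_sub_le (hγ : 1 ≤ γ) (hv : vp ∈ Ioo (0 : ℝ) 1) {u w : ℝ} (hu : vp ≤ u)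
    (huw : u ≤ w) : |fCoeff γ vp w - fCoeff γ vp u| ≤ (2 + (γ - 1) * γ / u) * (w - u) := by
  have hu0 : 0 < u := hv.1.trans_le hu
  rw [fCoeff_eq hu0, fCoeff_eq (hu0.trans_le huw)]
  have h1 := rpow_neg_sub_le hγ hu0 huw
  have h2 : w ^ (-γ) ≤ u ^ (-γ) := Real.rpow_le_rpow_of_nonpos hu0 huw (by linarith)
  have h3 := rhConst_mul_rpow_le_one hγ hv hu
  have ha := rhConst_pos hγ hv
  have h4 : rhConst γ vp * (u ^ (-γ) - w ^ (-γ)) ≤ γ * (w - u) / u := by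
    calc rhConst γ vp * (u ^ (-γ) - w ^ (-γ))
        ≤ rhConst γ vp * (u ^ (-γ) * (γ * (w - u) / u)) := mul_le_mul_of_nonneg_left h1 ha.le
      _ = rhConst γ vp * u ^ (-γ) * (γ * (w - u) / u) := by ring
      _ ≤ 1 * (γ * (w - u) / u) := mul_le_mul_of_nonneg_right h3
          (div_nonneg (mul_nonneg (by linarith) (by linarith)) hu0.le)
      _ = _ := one_mul _
  have h5 : 0 ≤ rhConst γ vp * (u ^ (-γ) - w ^ (-γ)) := mul_nonneg ha.le (by linarith)
  have e : 2 * w - (1 + rhConst γ vp) - (γ - 1) * (rhConst γ vp * w ^ (-γ))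
      - (2 * u - (1 + rhConst γ vp) - (γ - 1) * (rhConst γ vp * u ^ (-γ)))
      = 2 * (w - u) + (γ - 1) * (rhConst γ vp * (u ^ (-γ) - w ^ (-γ))) := by ring
  have h6 := mul_nonneg (sub_nonneg.2 hγ) h5
  have h7 := mul_le_mul_of_nonneg_left h4 (sub_nonneg.2 hγ)
  have e2 : (2 + (γ - 1) * γ / u) * (w - u) = 2 * (w - u) + (γ - 1) * (γ * (w - u) / u) := by ring
  rw [e, e2, abs_of_nonneg (by linarith)]
  linarith

theorem continuous_fCoeff_comp {v : ℝ → ℝ} (hv : Continuous v) (h : ∀ x, 0 < v x) :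
    Continuous fun x => fCoeff γ vp (v x) := by
  have : (fun x => fCoeff γ vp (v x)) = fun x =>
      2 * v x - (1 + rhConst γ vp) - (γ - 1) * (rhConst γ vp * v x ^ (-γ)) :=
    funext fun x => fCoeff_eq (h x)
  rw [this]
  have := hv.rpow_const (p := -γ) fun x => Or.inl (h x).ne'
  fun_prop

theorem convexOn_rpow_of_nonpos {p : ℝ} (hp : p ≤ 0) :
    ConvexOn ℝ (Ioi (0 : ℝ)) fun x => x ^ p := by
  refine ⟨convex_Ioi 0, fun x hx y hy a b ha hb hab => ?_⟩
  have hx' : 0 < x := hx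
  have hy' : 0 < y := hy
  have hxy : 0 < a • x + b • y := convex_Ioi (0 : ℝ) hx hy ha hb hab
  simp only [Real.rpow_def_of_pos hx', Real.rpow_def_of_pos hy', Real.rpow_def_of_pos hxy]
  have h1 := strictConcaveOn_log_Ioi.concaveOn.2 hx hy ha hb hab
  have h2 := convexOn_exp.2 (mem_univ (Real.log x * p)) (mem_univ (Real.log y * p)) ha hb hab
  refine le_trans (Real.exp_le_exp.2 ?_) h2
  simp only [smul_eq_mul] at h1 ⊢
  nlinarith

/-- The profile field lies below the parabola through its two zeros. -/
theorem profileField_le (hγ : 1 ≤ γ) (hv : vp ∈ Ioo (0 : ℝ) 1) {v : ℝ} (hvv : v ∈ Icc vp 1) :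
    profileField γ vp v ≤ -((v - vp) * (1 - v)) := by
  have hv0 : 0 < v := hv.1.trans_le hvv.1
  have h1 : 0 < 1 - vp := by linarith [hv.2]
  have hc := (convexOn_rpow_of_nonpos (p := 1 - γ) (by linarith)).2 (mem_Ioi.2 hv.1)
    (mem_Ioi.2 one_pos)
    (div_nonneg (by linarith [hvv.2]) h1.le : 0 ≤ (1 - v) / (1 - vp))
    (div_nonneg (by linarith [hvv.1]) h1.le : 0 ≤ (v - vp) / (1 - vp))
    (by rw [← add_div, div_eq_one_iff_eq h1.ne']; ring)
  have e1 : ((1 - v) / (1 - vp)) • vp + ((v - vp) / (1 - vp)) • (1 : ℝ) = v := by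
    simp only [smul_eq_mul]; field_simp; ring
  rw [e1] at hc
  simp only [smul_eq_mul, Real.one_rpow, mul_one] at hc
  have e2 : rhConst γ vp * vp ^ (1 - γ) = vp * (1 + rhConst γ vp - vp) := by
    rw [← rhConst_mul_rpow hγ hv, sub_eq_add_neg, Real.rpow_add hv.1, Real.rpow_one]; ring
  have h2 := mul_le_mul_of_nonneg_left hc (rhConst_pos hγ hv).le
  rw [profileField_eq hv0]
  have e3 : rhConst γ vp * ((1 - v) / (1 - vp) * vp ^ (1 - γ) + (v - vp) / (1 - vp))
      = ((1 - v) * (rhConst γ vp * vp ^ (1 - γ)) + rhConst γ vp * (v - vp)) / (1 - vp) := by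
    field_simp
  rw [e3, e2, le_div_iff₀ h1] at h2
  nlinarith

theorem abs_profileField_sub_le (hγ : 1 ≤ γ) (hv : vp ∈ Ioo (0 : ℝ) 1) {v : ℝ}
    (hvv : v ∈ Icc vp 1) : |profileField γ vp v - (v ^ 2 - v)| ≤ vp := by
  have hv0 : 0 < v := hv.1.trans_le hvv.1
  have ha := rhConst_pos hγ hv
  have ha' := rhConst_le hγ hv
  have e2 : rhConst γ vp * vp ^ (1 - γ) = vp * (1 + rhConst γ vp - vp) := by
    rw [← rhConst_mul_rpow hγ hv, sub_eq_add_neg, Real.rpow_add hv.1, Real.rpow_one]; ring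
  have h1 : v ^ (1 - γ) ≤ vp ^ (1 - γ) := Real.rpow_le_rpow_of_nonpos hv.1 hvv.1 (by linarith)
  have h2 := mul_le_mul_of_nonneg_left h1 ha.le
  have h3 : 0 ≤ rhConst γ vp * v ^ (1 - γ) := mul_nonneg ha.le (Real.rpow_nonneg hv0.le _)
  rw [profileField_eq hv0, abs_le]
  constructor <;> nlinarith [hvv.1, hvv.2, hv.1, hv.2]

theorem profileField_endpoint (hγ : 1 ≤ γ) (hv : vp ∈ Ioo (0 : ℝ) 1) :
    profileField γ vp vp = 0 := by
  rw [profileField, mul_sub, rhConst_mul_rpow hγ hv]; ring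

theorem profileField_one : profileField γ vp 1 = 0 := by
  rw [profileField, Real.one_rpow]; ring

theorem exists_lipschitzOnWith_profileField (hγ : 1 ≤ γ) (hv : vp ∈ Ioo (0 : ℝ) 1) :
    ∃ K, LipschitzOnWith K (profileField γ vp) (Icc vp 1) := by
  have hd : ∀ x ∈ Icc vp 1, HasDerivWithinAt (profileField γ vp)
      (2 * x - (1 + rhConst γ vp) + rhConst γ vp * ((1 - γ) * x ^ (-γ))) (Icc vp 1) x := by
    intro x hx
    have hx0 : 0 < x := hv.1.trans_le hx.1
    have h1 := Real.hasDerivAt_rpow_const (x := x) (p := 1 - γ) (Or.inl hx0.ne')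
    have h2 := (((hasDerivAt_pow 2 x).sub ((hasDerivAt_id x).const_mul (1 + rhConst γ vp))).add
      (h1.const_mul (rhConst γ vp)))
    refine ((h2.congr_of_eventuallyEq ?_).congr_deriv ?_).hasDerivWithinAt
    · filter_upwards [lt_mem_nhds hx0] with y hy
      simp [profileField_eq hy]
    · rw [show 1 - γ - 1 = -γ by ring]; simp
  refine ⟨(γ + 3).toNNReal, LipschitzOnWith.of_dist_le_mul fun x hx y hy => ?_⟩
  rw [Real.coe_toNNReal _ (by linarith), dist_eq_norm, dist_eq_norm]
  refine (convex_Icc vp 1).norm_image_sub_le_of_norm_hasDerivWithin_le hd (fun z hz => ?_) hy hx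
  have h1 := rhConst_mul_rpow_nonneg hγ hv hz.1
  have h2 := rhConst_mul_rpow_le_one hγ hv hz.1
  have h3 := mul_nonneg (sub_nonneg.2 hγ) h1
  have h4 := mul_le_mul_of_nonneg_left h2 (sub_nonneg.2 hγ)
  have e : rhConst γ vp * ((1 - γ) * z ^ (-γ)) = -((γ - 1) * (rhConst γ vp * z ^ (-γ))) := by ring
  rw [e, Real.norm_eq_abs, abs_le]
  constructor <;> linarith [hz.1, hz.2, rhConst_pos hγ hv, rhConst_le hγ hv, hv.1, hv.2]

end Coefficients

section Decay

/-- Exponential approach to the right end state. -/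
theorem sub_le_exp_of_deriv_le {v v' : ℝ → ℝ} {m : ℝ} (hd : ∀ x, HasDerivAt v (v' x) x)
    (hm : ∀ x, v x ∈ Ioo m 1) (hle : ∀ x, v' x ≤ -((v x - m) * (1 - v x))) {x : ℝ} (hx : 0 ≤ x) :
    v x - m ≤ (v 0 - m) * Real.exp (-(1 - v 0) * x) := by
  have hanti : Antitone v := antitone_of_deriv_nonpos (fun x => (hd x).differentiableAt) fun x => by
    rw [(hd x).deriv]
    nlinarith [hle x, (hm x).1, (hm x).2]
  have hder : ∀ x, HasDerivAt (fun x => (v x - m) * Real.exp ((1 - v 0) * x))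
      (v' x * Real.exp ((1 - v 0) * x) + (v x - m) * (Real.exp ((1 - v 0) * x) * (1 - v 0))) x := by
    intro x
    have h1 : HasDerivAt (fun x => Real.exp ((1 - v 0) * x)) (Real.exp ((1 - v 0) * x) * (1 - v 0)) x := by
      simpa using ((hasDerivAt_id x).const_mul (1 - v 0)).exp
    exact ((hd x).sub_const m).mul h1
  have h := antitoneOn_of_deriv_nonpos (convex_Ici (0 : ℝ))
    (fun x _ => (hder x).continuousAt.continuousWithinAt)
    (fun x _ => (hder x).differentiableAt.differentiableWithinAt) (fun x hx => by
      rw [interior_Ici] at hx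
      rw [(hder x).deriv]
      have h1 : v x ≤ v 0 := hanti hx.le
      have h2 : v' x + (v x - m) * (1 - v 0) ≤ 0 := by nlinarith [hle x, (hm x).1]
      have e : v' x * Real.exp ((1 - v 0) * x) + (v x - m) * (Real.exp ((1 - v 0) * x) * (1 - v 0))
        = (v' x + (v x - m) * (1 - v 0)) * Real.exp ((1 - v 0) * x) := by ring
      rw [e]
      exact mul_nonpos_of_nonpos_of_nonneg h2 (Real.exp_pos _).le) self_mem_Ici hx hx
  simp only [mul_zero, Real.exp_zero, mul_one] at h
  rw [neg_mul, Real.exp_neg, ← div_eq_mul_inv, le_div_iff₀ (Real.exp_pos _)]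
  exact h

/-- Exponential approach to the left end state. -/
theorem one_sub_le_exp_of_deriv_le {v v' : ℝ → ℝ} {m : ℝ} (hd : ∀ x, HasDerivAt v (v' x) x)
    (hm : ∀ x, v x ∈ Ioo m 1) (hle : ∀ x, v' x ≤ -((v x - m) * (1 - v x))) {x : ℝ} (hx : 0 ≤ x) :
    1 - v (-x) ≤ (1 - v 0) * Real.exp (-(v 0 - m) * x) := by
  have h := sub_le_exp_of_deriv_le (v := fun x => 1 + m - v (-x)) (v' := fun x => v' (-x)) (m := m)
    (fun x => by
      have h1 := (hd (-x)).scomp x (hasDerivAt_neg x)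
      exact (h1.const_sub (1 + m)).congr_deriv (by simp))
    (fun x => ⟨by linarith [(hm (-x)).2], by linarith [(hm (-x)).1]⟩)
    (fun x => by nlinarith [hle (-x)]) hx
  simp only [neg_zero] at h
  have e : 1 - (1 + m - v 0) = v 0 - m := by ring
  rw [e] at h
  linarith

end Decay

section Profiles

variable {γ vp : ℝ}

theorem IsShockProfile.mem_Ioo {v : ℝ → ℝ} (h : IsShockProfile γ vp v) (x : ℝ) :
    v x ∈ Ioo vp 1 := by
  constructor
  · have h1 : vp ≤ v (x + 1) := h.strictAnti.antitone.le_of_tendsto h.tendsto_atTop (x + 1)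
    exact h1.trans_lt (h.strictAnti (by linarith))
  · have h1 : v (x - 1) ≤ 1 := h.strictAnti.antitone.ge_of_tendsto h.tendsto_atBot (x - 1)
    exact (h.strictAnti (by linarith)).trans_le h1

theorem IsShockProfile.deriv_le (hγ : 1 ≤ γ) (hv : vp ∈ Ioo (0 : ℝ) 1) {v : ℝ → ℝ}
    (h : IsShockProfile γ vp v) (x : ℝ) :
    profileField γ vp (v x) ≤ -((v x - vp) * (1 - v x)) :=
  profileField_le hγ hv (Ioo_subset_Icc_self (h.mem_Ioo x))

theorem IsShockProfile.continuous {v : ℝ → ℝ} (h : IsShockProfile γ vp v) : Continuous v :=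
  continuous_iff_continuousAt.2 fun x => (h.deriv_eq x).continuousAt

theorem exists_shockProfile (hγ : 1 ≤ γ) (hv : vp ∈ Ioo (0 : ℝ) 1) {c : ℝ} (hc : c ∈ Ioo vp 1) :
    ∃ v : ℝ → ℝ, IsShockProfile γ vp v ∧ v 0 = c := by
  obtain ⟨K, hK⟩ := exists_lipschitzOnWith_profileField hγ hv
  set f : ℝ → ℝ := fun y => profileField γ vp (projIcc vp 1 hv.2.le y) with hf
  have hfL : LipschitzWith (K * 1) f := by
    have h1 : LipschitzWith K (fun y : Icc vp 1 => profileField γ vp y) :=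
      lipschitzOnWith_iff_restrict.1 hK
    exact h1.comp (LipschitzWith.projIcc hv.2.le)
  have hfb : ∀ y, ‖f y‖ ≤ 2 := by
    intro y
    have hy := (projIcc vp 1 hv.2.le y).2
    have h1 := abs_le.1 (abs_profileField_sub_le hγ hv hy)
    rw [Real.norm_eq_abs, abs_le]
    simp only [hf]
    set w : ℝ := (projIcc vp 1 hv.2.le y : ℝ) with hw
    have hw0 : 0 < w := hv.1.trans_le hy.1
    constructor <;> nlinarith [hy.1, hy.2, hv.1, hv.2]
  obtain ⟨v, hv0, hvd⟩ := exists_global_of_bounded hfL hfb 0 c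
  have hcont : Continuous v := continuous_iff_continuousAt.2 fun x => (hvd x).continuousAt
  have fixed : ∀ e ∈ Icc vp 1, profileField γ vp e = 0 → e ≠ c → ∀ t, v t ≠ e := by
    intro e he hez hec t hte
    have hfe : f e = 0 := by simp only [hf, projIcc_of_mem _ he, hez]
    have : v = fun _ => e := ODE_solution_unique_univ (v := fun _ => f) (s := fun _ => univ) (t₀ := t)
      (fun _ => hfL.lipschitzOnWith) (fun s => ⟨hvd s, trivial⟩)
      (fun s => ⟨by rw [hfe]; exact hasDerivAt_const s e, trivial⟩) hte
    exact hec (by rw [← hv0, this])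
  have h1 := fixed 1 ⟨hv.2.le, le_rfl⟩ profileField_one hc.2.ne'
  have h2 := fixed vp ⟨le_rfl, hv.2.le⟩ (profileField_endpoint hγ hv) hc.1.ne
  have hmem : ∀ t, v t ∈ Ioo vp 1 := by
    intro t
    constructor
    · by_contra! hlt
      obtain ⟨s, hs⟩ := mem_range_of_exists_le_of_exists_ge hcont ⟨t, hlt⟩
        ⟨0, by rw [hv0]; exact hc.1.le⟩
      exact h2 s hs
    · by_contra! hlt
      obtain ⟨s, hs⟩ := mem_range_of_exists_le_of_exists_ge hcont
        ⟨0, by rw [hv0]; exact hc.2.le⟩ ⟨t, hlt⟩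
      exact h1 s hs
  have hder : ∀ t, HasDerivAt v (profileField γ vp (v t)) t := fun t =>
    (hvd t).congr_deriv (by
      simp only [hf, projIcc_of_mem _ (Ioo_subset_Icc_self (hmem t))])
  have hle : ∀ t, profileField γ vp (v t) ≤ -((v t - vp) * (1 - v t)) := fun t =>
    profileField_le hγ hv (Ioo_subset_Icc_self (hmem t))
  refine ⟨v, ⟨hder, strictAnti_of_deriv_neg fun t => ?_, ?_, ?_⟩, hv0⟩
  · rw [(hder t).deriv]
    have := mul_pos (sub_pos.2 (hmem t).1) (sub_pos.2 (hmem t).2)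
    linarith [hle t]
  · have h3 : Tendsto (fun x => 1 - v (-x)) atTop (𝓝 0) := by
      refine squeeze_zero' (Eventually.of_forall fun x => by linarith [(hmem (-x)).2])
        ((eventually_ge_atTop 0).mono fun x hx => one_sub_le_exp_of_deriv_le hder hmem hle hx) ?_
      have := (tendsto_exp_neg_mul (η := v 0 - vp) (by linarith [(hmem 0).1])).const_mul (1 - v 0)
      simpa using this
    have h4 := (h3.const_sub 1).comp tendsto_neg_atBot_atTop
    simpa [Function.comp_def] using h4
  · have h3 : Tendsto (fun x => v x - vp) atTop (𝓝 0) := by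
      refine squeeze_zero' (Eventually.of_forall fun x => by linarith [(hmem x).1])
        ((eventually_ge_atTop 0).mono fun x hx => sub_le_exp_of_deriv_le hder hmem hle hx) ?_
      have := (tendsto_exp_neg_mul (η := 1 - v 0) (by linarith [(hmem 0).2])).const_mul (v 0 - vp)
      simpa using this
    have h4 := h3.add_const vp
    simpa using h4

theorem limitProfile_mem_Ioo (x₀ x : ℝ) : limitProfile x₀ x ∈ Ioo (0 : ℝ) 1 := by
  rw [limitProfile]
  exact ⟨by linarith [Real.tanh_lt_one ((x - x₀) / 2)],
    by linarith [Real.neg_one_lt_tanh ((x - x₀) / 2)]⟩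

theorem hasDerivAt_limitProfile (x₀ x : ℝ) : HasDerivAt (limitProfile x₀)
    (limitProfile x₀ x ^ 2 - limitProfile x₀ x) x := by
  set y := (x - x₀) / 2 with hy
  have hc : Real.cosh y ≠ 0 := (Real.cosh_pos y).ne'
  have h0 : HasDerivAt (fun x : ℝ => (x - x₀) / 2) (1 / 2) x :=
    ((hasDerivAt_id x).sub_const x₀).div_const 2
  have h1 : HasDerivAt (fun x : ℝ => Real.sinh ((x - x₀) / 2)) (Real.cosh y * (1 / 2)) x := h0.sinh
  have h2 : HasDerivAt (fun x : ℝ => Real.cosh ((x - x₀) / 2)) (Real.sinh y * (1 / 2)) x := h0.cosh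
  have h3 := ((h1.div h2 hc).const_sub 1).div_const 2
  have e : limitProfile x₀ = fun x => (1 - Real.sinh ((x - x₀) / 2) / Real.cosh ((x - x₀) / 2)) / 2 := by
    funext z
    rw [limitProfile, Real.tanh_eq_sinh_div_cosh]
  rw [e]
  refine h3.congr_deriv ?_
  have h4 := Real.cosh_sq y
  simp only [← hy]
  field_simp
  nlinarith

theorem continuous_limitProfile (x₀ : ℝ) : Continuous (limitProfile x₀) :=
  continuous_iff_continuousAt.2 fun x => (hasDerivAt_limitProfile x₀ x).continuousAt

theorem limitProfile_deriv_le (x₀ x : ℝ) : limitProfile x₀ x ^ 2 - limitProfile x₀ x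
    ≤ -((limitProfile x₀ x - 0) * (1 - limitProfile x₀ x)) := by
  nlinarith

/-- Quantitative closeness of a shock profile to the limiting profile. -/
theorem IsShockProfile.abs_sub_limitProfile_le (hγ : 1 ≤ γ) (hv : vp ∈ Ioo (0 : ℝ) 1) {v : ℝ → ℝ}
    (h : IsShockProfile γ vp v) (x₀ x : ℝ) :
    |v x - limitProfile x₀ x| ≤ (|v 0 - limitProfile x₀ 0| + vp) * Real.exp |x| := by
  have := norm_le_exp_of_norm_deriv_le (d := fun x => v x - limitProfile x₀ x) (K := 1) (G := vp)
    (A := min 0 x) (B := max 0 x) le_rfl hv.1.le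
    (fun s _ => (h.deriv_eq s).sub (hasDerivAt_limitProfile x₀ s))
    (fun s _ => by
      have h1 := abs_profileField_sub_le hγ hv (Ioo_subset_Icc_self (h.mem_Ioo s))
      have h2 := h.mem_Ioo s
      have h3 := limitProfile_mem_Ioo x₀ s
      have e : profileField γ vp (v s) - (limitProfile x₀ s ^ 2 - limitProfile x₀ s)
          = (v s + limitProfile x₀ s - 1) * (v s - limitProfile x₀ s)
            + (profileField γ vp (v s) - (v s ^ 2 - v s)) := by ring
      rw [e, Real.norm_eq_abs, Real.norm_eq_abs]
      refine (abs_add_le _ _).trans (add_le_add ?_ h1)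
      rw [abs_mul]
      refine mul_le_mul_of_nonneg_right (abs_le.2 ⟨?_, ?_⟩) (abs_nonneg _)
      · linarith [h2.1, h3.1, hv.1]
      · linarith [h2.2, h3.2])
    (x := x) (y := 0) ⟨min_le_right _ _, le_max_right _ _⟩ ⟨min_le_left _ _, le_max_left _ _⟩
  simpa using this

end Profiles

section Roots

/-- `t₁, t₂, t₃` are the roots of `(t² - g²) (t - b) = λ t`. -/
structure IsRootTriple (b g : ℝ) (lam t₁ t₂ t₃ : ℂ) : Prop where
  sum_eq : t₁ + t₂ + t₃ = b
  sum_mul_eq : t₁ * t₂ + t₁ * t₃ + t₂ * t₃ = -(g : ℂ) ^ 2 - lam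
  prod_eq : t₁ * t₂ * t₃ = -((g : ℂ) ^ 2 * b)

variable {b g : ℝ} {lam t t₁ t₂ t₃ : ℂ}

theorem IsRootTriple.factor (h : IsRootTriple b g lam t₁ t₂ t₃) (t : ℂ) :
    (t ^ 2 - (g : ℂ) ^ 2) * (t - b) - lam * t = (t - t₁) * (t - t₂) * (t - t₃) := by
  linear_combination t ^ 2 * h.sum_eq - t * h.sum_mul_eq + h.prod_eq

theorem IsRootTriple.rotate (h : IsRootTriple b g lam t₁ t₂ t₃) : IsRootTriple b g lam t₂ t₃ t₁ :=
  ⟨by linear_combination h.sum_eq, by linear_combination h.sum_mul_eq,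
    by linear_combination h.prod_eq⟩

theorem IsRootTriple.swap (h : IsRootTriple b g lam t₁ t₂ t₃) : IsRootTriple b g lam t₁ t₃ t₂ :=
  ⟨by linear_combination h.sum_eq, by linear_combination h.sum_mul_eq,
    by linear_combination h.prod_eq⟩

theorem IsRootTriple.root (h : IsRootTriple b g lam t₁ t₂ t₃) :
    (t₁ ^ 2 - (g : ℂ) ^ 2) * (t₁ - b) = lam * t₁ := by
  have := h.factor t₁
  rw [sub_self, zero_mul, zero_mul] at this
  exact sub_eq_zero.1 this

theorem IsRootTriple.eq_or_eq_or_eq (h : IsRootTriple b g lam t₁ t₂ t₃)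
    (ht : (t ^ 2 - (g : ℂ) ^ 2) * (t - b) = lam * t) : t = t₁ ∨ t = t₂ ∨ t = t₃ := by
  have := h.factor t
  rw [ht, sub_self] at this
  rcases mul_eq_zero.1 this.symm with h1 | h1
  · rcases mul_eq_zero.1 h1 with h2 | h2
    · exact Or.inl (sub_eq_zero.1 h2)
    · exact Or.inr (Or.inl (sub_eq_zero.1 h2))
  · exact Or.inr (Or.inr (sub_eq_zero.1 h1))

theorem exists_three_roots (s p q : ℂ) :
    ∃ t₁ t₂ t₃ : ℂ, t₁ + t₂ + t₃ = s ∧ t₁ * t₂ + t₁ * t₃ + t₂ * t₃ = p ∧ t₁ * t₂ * t₃ = q := by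
  obtain ⟨t₁, h1⟩ := IsAlgClosed.exists_root
    (Polynomial.X ^ 3 - (Polynomial.C s * Polynomial.X ^ 2 - Polynomial.C p * Polynomial.X
      + Polynomial.C q) : Polynomial ℂ) (by
    have : (Polynomial.C s * Polynomial.X ^ 2 - Polynomial.C p * Polynomial.X
      + Polynomial.C q : Polynomial ℂ).degree < ((3 : ℕ) : WithBot ℕ) := by
      refine lt_of_le_of_lt ?_ (by norm_cast : ((2 : ℕ) : WithBot ℕ) < ((3 : ℕ) : WithBot ℕ))
      compute_degree
      norm_num
    rw [Polynomial.degree_sub_eq_left_of_degree_lt] <;> rw [Polynomial.degree_X_pow]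
    · norm_num
    · exact this)
  simp only [Polynomial.IsRoot.def, Polynomial.eval_sub, Polynomial.eval_add, Polynomial.eval_pow,
    Polynomial.eval_X, Polynomial.eval_mul, Polynomial.eval_C] at h1
  obtain ⟨r, hr⟩ := IsAlgClosed.exists_eq_mul_self ((s - t₁) ^ 2 - 4 * (p - t₁ * (s - t₁)))
  refine ⟨t₁, (s - t₁ + r) / 2, (s - t₁ - r) / 2, by ring, by linear_combination (1 / 4 : ℂ) * hr, ?_⟩
  linear_combination (t₁ / 4) * hr + h1

theorem re_mul_normSq_eq (h : (t ^ 2 - (g : ℂ) ^ 2) * (t - b) = lam * t) :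
    lam.re * ‖t‖ ^ 2 = ‖t‖ ^ 2 * (t.re ^ 2 - t.im ^ 2 - g ^ 2) - b * t.re * (‖t‖ ^ 2 - g ^ 2) := by
  have h1 : lam * (‖t‖ ^ 2 : ℝ) = (t ^ 2 - (g : ℂ) ^ 2) * (t - b) * (starRingEnd ℂ t) := by
    rw [h, mul_assoc, Complex.mul_conj, Complex.normSq_eq_norm_sq]
  have h2 := congrArg Complex.re h1
  rw [Complex.re_mul_ofReal] at h2
  rw [h2, ← Complex.normSq_eq_norm_sq, Complex.normSq_apply]
  simp [pow_two]
  ring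

theorem ne_zero_of_root (hb : 0 < b) (hg : 0 < g)
    (h : (t ^ 2 - (g : ℂ) ^ 2) * (t - b) = lam * t) : t ≠ 0 := by
  rintro rfl
  have h1 : (b : ℂ) ≠ 0 := by exact_mod_cast hb.ne'
  have h2 : (g : ℂ) ≠ 0 := by exact_mod_cast hg.ne'
  simp [h1, h2] at h

theorem re_ne_zero_of_root (hb : 0 < b) (hg : 0 < g) (hlam : 0 ≤ lam.re)
    (h : (t ^ 2 - (g : ℂ) ^ 2) * (t - b) = lam * t) : t.re ≠ 0 := by
  intro h0
  have h1 := re_mul_normSq_eq h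
  have h2 : 0 < ‖t‖ ^ 2 := by have := norm_pos_iff.2 (ne_zero_of_root hb hg h); positivity
  rw [h0] at h1
  nlinarith [mul_nonneg hlam h2.le, mul_nonneg h2.le (sq_nonneg t.im), mul_pos h2 (pow_pos hg 2)]

theorem norm_ne_of_root (hg : 0 < g) (hlam : 0 ≤ lam.re) (hlam0 : lam ≠ 0)
    (h : (t ^ 2 - (g : ℂ) ^ 2) * (t - b) = lam * t) : ‖t‖ ≠ g := by
  intro h0
  have h1 := re_mul_normSq_eq h
  rw [h0] at h1
  have h3 : ‖t‖ ^ 2 = t.re ^ 2 + t.im ^ 2 := by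
    rw [← Complex.normSq_eq_norm_sq, Complex.normSq_apply]; ring
  rw [h0] at h3
  have hg2 := pow_pos hg 2
  have h4 : t.im ^ 2 = 0 := by
    have : g ^ 2 * (lam.re + 2 * t.im ^ 2) = 0 := by nlinarith
    rcases mul_eq_zero.1 this with h | h
    · exact absurd h hg2.ne'
    · nlinarith [sq_nonneg t.im]
  have h5 : t.im = 0 := by simpa using h4
  have h6 : t = (t.re : ℂ) := Complex.ext (by simp) (by simp [h5])
  have h7 : t ^ 2 = (g : ℂ) ^ 2 := by
    rw [h6]
    have : t.re ^ 2 = g ^ 2 := by rw [h3, h4, add_zero]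
    exact_mod_cast this
  rw [h7, sub_self, zero_mul] at h
  rcases mul_eq_zero.1 h.symm with h | h
  · exact hlam0 h
  · rw [h, norm_zero] at h0
    exact hg.ne h0

/-- The part of the right half-plane outside the disc of radius `g`. -/
def outerRegion (g : ℝ) : Set ℂ := {t | 0 ≤ t.re ∧ g ≤ ‖t‖}

/-- The complement of the interior of `outerRegion g`. -/
def innerRegion (g : ℝ) : Set ℂ := {t | t.re ≤ 0 ∨ ‖t‖ ≤ g}

theorem isClosed_outerRegion (g : ℝ) : IsClosed (outerRegion g) :=
  (isClosed_le continuous_const Complex.continuous_re).inter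
    (isClosed_le continuous_const continuous_norm)

theorem isClosed_innerRegion (g : ℝ) : IsClosed (innerRegion g) :=
  (isClosed_le Complex.continuous_re continuous_const).union
    (isClosed_le continuous_norm continuous_const)

theorem mem_outer_or_inner (g : ℝ) (t : ℂ) : t ∈ outerRegion g ∨ t ∈ innerRegion g := by
  by_cases h1 : 0 ≤ t.re
  · by_cases h2 : g ≤ ‖t‖
    · exact Or.inl ⟨h1, h2⟩
    · exact Or.inr (Or.inr (not_le.1 h2).le)
  · exact Or.inr (Or.inl (not_le.1 h1).le)

theorem not_mem_inner_of_outer (hb : 0 < b) (hg : 0 < g) (hlam : 0 ≤ lam.re) (hlam0 : lam ≠ 0)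
    (h : (t ^ 2 - (g : ℂ) ^ 2) * (t - b) = lam * t) (ho : t ∈ outerRegion g) :
    t ∉ innerRegion g := by
  rintro (hi | hi)
  · exact re_ne_zero_of_root hb hg hlam h (le_antisymm hi ho.1)
  · exact norm_ne_of_root hg hlam hlam0 h (le_antisymm hi ho.2)

theorem norm_le_of_root (hb : 0 < b) (h : (t ^ 2 - (g : ℂ) ^ 2) * (t - b) = lam * t) :
    ‖t‖ ≤ 1 + b + (g ^ 2 + ‖lam‖) + g ^ 2 * b := by
  by_cases h1 : ‖t‖ ≤ 1
  · have : 0 ≤ g ^ 2 * b := by positivity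
    nlinarith [norm_nonneg lam, sq_nonneg g]
  · push Not at h1
    have e : t ^ 3 = b * t ^ 2 + ((g : ℂ) ^ 2 + lam) * t - (g : ℂ) ^ 2 * b := by
      linear_combination h
    have e1 : ‖t‖ ^ 3 ≤ b * ‖t‖ ^ 2 + (g ^ 2 + ‖lam‖) * ‖t‖ + g ^ 2 * b := by
      rw [← norm_pow, e]
      refine (norm_sub_le _ _).trans (add_le_add ((norm_add_le _ _).trans (add_le_add ?_ ?_)) ?_)
      · rw [norm_mul, norm_pow, Complex.norm_real, Real.norm_of_nonneg hb.le]
      · rw [norm_mul]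
        refine mul_le_mul_of_nonneg_right ((norm_add_le _ _).trans ?_) (norm_nonneg _)
        rw [norm_pow, Complex.norm_real, Real.norm_eq_abs, sq_abs]
      · rw [norm_mul, norm_pow, Complex.norm_real, Complex.norm_real, Real.norm_eq_abs, sq_abs,
          Real.norm_of_nonneg hb.le]
    have h2 : 0 < ‖t‖ ^ 2 := by positivity
    have h3 : ‖t‖ ≤ ‖t‖ ^ 2 := by nlinarith
    have h4 : 1 ≤ ‖t‖ ^ 2 := by nlinarith
    have h5 : 0 ≤ g ^ 2 + ‖lam‖ := by positivity
    have h6 : 0 ≤ g ^ 2 * b := by positivity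
    have h7 : ‖t‖ ^ 2 * ‖t‖ ≤ ‖t‖ ^ 2 * (b + (g ^ 2 + ‖lam‖) + g ^ 2 * b) := by nlinarith
    have := le_of_mul_le_mul_left h7 h2
    linarith

/-- Splitting of the roots for one explicit positive value of the parameter. -/
theorem exists_base_triple (hb : 0 < b) (hg : 0 < g) : ∃ (L : ℝ) (t₁ t₂ t₃ : ℂ), 0 < L ∧
    IsRootTriple b g L t₁ t₂ t₃ ∧ t₁ ∈ outerRegion g ∧ t₂ ∈ innerRegion g ∧ t₃ ∈ innerRegion g := by
  set τ := min b g / 2 with hτ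
  have hm : 0 < min b g := lt_min hb hg
  have hτ0 : 0 < τ := by positivity
  have hτb : τ < b := by linarith [min_le_left b g]
  have hτg : τ < g := by linarith [min_le_right b g]
  set m := b - τ with hm'
  set r := Real.sqrt (m ^ 2 + 4 * (g ^ 2 * b / τ)) with hr
  have hr2 : r ^ 2 = m ^ 2 + 4 * (g ^ 2 * b / τ) := Real.sq_sqrt (by positivity)
  have hr0 : 0 ≤ r := Real.sqrt_nonneg _
  have hq : g ^ 2 * b / τ * τ = g ^ 2 * b := by field_simp
  have hmr : m < r := by
    refine lt_of_pow_lt_pow_left₀ 2 hr0 ?_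
    rw [hr2]
    have : 0 < g ^ 2 * b / τ := by positivity
    linarith
  have hLeq : ((b - τ) * (g ^ 2 / τ - τ)) = -g ^ 2 - ((m + r) / 2 * ((m - r) / 2) + (m + r) / 2 * τ
      + (m - r) / 2 * τ) := by
    have e : (m + r) / 2 * ((m - r) / 2) = -(g ^ 2 * b / τ) := by nlinarith
    rw [e]
    field_simp
    ring
  refine ⟨(b - τ) * (g ^ 2 / τ - τ), ((m + r) / 2 : ℝ), ((m - r) / 2 : ℝ), (τ : ℝ), ?_, ⟨?_, ?_, ?_⟩,
    ⟨?_, ?_⟩, Or.inl ?_, Or.inr ?_⟩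
  · refine mul_pos (by linarith) (sub_pos.2 ?_)
    rw [lt_div_iff₀ hτ0]; nlinarith
  · norm_cast; rw [hm']; ring
  · rw [hLeq]; push_cast; ring
  · norm_cast
    have e : (m + r) / 2 * ((m - r) / 2) = -(g ^ 2 * b / τ) := by nlinarith
    rw [e]; linarith
  · rw [Complex.ofReal_re]
    have : 0 < m := by rw [hm']; linarith
    positivity
  · rw [Complex.norm_real, Real.norm_eq_abs, abs_of_nonneg (by
      have : 0 < m := by rw [hm']; linarith
      positivity)]
    have h1 : 2 * g - m ≤ r := by
      refine le_of_not_gt fun hlt => ?_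
      have h3 : r ^ 2 < (2 * g - m) ^ 2 := by nlinarith
      rw [hr2] at h3
      have h2 : g ^ 2 ≤ g ^ 2 * b / τ := by rw [le_div_iff₀ hτ0]; nlinarith
      nlinarith [mul_pos hg (sub_pos.2 hτb)]
    linarith
  · rw [Complex.ofReal_re]; linarith
  · rw [Complex.norm_real, Real.norm_eq_abs, abs_of_pos hτ0]; exact hτg.le

end Roots

section Splitting

variable {b g : ℝ} {lam t t₁ t₂ t₃ : ℂ}

theorem isClosed_exists_triple (hb : 0 < b) {L : ℝ → ℂ} (hL : Continuous L)
    {S : Set (ℂ × ℂ × ℂ)} (hS : IsClosed S) :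
    IsClosed {s : ℝ | s ∈ Icc (0 : ℝ) 1 ∧ ∃ t₁ t₂ t₃, IsRootTriple b g (L s) t₁ t₂ t₃ ∧
      (t₁, t₂, t₃) ∈ S} := by
  obtain ⟨M, hM⟩ := (isCompact_Icc (a := (0 : ℝ)) (b := 1)).exists_bound_of_continuousOn hL.continuousOn
  set R := 1 + b + (g ^ 2 + M) + g ^ 2 * b with hR
  set T : Set (ℝ × ℂ × ℂ × ℂ) := {x | x.2.1 + x.2.2.1 + x.2.2.2 = b ∧
      x.2.1 * x.2.2.1 + x.2.1 * x.2.2.2 + x.2.2.1 * x.2.2.2 = -(g : ℂ) ^ 2 - L x.1 ∧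
      x.2.1 * x.2.2.1 * x.2.2.2 = -((g : ℂ) ^ 2 * b) ∧ x.2 ∈ S} with hT
  have hTc : IsClosed T := by
    refine IsClosed.inter (isClosed_eq (by fun_prop) (by fun_prop)) (IsClosed.inter
      (isClosed_eq (by fun_prop) (by fun_prop)) (IsClosed.inter
      (isClosed_eq (by fun_prop) (by fun_prop)) (hS.preimage continuous_snd)))
  have hK : IsCompact (Icc (0 : ℝ) 1 ×ˢ (Metric.closedBall (0 : ℂ) R ×ˢ
      (Metric.closedBall (0 : ℂ) R ×ˢ Metric.closedBall (0 : ℂ) R))) :=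
    isCompact_Icc.prod ((isCompact_closedBall _ _).prod
      ((isCompact_closedBall _ _).prod (isCompact_closedBall _ _)))
  have himg := ((hK.inter_right hTc).image continuous_fst).isClosed
  convert himg using 1
  ext s
  constructor
  · rintro ⟨hs, t₁, t₂, t₃, h, hmem⟩
    have bd : ∀ t : ℂ, (t ^ 2 - (g : ℂ) ^ 2) * (t - b) = L s * t → t ∈ Metric.closedBall (0 : ℂ) R := by
      intro t ht
      rw [mem_closedBall_zero_iff]
      exact (norm_le_of_root hb ht).trans (by rw [hR]; linarith [hM s hs])
    exact ⟨(s, t₁, t₂, t₃), ⟨⟨hs, bd _ h.root, bd _ h.rotate.root, bd _ h.rotate.rotate.root⟩,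
      h.sum_eq, h.sum_mul_eq, h.prod_eq, hmem⟩, rfl⟩
  · rintro ⟨⟨s', t₁, t₂, t₃⟩, ⟨⟨hs, -⟩, h1, h2, h3, h4⟩, rfl⟩
    exact ⟨hs, t₁, t₂, t₃, ⟨h1, h2, h3⟩, h4⟩

/-- For `Re λ ≥ 0`, `λ ≠ 0`, exactly one root lies in the outer region. -/
theorem exists_split_triple_of_ne_zero (hb : 0 < b) (hg : 0 < g) (hlam : 0 ≤ lam.re)
    (hlam0 : lam ≠ 0) : ∃ t₁ t₂ t₃, IsRootTriple b g lam t₁ t₂ t₃ ∧ t₁ ∈ outerRegion g ∧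
      t₂ ∈ innerRegion g ∧ t₃ ∈ innerRegion g := by
  obtain ⟨Λ, u₁, u₂, u₃, hΛ, hu, hu1, hu2, hu3⟩ := exists_base_triple hb hg
  set L : ℝ → ℂ := fun s => (1 - s : ℝ) * (Λ : ℂ) + (s : ℂ) * lam with hL
  have hLc : Continuous L := by rw [hL]; fun_prop
  have hLre : ∀ s, (L s).re = (1 - s) * Λ + s * lam.re := fun s => by
    simp [hL]
  have hL0 : ∀ s ∈ Icc (0 : ℝ) 1, 0 ≤ (L s).re := fun s hs => by
    rw [hLre]
    exact add_nonneg (mul_nonneg (by linarith [hs.2]) hΛ.le) (mul_nonneg hs.1 hlam)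
  have hLne : ∀ s ∈ Icc (0 : ℝ) 1, L s ≠ 0 := by
    intro s hs h0
    have h1 := hLre s
    rw [h0, Complex.zero_re] at h1
    have h2 : 0 ≤ (1 - s) * Λ := mul_nonneg (by linarith [hs.2]) hΛ.le
    have h3 : 0 ≤ s * lam.re := mul_nonneg hs.1 hlam
    have h4 : (1 - s) * Λ = 0 := by linarith
    have h5 : s = 1 := by
      rcases mul_eq_zero.1 h4 with h | h
      · linarith
      · exact absurd h hΛ.ne'
    subst h5
    simp [hL] at h0
    exact hlam0 h0
  have hclP := isClosed_exists_triple (g := g) hb hLc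
    (((isClosed_outerRegion g).preimage continuous_fst).inter
      ((((isClosed_innerRegion g).preimage continuous_fst).preimage continuous_snd).inter
      (((isClosed_innerRegion g).preimage continuous_snd).preimage continuous_snd)) :
      IsClosed ((Prod.fst ⁻¹' outerRegion g : Set (ℂ × ℂ × ℂ)) ∩ _))
  have hclQ := isClosed_exists_triple (g := g) hb hLc
    ((((isClosed_outerRegion g).preimage continuous_fst).inter
      (((isClosed_outerRegion g).preimage continuous_fst).preimage continuous_snd)).union
      (((isClosed_innerRegion g).preimage continuous_fst).inter
      ((((isClosed_innerRegion g).preimage continuous_fst).preimage continuous_snd).inter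
      (((isClosed_innerRegion g).preimage continuous_snd).preimage continuous_snd))) :
      IsClosed (((Prod.fst ⁻¹' outerRegion g : Set (ℂ × ℂ × ℂ)) ∩ _) ∪ _))
  have hcover : ∀ s ∈ Icc (0 : ℝ) 1,
      (∃ t₁ t₂ t₃, IsRootTriple b g (L s) t₁ t₂ t₃ ∧ t₁ ∈ outerRegion g ∧ t₂ ∈ innerRegion g ∧
        t₃ ∈ innerRegion g) ∨
      (∃ t₁ t₂ t₃, IsRootTriple b g (L s) t₁ t₂ t₃ ∧ ((t₁ ∈ outerRegion g ∧ t₂ ∈ outerRegion g) ∨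
        (t₁ ∈ innerRegion g ∧ t₂ ∈ innerRegion g ∧ t₃ ∈ innerRegion g))) := by
    intro s _
    obtain ⟨t₁, t₂, t₃, h1, h2, h3⟩ := exists_three_roots (b : ℂ) (-(g : ℂ) ^ 2 - L s)
      (-((g : ℂ) ^ 2 * b))
    have h : IsRootTriple b g (L s) t₁ t₂ t₃ := ⟨h1, h2, h3⟩
    rcases mem_outer_or_inner g t₁ with a1 | a1 <;> rcases mem_outer_or_inner g t₂ with a2 | a2 <;>
      rcases mem_outer_or_inner g t₃ with a3 | a3
    · exact Or.inr ⟨_, _, _, h, Or.inl ⟨a1, a2⟩⟩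
    · exact Or.inr ⟨_, _, _, h, Or.inl ⟨a1, a2⟩⟩
    · exact Or.inr ⟨_, _, _, h.swap, Or.inl ⟨a1, a3⟩⟩
    · exact Or.inl ⟨_, _, _, h, a1, a2, a3⟩
    · exact Or.inr ⟨_, _, _, h.rotate, Or.inl ⟨a2, a3⟩⟩
    · exact Or.inl ⟨_, _, _, h.rotate, a2, a3, a1⟩
    · exact Or.inl ⟨_, _, _, h.rotate.rotate, a3, a1, a2⟩
    · exact Or.inr ⟨_, _, _, h, Or.inr ⟨a1, a2, a3⟩⟩
  have hdisj : ∀ s ∈ Icc (0 : ℝ) 1,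
      (∃ t₁ t₂ t₃, IsRootTriple b g (L s) t₁ t₂ t₃ ∧ t₁ ∈ outerRegion g ∧ t₂ ∈ innerRegion g ∧
        t₃ ∈ innerRegion g) →
      ¬ (∃ t₁ t₂ t₃, IsRootTriple b g (L s) t₁ t₂ t₃ ∧ ((t₁ ∈ outerRegion g ∧ t₂ ∈ outerRegion g) ∨
        (t₁ ∈ innerRegion g ∧ t₂ ∈ innerRegion g ∧ t₃ ∈ innerRegion g))) := by
    rintro s hs ⟨t₁, t₂, t₃, h, h1, h2, h3⟩ ⟨v₁, v₂, v₃, k, hk⟩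
    have nb : ∀ t : ℂ, (t ^ 2 - (g : ℂ) ^ 2) * (t - b) = L s * t → t ∈ outerRegion g →
        t ∉ innerRegion g := fun t ht ho =>
      not_mem_inner_of_outer hb hg (hL0 s hs) (hLne s hs) ht ho
    rcases hk with ⟨k1, k2⟩ | ⟨k1, k2, k3⟩
    · have eq1 : ∀ v : ℂ, (v ^ 2 - (g : ℂ) ^ 2) * (v - b) = L s * v → v ∈ outerRegion g → v = t₁ := by
        intro v hv hvo
        rcases h.eq_or_eq_or_eq hv with e | e | e
        · exact e
        · exact absurd (e ▸ h2) (nb v hv hvo)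
        · exact absurd (e ▸ h3) (nb v hv hvo)
      have e1 := eq1 v₁ k.root k1
      have e2 := eq1 v₂ k.rotate.root k2
      have ht0 := ne_zero_of_root hb hg h.root
      subst e1
      rw [e2] at k
      have h4 : (v₁ - t₂) * (v₁ - t₃) * v₁ = 0 := by
        linear_combination v₁ ^ 2 * (k.sum_eq - h.sum_eq) - k.prod_eq + h.prod_eq
      rcases mul_eq_zero.1 h4 with h5 | h5
      · rcases mul_eq_zero.1 h5 with h6 | h6
        · exact nb _ h.root h1 (sub_eq_zero.1 h6 ▸ h2)
        · exact nb _ h.root h1 (sub_eq_zero.1 h6 ▸ h3)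
      · exact ht0 h5
    · rcases k.eq_or_eq_or_eq h.root with e | e | e
      · exact nb _ h.root h1 (e ▸ k1)
      · exact nb _ h.root h1 (e ▸ k2)
      · exact nb _ h.root h1 (e ▸ k3)
  by_contra hcon
  have hpre := isPreconnected_closed_iff.1 (isPreconnected_Icc (a := (0 : ℝ)) (b := 1)) _ _ hclP hclQ
    (fun s hs => (hcover s hs).imp (fun h => ⟨hs, h⟩) (fun h => ⟨hs, h⟩))
    ⟨0, ⟨le_rfl, zero_le_one⟩, ⟨le_rfl, zero_le_one⟩, u₁, u₂, u₃, by simpa [hL] using hu, hu1, hu2, hu3⟩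
    (by
      have h1 : (1 : ℝ) ∈ Icc (0 : ℝ) 1 := ⟨zero_le_one, le_rfl⟩
      refine ⟨1, h1, h1, ?_⟩
      refine (hcover 1 h1).resolve_left fun h => hcon ?_
      simpa [hL] using h)
  obtain ⟨s, hs, ⟨-, hP⟩, ⟨-, hQ⟩⟩ := hpre
  exact hdisj s hs hP hQ

/-- A root triple whose first member lies in the outer region and the others in the inner region. -/
structure IsSplitTriple (b g : ℝ) (lam t₁ t₂ t₃ : ℂ) : Prop extends
    IsRootTriple b g lam t₁ t₂ t₃ where
  re_pos : 0 < t₁.re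
  le_norm : g ≤ ‖t₁‖
  inner₂ : t₂ ∈ innerRegion g
  inner₃ : t₃ ∈ innerRegion g

theorem IsSplitTriple.swap (h : IsSplitTriple b g lam t₁ t₂ t₃) : IsSplitTriple b g lam t₁ t₃ t₂ :=
  ⟨h.toIsRootTriple.swap, h.re_pos, h.le_norm, h.inner₃, h.inner₂⟩

theorem exists_split_triple (hb : 0 < b) (hg : 0 < g) (hlam : 0 ≤ lam.re) :
    ∃ t₁ t₂ t₃, IsSplitTriple b g lam t₁ t₂ t₃ := by
  rcases eq_or_ne lam 0 with rfl | h0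
  · have hg' : -(g : ℂ) ∈ innerRegion g := Or.inl (by simpa using hg.le)
    rcases le_total b g with h | h
    · exact ⟨g, -g, b, ⟨⟨by ring, by ring, by ring⟩, by simpa using hg,
        by rw [Complex.norm_real]; exact le_abs_self g, hg',
        Or.inr (by rw [Complex.norm_real, Real.norm_of_nonneg hb.le]; exact h)⟩⟩
    · exact ⟨b, -g, g, ⟨⟨by ring, by ring, by ring⟩, by simpa using hb,
        by rw [Complex.norm_real]; exact h.trans (le_abs_self b), hg',
        Or.inr (by rw [Complex.norm_real, Real.norm_of_nonneg hg.le])⟩⟩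
  · obtain ⟨t₁, t₂, t₃, h, h1, h2, h3⟩ := exists_split_triple_of_ne_zero hb hg hlam h0
    exact ⟨t₁, t₂, t₃, ⟨h, lt_of_le_of_ne h1.1 (re_ne_zero_of_root hb hg hlam h.root).symm,
      h1.2, h2, h3⟩⟩

theorem re_eigenvalue_mul_eq (h : IsRootTriple b g lam t₁ t₂ t₃) :
    ((t₁ + t₂) * (t₁ + t₃)).re * ‖t₁‖ ^ 2 = b * t₁.re * (‖t₁‖ ^ 2 - g ^ 2) := by
  have e : (t₁ + t₂) * (t₁ + t₃) * t₁ = b * (t₁ ^ 2 - (g : ℂ) ^ 2) := by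
    linear_combination t₁ ^ 2 * h.sum_eq + h.prod_eq
  have h1 : (t₁ + t₂) * (t₁ + t₃) * (‖t₁‖ ^ 2 : ℝ)
      = b * (t₁ ^ 2 - (g : ℂ) ^ 2) * (starRingEnd ℂ t₁) := by
    rw [← e, mul_assoc _ t₁, Complex.mul_conj, Complex.normSq_eq_norm_sq]
  have h2 := congrArg Complex.re h1
  rw [Complex.re_mul_ofReal] at h2
  rw [h2, ← Complex.normSq_eq_norm_sq, Complex.normSq_apply]
  simp [pow_two]
  ring

theorem re_eigenvalue_nonpos (hb : 0 < b) (hg : 0 < g) (hlam : 0 ≤ lam.re)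
    (h : IsRootTriple b g lam t₁ t₂ t₃) (hi : t₁ ∈ innerRegion g) :
    ((t₁ + t₂) * (t₁ + t₃)).re ≤ 0 := by
  have h1 := re_eigenvalue_mul_eq h
  have h2 : 0 < ‖t₁‖ ^ 2 := by
    have := norm_pos_iff.2 (ne_zero_of_root hb hg h.root); positivity
  have h3 : b * t₁.re * (‖t₁‖ ^ 2 - g ^ 2) ≤ 0 := by
    rcases le_total t₁.re 0 with hr | hr <;> rcases le_total ‖t₁‖ g with hn | hn
    · have h4 := re_mul_normSq_eq h.root
      have h5 : ‖t₁‖ ^ 2 = t₁.re ^ 2 + t₁.im ^ 2 := by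
        rw [← Complex.normSq_eq_norm_sq, Complex.normSq_apply]; ring
      have h6 : ‖t₁‖ ^ 2 ≤ g ^ 2 := pow_le_pow_left₀ (norm_nonneg _) hn 2
      have h7 : t₁.re ^ 2 - t₁.im ^ 2 - g ^ 2 ≤ 0 := by nlinarith [sq_nonneg t₁.im]
      nlinarith [mul_nonneg hlam h2.le, mul_nonpos_of_nonneg_of_nonpos h2.le h7]
    · have h6 : g ^ 2 ≤ ‖t₁‖ ^ 2 := pow_le_pow_left₀ hg.le hn 2
      exact mul_nonpos_of_nonpos_of_nonneg (mul_nonpos_of_nonneg_of_nonpos hb.le hr) (by linarith)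
    · have h6 : ‖t₁‖ ^ 2 ≤ g ^ 2 := pow_le_pow_left₀ (norm_nonneg _) hn 2
      exact mul_nonpos_of_nonneg_of_nonpos (mul_nonneg hb.le hr) (by linarith)
    · rcases hi with hi | hi
      · have h6 : t₁.re = 0 := le_antisymm hi hr
        simp [h6]
      · have h6 : ‖t₁‖ = g := le_antisymm hi hn
        simp [h6]
  by_contra! hc
  nlinarith [mul_pos hc h2]

theorem IsSplitTriple.re_eigenvalue₂ (hb : 0 < b) (hg : 0 < g) (hlam : 0 ≤ lam.re)
    (h : IsSplitTriple b g lam t₁ t₂ t₃) : ((t₁ + t₂) * (t₂ + t₃)).re ≤ 0 := by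
  have := re_eigenvalue_nonpos hb hg hlam h.toIsRootTriple.rotate h.inner₂
  rwa [mul_comm, add_comm t₂ t₁] at this

theorem IsSplitTriple.re_eigenvalue₃ (hb : 0 < b) (hg : 0 < g) (hlam : 0 ≤ lam.re)
    (h : IsSplitTriple b g lam t₁ t₂ t₃) : ((t₁ + t₃) * (t₂ + t₃)).re ≤ 0 := by
  have := h.swap.re_eigenvalue₂ hb hg hlam
  rwa [add_comm t₃ t₂] at this

theorem IsSplitTriple.re_eigenvalue₁_nonneg (hb : 0 < b) (hg : 0 < g)
    (h : IsSplitTriple b g lam t₁ t₂ t₃) : 0 ≤ ((t₁ + t₂) * (t₁ + t₃)).re := by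
  have h1 := re_eigenvalue_mul_eq h.toIsRootTriple
  have h2 : 0 < ‖t₁‖ ^ 2 := by have := hg.trans_le h.le_norm; positivity
  have h6 : g ^ 2 ≤ ‖t₁‖ ^ 2 := pow_le_pow_left₀ hg.le h.le_norm 2
  have h3 : 0 ≤ b * t₁.re * (‖t₁‖ ^ 2 - g ^ 2) :=
    mul_nonneg (mul_nonneg hb.le h.re_pos.le) (by linarith)
  by_contra! hc
  nlinarith [mul_neg_of_neg_of_pos hc h2]

theorem IsSplitTriple.re_eigenvalue₁_pos (hb : 0 < b) (hg : 0 < g)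
    (h : IsSplitTriple b g lam t₁ t₂ t₃) (hlt : g < ‖t₁‖) :
    0 < ((t₁ + t₂) * (t₁ + t₃)).re := by
  have h1 := re_eigenvalue_mul_eq h.toIsRootTriple
  have h6 : g ^ 2 < ‖t₁‖ ^ 2 := pow_lt_pow_left₀ hlt hg.le two_ne_zero
  have h3 : 0 < b * t₁.re * (‖t₁‖ ^ 2 - g ^ 2) :=
    mul_pos (mul_pos hb h.re_pos) (by linarith)
  by_contra! hc
  nlinarith [sq_nonneg ‖t₁‖]

theorem IsSplitTriple.lt_norm (hg : 0 < g) (hlam : 0 ≤ lam.re) (hlam0 : lam ≠ 0)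
    (h : IsSplitTriple b g lam t₁ t₂ t₃) : g < ‖t₁‖ :=
  lt_of_le_of_ne h.le_norm (norm_ne_of_root hg hlam hlam0 h.toIsRootTriple.root).symm

theorem IsSplitTriple.lt_norm_of_lt (hg : 0 < g) (hgb : g < b) (hlam : 0 ≤ lam.re)
    (h : IsSplitTriple b g lam t₁ t₂ t₃) : g < ‖t₁‖ := by
  rcases eq_or_ne lam 0 with rfl | h0
  · refine lt_of_le_of_ne h.le_norm fun heq => ?_
    have hb : 0 < b := hg.trans hgb
    have key : ((b : ℂ) - t₁) * (b - t₂) * (b - t₃) = 0 := by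
      rw [← h.toIsRootTriple.factor b]; ring
    have hbo : (b : ℂ) ∉ innerRegion g := by
      rintro (hc | hc)
      · rw [Complex.ofReal_re] at hc; linarith
      · rw [Complex.norm_real, Real.norm_of_nonneg hb.le] at hc; linarith
    rcases mul_eq_zero.1 key with h1 | h1
    · rcases mul_eq_zero.1 h1 with h2 | h2
      · rw [← sub_eq_zero.1 h2, Complex.norm_real, Real.norm_of_nonneg hb.le] at heq
        linarith
      · exact hbo (sub_eq_zero.1 h2 ▸ h.inner₂)
    · exact hbo (sub_eq_zero.1 h1 ▸ h.inner₃)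
  · exact h.lt_norm hg hlam h0

end Splitting

section SystemMatrix

attribute [local instance] Matrix.linftyOpNormedRing Matrix.linftyOpNormedAlgebra

/-- The common form of `evansMatrix` and `limitMatrix`. -/
noncomputable def sysMatrix (w f : ℝ) (lam : ℂ) : Matrix (Fin 3) (Fin 3) ℂ :=
  !![0, lam, 1;
     0, 0, 1;
     lam * (w : ℂ), lam * (w : ℂ), (f : ℂ) - lam]

theorem limitMatrix_eq (w : ℝ) (lam : ℂ) : limitMatrix w lam = sysMatrix w (2 * w - 1) lam := rfl

variable {w f : ℝ} {lam : ℂ}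

theorem sysMatrix_annihilated {μ α β : ℂ} (h1 : μ + α + β = f - lam)
    (h2 : μ * α + μ * β + α * β = -2 * lam * w) (h3 : μ * α * β = lam ^ 2 * w) :
    (sysMatrix w f lam - β • (1 : Matrix (Fin 3) (Fin 3) ℂ)) *
      ((sysMatrix w f lam - α • (1 : Matrix (Fin 3) (Fin 3) ℂ)) *
        (sysMatrix w f lam - μ • (1 : Matrix (Fin 3) (Fin 3) ℂ))) = 0 := by
  have cayley : sysMatrix w f lam * (sysMatrix w f lam * sysMatrix w f lam)
      - (f - lam) • (sysMatrix w f lam * sysMatrix w f lam)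
      + (-2 * lam * w) • sysMatrix w f lam - (lam ^ 2 * w) • (1 : Matrix (Fin 3) (Fin 3) ℂ) = 0 := by
    ext i j
    fin_cases i <;> fin_cases j <;>
      simp [sysMatrix] <;> ring
  rw [← cayley, ← h1, ← h2, ← h3]
  simp only [sub_mul, mul_sub, smul_mul_assoc, mul_smul_comm, one_mul, mul_one]
  module

theorem neg_annihilated {A : Matrix (Fin 3) (Fin 3) ℂ} {μ α β : ℂ}
    (h : (A - β • (1 : Matrix (Fin 3) (Fin 3) ℂ)) * ((A - α • (1 : Matrix (Fin 3) (Fin 3) ℂ)) *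
      (A - μ • (1 : Matrix (Fin 3) (Fin 3) ℂ))) = 0) :
    (-A - (-β) • (1 : Matrix (Fin 3) (Fin 3) ℂ)) * ((-A - (-α) • (1 : Matrix (Fin 3) (Fin 3) ℂ)) *
      (-A - (-μ) • (1 : Matrix (Fin 3) (Fin 3) ℂ))) = 0 := by
  have e : ∀ τ : ℂ, -A - (-τ) • (1 : Matrix (Fin 3) (Fin 3) ℂ)
      = -(A - τ • (1 : Matrix (Fin 3) (Fin 3) ℂ)) := fun τ => by rw [neg_smul]; abel
  rw [e, e, e, neg_mul_neg, neg_mul, h, neg_zero]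

theorem neg_conjTranspose_annihilated {A : Matrix (Fin 3) (Fin 3) ℂ} {μ α β : ℂ}
    (h : (A - μ • (1 : Matrix (Fin 3) (Fin 3) ℂ)) * ((A - α • (1 : Matrix (Fin 3) (Fin 3) ℂ)) *
      (A - β • (1 : Matrix (Fin 3) (Fin 3) ℂ))) = 0) :
    (-Aᴴ - (-star β) • (1 : Matrix (Fin 3) (Fin 3) ℂ)) *
      ((-Aᴴ - (-star α) • (1 : Matrix (Fin 3) (Fin 3) ℂ)) *
      (-Aᴴ - (-star μ) • (1 : Matrix (Fin 3) (Fin 3) ℂ))) = 0 := by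
  apply neg_annihilated
  have := congrArg Matrix.conjTranspose h
  simpa [Matrix.conjTranspose_mul, Matrix.conjTranspose_sub, Matrix.conjTranspose_smul, mul_assoc]
    using this

theorem norm_le_sum_entries (M : Matrix (Fin 3) (Fin 3) ℂ) : ‖M‖ ≤ ∑ i, ∑ j, ‖M i j‖ := by
  rw [Matrix.linfty_opNorm_def]
  have h : (Finset.univ.sup fun i => ∑ j, ‖M i j‖₊) ≤ ∑ i, ∑ j, ‖M i j‖₊ :=
    Finset.sup_le fun i _ => Finset.single_le_sum (f := fun i => ∑ j, ‖M i j‖₊)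
      (fun _ _ => zero_le) (Finset.mem_univ i)
  have h2 : (((Finset.univ.sup fun i => ∑ j, ‖M i j‖₊ : NNReal)) : ℝ)
      ≤ ((∑ i, ∑ j, ‖M i j‖₊ : NNReal) : ℝ) := NNReal.coe_le_coe.2 h
  refine h2.trans (le_of_eq ?_)
  push_cast
  rfl

theorem norm_sysMatrix_sub_le (w f w' f' : ℝ) (lam lam' : ℂ) :
    ‖sysMatrix w f lam - sysMatrix w' f' lam'‖
      ≤ 2 * ‖lam * w - lam' * w'‖ + |f - f'| + 2 * ‖lam - lam'‖ := by
  refine (norm_le_sum_entries _).trans ?_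
  have h : ‖(f : ℂ) - lam - (f' - lam')‖ ≤ |f - f'| + ‖lam - lam'‖ := by
    have e : (f : ℂ) - lam - (f' - lam') = ((f - f' : ℝ) : ℂ) - (lam - lam') := by push_cast; ring
    rw [e]
    refine (norm_sub_le _ _).trans (le_of_eq ?_)
    rw [Complex.norm_real, Real.norm_eq_abs]
  simp [sysMatrix, Fin.sum_univ_three]
  linarith

theorem norm_sysMatrix_conjTranspose_sub_le (w f w' f' : ℝ) (lam lam' : ℂ) :
    ‖-(sysMatrix w f lam)ᴴ - -(sysMatrix w' f' lam')ᴴ‖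
      ≤ 2 * ‖lam * w - lam' * w'‖ + |f - f'| + 2 * ‖lam - lam'‖ := by
  refine (norm_le_sum_entries _).trans ?_
  have h : ‖(f : ℂ) - lam - (f' - lam')‖ ≤ |f - f'| + ‖lam - lam'‖ := by
    have e : (f : ℂ) - lam - (f' - lam') = ((f - f' : ℝ) : ℂ) - (lam - lam') := by push_cast; ring
    rw [e]
    refine (norm_sub_le _ _).trans (le_of_eq ?_)
    rw [Complex.norm_real, Real.norm_eq_abs]
  have entry : ∀ i j, ‖(-(sysMatrix w f lam)ᴴ - -(sysMatrix w' f' lam')ᴴ) i j‖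
      = ‖(sysMatrix w f lam - sysMatrix w' f' lam') j i‖ := by
    intro i j
    have e : (-(sysMatrix w f lam)ᴴ - -(sysMatrix w' f' lam')ᴴ) i j
        = -star ((sysMatrix w f lam - sysMatrix w' f' lam') j i) := by
      simp only [Matrix.sub_apply, Matrix.neg_apply, Matrix.conjTranspose_apply, star_sub]
      ring
    rw [e, norm_neg, norm_star]
  simp only [entry]
  simp [sysMatrix, Fin.sum_univ_three]
  linarith

theorem continuous_sysMatrix {u φ : ℝ → ℝ} (hu : Continuous u) (hφ : Continuous φ) (lam : ℂ) :
    Continuous fun x => sysMatrix (u x) (φ x) lam := by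
  refine continuous_matrix fun i j => ?_
  fin_cases i <;> fin_cases j <;> simp [sysMatrix] <;> fun_prop

theorem sysMatrix_mulVec (V : Fin 3 → ℂ) : sysMatrix w f lam *ᵥ V
    = ![lam * V 1 + V 2, V 2, lam * w * V 0 + lam * w * V 1 + (f - lam) * V 2] := by
  ext i
  fin_cases i <;> simp [sysMatrix, Matrix.mulVec, dotProduct, Fin.sum_univ_three]

theorem vecMul_sysMatrix (l : Fin 3 → ℂ) : l ᵥ* sysMatrix w f lam
    = ![lam * w * l 2, lam * l 0 + lam * w * l 2, l 0 + l 1 + (f - lam) * l 2] := by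
  ext i
  fin_cases i <;> simp [sysMatrix, Matrix.vecMul, dotProduct, Fin.sum_univ_three] <;> ring

/-- The eigenvector of `sysMatrix` for an eigenvalue `μ ≠ 0`, with second entry `n`. -/
noncomputable def unstableVector (lam μ n : ℂ) : Fin 3 → ℂ := ![(lam + μ) / μ * n, n, μ * n]

theorem sysMatrix_mulVec_unstableVector {μ n : ℂ} (hμ : μ ≠ 0)
    (h : μ ^ 3 + (lam - f) * μ ^ 2 - 2 * lam * w * μ - lam ^ 2 * w = 0) :
    sysMatrix w f lam *ᵥ unstableVector lam μ n = μ • unstableVector lam μ n := by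
  rw [sysMatrix_mulVec]
  ext i
  fin_cases i
  · simp [unstableVector]; field_simp
  · simp [unstableVector]
  · simp [unstableVector]
    field_simp
    linear_combination -n * h

theorem eq_unstableVector {μ n : ℂ} {V : Fin 3 → ℂ} (hμ : μ ≠ 0)
    (h : sysMatrix w f lam *ᵥ V = μ • V) (hn : V 1 = n) : V = unstableVector lam μ n := by
  rw [sysMatrix_mulVec] at h
  have h0 := congrFun h 0
  have h1 := congrFun h 1
  simp at h0 h1
  rw [hn] at h0 h1
  ext i
  fin_cases i
  · simp [unstableVector]
    field_simp
    linear_combination -h0 + h1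
  · simp [unstableVector, hn]
  · simp [unstableVector, h1]

theorem charpoly_eq_zero_of_eigenvector {μ n : ℂ} {V : Fin 3 → ℂ} (hn0 : n ≠ 0)
    (h : sysMatrix w f lam *ᵥ V = μ • V) (hn : V 1 = n) :
    μ ^ 3 + (lam - f) * μ ^ 2 - 2 * lam * w * μ - lam ^ 2 * w = 0 := by
  rw [sysMatrix_mulVec] at h
  have h0 := congrFun h 0
  have h1 := congrFun h 1
  have h2 := congrFun h 2
  simp at h0 h1 h2
  rw [hn] at h0 h1 h2
  have : (μ ^ 3 + (lam - f) * μ ^ 2 - 2 * lam * w * μ - lam ^ 2 * w) * n = 0 := by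
    linear_combination -μ * h2 - lam * w * h0 - (μ ^ 2 - μ * (f - lam) - lam * w) * h1
  exact (mul_eq_zero.1 this).resolve_right hn0

/-- The roots of the characteristic polynomial in terms of a root triple. -/
theorem eigenvalue_symmetric {b g : ℝ} {t₁ t₂ t₃ : ℂ} (h : IsRootTriple b g lam t₁ t₂ t₃)
    (hb : b ^ 2 = w) (hg : g ^ 2 = w - f) :
    (t₁ + t₂) * (t₁ + t₃) + (t₁ + t₂) * (t₂ + t₃) + (t₁ + t₃) * (t₂ + t₃) = f - lam ∧
    (t₁ + t₂) * (t₁ + t₃) * ((t₁ + t₂) * (t₂ + t₃)) + (t₁ + t₂) * (t₁ + t₃) * ((t₁ + t₃) * (t₂ + t₃))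
      + (t₁ + t₂) * (t₂ + t₃) * ((t₁ + t₃) * (t₂ + t₃)) = -2 * lam * w ∧
    (t₁ + t₂) * (t₁ + t₃) * ((t₁ + t₂) * (t₂ + t₃)) * ((t₁ + t₃) * (t₂ + t₃)) = lam ^ 2 * w := by
  have hb' : (b : ℂ) ^ 2 = w := by exact_mod_cast hb
  have hg' : (g : ℂ) ^ 2 = w - f := by exact_mod_cast hg
  have key : (t₁ + t₂) * (t₁ + t₃) * (t₂ + t₃) = -(b * lam) := by
    linear_combination (t₁ * t₂ + t₁ * t₃ + t₂ * t₃) * h.sum_eq + b * h.sum_mul_eq - h.prod_eq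
  refine ⟨?_, ?_, ?_⟩
  · linear_combination (t₁ + t₂ + t₃ + b) * h.sum_eq + h.sum_mul_eq + hb' - hg'
  · linear_combination (2 * (t₁ + t₂ + t₃)) * key - 2 * b * lam * h.sum_eq - 2 * lam * hb'
  · linear_combination ((t₁ + t₂) * (t₁ + t₃) * (t₂ + t₃) - b * lam) * key + lam ^ 2 * hb'

theorem charpoly_factor {μ α β : ℂ} (h1 : μ + α + β = f - lam)
    (h2 : μ * α + μ * β + α * β = -2 * lam * w) (h3 : μ * α * β = lam ^ 2 * w) (x : ℂ) :
    x ^ 3 + (lam - f) * x ^ 2 - 2 * lam * w * x - lam ^ 2 * w = (x - μ) * (x - α) * (x - β) := by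
  linear_combination x ^ 2 * h1 - x * h2 + h3

theorem eq_of_charpoly {μ α β x : ℂ} (h1 : μ + α + β = f - lam)
    (h2 : μ * α + μ * β + α * β = -2 * lam * w) (h3 : μ * α * β = lam ^ 2 * w)
    (hα : α.re ≤ 0) (hβ : β.re ≤ 0) (hx : 0 < x.re)
    (h : x ^ 3 + (lam - f) * x ^ 2 - 2 * lam * w * x - lam ^ 2 * w = 0) : x = μ := by
  rw [charpoly_factor h1 h2 h3] at h
  rcases mul_eq_zero.1 h with h | h
  · rcases mul_eq_zero.1 h with h | h
    · exact sub_eq_zero.1 h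
    · rw [sub_eq_zero.1 h] at hx; linarith
  · rw [sub_eq_zero.1 h] at hx; linarith

theorem norm_root_le {μ α β : ℂ} {M : ℝ} (hM : 1 ≤ M) (h1 : ‖μ + α + β‖ ≤ M)
    (h2 : ‖μ * α + μ * β + α * β‖ ≤ M) (h3 : ‖μ * α * β‖ ≤ M) : ‖α‖ ≤ 3 * M := by
  by_contra! hc
  have e : α ^ 3 = (μ + α + β) * α ^ 2 - (μ * α + μ * β + α * β) * α + μ * α * β := by ring
  have h4 : ‖α‖ ^ 3 ≤ M * ‖α‖ ^ 2 + M * ‖α‖ + M := by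
    rw [← norm_pow, e]
    refine (norm_add_le _ _).trans (add_le_add ((norm_sub_le _ _).trans (add_le_add ?_ ?_)) h3)
    · rw [norm_mul, norm_pow]; exact mul_le_mul_of_nonneg_right h1 (by positivity)
    · rw [norm_mul]; exact mul_le_mul_of_nonneg_right h2 (by positivity)
  have h5 : 1 ≤ ‖α‖ := by linarith
  have h6 : ‖α‖ ≤ ‖α‖ ^ 2 := by nlinarith
  have h7 : M * ‖α‖ ^ 2 + M * ‖α‖ + M ≤ 3 * M * ‖α‖ ^ 2 := by nlinarith
  have h8 : 3 * M * ‖α‖ ^ 2 < ‖α‖ * ‖α‖ ^ 2 := mul_lt_mul_of_pos_right hc (by positivity)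
  nlinarith

theorem isModeAtBot_iff {M : ℝ → Matrix (Fin 3) (Fin 3) ℂ} {μ : ℂ} {V : Fin 3 → ℂ}
    {W : ℝ → Fin 3 → ℂ} :
    IsModeAtBot M μ V W ↔ IsModeAtTop (fun x => -M (-x)) (-μ) V fun x => W (-x) := by
  have key : ∀ {N : ℝ → Matrix (Fin 3) (Fin 3) ℂ} {Y : ℝ → Fin 3 → ℂ}, SolvesODE N Y →
      SolvesODE (fun x => -N (-x)) fun x => Y (-x) := by
    intro N Y h x
    have := (h (-x)).scomp x (hasDerivAt_neg x)
    exact this.congr_deriv (by simp [Matrix.neg_mulVec])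
  constructor
  · rintro ⟨h1, h2⟩
    refine ⟨key h1, (h2.comp tendsto_neg_atTop_atBot).congr fun x => ?_⟩
    simp
  · rintro ⟨h1, h2⟩
    refine ⟨by simpa using key h1, (h2.comp tendsto_neg_atBot_atTop).congr fun x => ?_⟩
    simp

end SystemMatrix

section Dual

variable {b g w f : ℝ} {lam t₁ t₂ t₃ : ℂ}

/-- The dual eigenvector with second entry `n` attached to the root `t` of the cubic. -/
noncomputable def dualVector (b : ℝ) (t n : ℂ) : Fin 3 → ℂ :=
  ![n * star ((b : ℂ) / t), n, n * star (1 / (t * (t - b)))]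

theorem adjoint_eigen_iff {A : Matrix (Fin 3) (Fin 3) ℂ} {V : Fin 3 → ℂ} {μ : ℂ} :
    (-Aᴴ) *ᵥ V = μ • V ↔ star V ᵥ* A = (-star μ) • star V := by
  rw [← star_injective.eq_iff, Matrix.star_mulVec, Matrix.conjTranspose_neg,
    Matrix.conjTranspose_conjTranspose, Matrix.vecMul_neg, star_smul, neg_smul, neg_eq_iff_eq_neg]

theorem IsSplitTriple.ne_zero (hg : 0 < g) (h : IsSplitTriple b g lam t₁ t₂ t₃) : t₁ ≠ 0 :=
  norm_pos_iff.1 (hg.trans_le h.le_norm)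

theorem IsSplitTriple.sub_ne_zero (hb : 0 < b) (hbg : b < g)
    (h : IsSplitTriple b g lam t₁ t₂ t₃) : t₁ - b ≠ 0 := by
  intro h0
  have h1 := h.le_norm
  rw [_root_.sub_eq_zero.1 h0, Complex.norm_real, Real.norm_of_nonneg hb.le] at h1
  linarith

theorem IsRootTriple.eigenvalue_eq (h : IsRootTriple b g lam t₁ t₂ t₃) :
    (t₁ + t₂) * (t₁ + t₃) = t₁ ^ 2 - (g : ℂ) ^ 2 - lam := by
  linear_combination h.sum_mul_eq

theorem IsRootTriple.mul_eigenvalue_eq (h : IsRootTriple b g lam t₁ t₂ t₃) :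
    (t₁ + t₂) * (t₁ + t₃) * (t₁ - b) = b * lam := by
  rw [h.eigenvalue_eq]
  linear_combination h.root

theorem dualVector_eigen (hb : 0 < b) (hbg : b < g) (h : IsSplitTriple b g lam t₁ t₂ t₃)
    (hw : b ^ 2 = w) (hf : g ^ 2 = w - f) (n : ℂ) :
    (-(sysMatrix w f lam)ᴴ) *ᵥ dualVector b t₁ n
      = (-star ((t₁ + t₂) * (t₁ + t₃))) • dualVector b t₁ n := by
  have ht := h.ne_zero (hb.trans hbg)
  have htb := h.sub_ne_zero hb hbg
  have hw' : (b : ℂ) ^ 2 = w := by exact_mod_cast hw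
  have hf' : (g : ℂ) ^ 2 = w - f := by exact_mod_cast hf
  have k1 := h.toIsRootTriple.mul_eigenvalue_eq
  have k2 := h.toIsRootTriple.eigenvalue_eq
  generalize (t₁ + t₂) * (t₁ + t₃) = ν at k1 k2 ⊢
  rw [adjoint_eigen_iff, vecMul_sysMatrix]
  have e : star (dualVector b t₁ n) = ![star n * ((b : ℂ) / t₁), star n, star n * (1 / (t₁ * (t₁ - b)))] := by
    ext i; fin_cases i <;> simp [dualVector]
  rw [e]
  simp only [star_neg, star_star, neg_neg]
  clear e
  generalize star n = m
  ext i
  fin_cases i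
  · simp
    field_simp
    linear_combination -m * lam * hw' - m * b * k1
  · simp
    field_simp
    linear_combination -m * lam * hw' - m * (b + (t₁ - b)) * k1
  · simp
    field_simp
    linear_combination m * (-hw' + hf' - k2)

theorem eq_dualVector (hb : 0 < b) (hbg : b < g) (hlam : 0 ≤ lam.re) (hlam0 : lam ≠ 0)
    (h : IsSplitTriple b g lam t₁ t₂ t₃) (hw : b ^ 2 = w) (hf : g ^ 2 = w - f) {n μ : ℂ}
    (hn : n ≠ 0) {V : Fin 3 → ℂ} (hV : (-(sysMatrix w f lam)ᴴ) *ᵥ V = μ • V) (hμ : μ.re < 0)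
    (hV1 : V 1 = n) : μ = -star ((t₁ + t₂) * (t₁ + t₃)) ∧ V = dualVector b t₁ n := by
  have hg := hb.trans hbg
  have hw0 : (w : ℂ) ≠ 0 := by
    have : w ≠ 0 := by rw [← hw]; positivity
    exact_mod_cast this
  have eqs : ∀ {ν : ℂ} {l : Fin 3 → ℂ}, l ᵥ* sysMatrix w f lam = ν • l →
      lam * w * l 2 = ν * l 0 ∧ (lam + ν) * l 0 = ν * l 1 ∧ l 0 + l 1 + (f - lam) * l 2 = ν * l 2 := by
    intro ν l hl
    rw [vecMul_sysMatrix] at hl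
    have h0 := congrFun hl 0
    have h1 := congrFun hl 1
    have h2 := congrFun hl 2
    simp at h0 h1 h2
    exact ⟨h0, by linear_combination h1 - h0, h2⟩
  have hV' := adjoint_eigen_iff.1 hV
  obtain ⟨q1, q2, q3⟩ := eqs hV'
  set ν := -star μ with hν
  have hνre : 0 < ν.re := by rw [hν]; simpa using hμ
  set m := star n with hm
  have hm0 : m ≠ 0 := by rw [hm]; exact star_ne_zero.2 hn
  have hl1 : star V 1 = m := by rw [Pi.star_apply, hV1]
  rw [hl1] at q2 q3
  have hchar : ν ^ 3 + (lam - f) * ν ^ 2 - 2 * lam * w * ν - lam ^ 2 * w = 0 := by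
    have : (ν ^ 3 + (lam - f) * ν ^ 2 - 2 * lam * w * ν - lam ^ 2 * w) * m = 0 := by
      linear_combination (-(ν - f + lam) * (lam + ν)) * q1 - (ν * (ν - f + lam) - lam * w) * q2 - lam * w * (lam + ν) * q3
    exact (mul_eq_zero.1 this).resolve_right hm0
  obtain ⟨s1, s2, s3⟩ := eigenvalue_symmetric h.toIsRootTriple hw hf
  have hνeq := eq_of_charpoly s1 s2 s3 (h.re_eigenvalue₂ hb hg hlam) (h.re_eigenvalue₃ hb hg hlam)
    hνre hchar
  have hμeq : μ = -star ((t₁ + t₂) * (t₁ + t₃)) := by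
    rw [← hνeq, hν, star_neg, star_star, neg_neg]
  refine ⟨hμeq, ?_⟩
  have hD := adjoint_eigen_iff.1 (dualVector_eigen hb hbg h hw hf n)
  rw [← hμeq, ← hν] at hD
  obtain ⟨p1, p2, -⟩ := eqs hD
  have hd1 : star (dualVector b t₁ n) 1 = m := by simp [dualVector, hm]
  rw [hd1] at p2
  have hsum : lam + ν ≠ 0 := by
    intro h0
    have := congrArg Complex.re h0
    rw [Complex.add_re, Complex.zero_re] at this
    linarith
  have e0 : star V 0 = star (dualVector b t₁ n) 0 :=
    mul_left_cancel₀ hsum (q2.trans p2.symm)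
  have e2 : star V 2 = star (dualVector b t₁ n) 2 := by
    refine mul_left_cancel₀ (mul_ne_zero hlam0 hw0) ?_
    rw [q1, p1, e0]
  refine star_injective (funext fun i => ?_)
  fin_cases i
  · exact e0
  · exact hl1.trans hd1.symm
  · exact e2

theorem continuousOn_split_root (hb : 0 < b) (hbg : b < g) {T₁ T₂ T₃ : ℂ → ℂ}
    (h : ∀ lam ∈ rightHalfPlane, IsSplitTriple b g lam (T₁ lam) (T₂ lam) (T₃ lam)) :
    ContinuousOn T₁ rightHalfPlane := by
  have hg := hb.trans hbg
  have main : ∀ lam ∈ rightHalfPlane, ∃ C : ℝ, ∀ lam' ∈ rightHalfPlane,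
      ‖T₁ lam' - T₁ lam‖ ≤ C * ‖lam' - lam‖ := by
    intro lam hlam
    rcases eq_or_ne lam 0 with rfl | h0
    · have hT0 : T₁ 0 = g := by
        have hr := (h 0 hlam).toIsRootTriple.root
        rw [zero_mul] at hr
        have h1 := (mul_eq_zero.1 hr).resolve_right ((h 0 hlam).sub_ne_zero hb hbg)
        have h2 : (T₁ 0 - g) * (T₁ 0 + g) = 0 := by linear_combination h1
        refine _root_.sub_eq_zero.1 ((mul_eq_zero.1 h2).resolve_right fun h3 => ?_)
        have h4 := congrArg Complex.re h3
        simp at h4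
        linarith [(h 0 hlam).re_pos]
      refine ⟨1 / (g - b), fun lam' hlam' => ?_⟩
      have hs := h lam' hlam'
      set t := T₁ lam' with ht
      have ht0 : 0 < ‖t‖ := hg.trans_le hs.le_norm
      have hr := hs.toIsRootTriple.root
      have e : (t - g) * (t + g) * (t - b) = lam' * t := by rw [← hr]; ring
      have hn := congrArg norm e
      rw [norm_mul, norm_mul, norm_mul] at hn
      have h1 : g ≤ ‖t + g‖ := by
        refine le_trans ?_ (Complex.re_le_norm _)
        simp [hs.re_pos.le]
      have h2 : ‖t‖ - b ≤ ‖t - b‖ := by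
        have := norm_sub_norm_le t (b : ℂ)
        rwa [Complex.norm_real, Real.norm_of_nonneg hb.le] at this
      have h3 : (g - b) * ‖t‖ ≤ g * (‖t‖ - b) := by nlinarith [hs.le_norm]
      have h4 : ‖t - g‖ * ((g - b) * ‖t‖) ≤ ‖lam'‖ * ‖t‖ := by
        rw [← hn, mul_assoc]
        refine mul_le_mul_of_nonneg_left (h3.trans ?_) (norm_nonneg _)
        exact mul_le_mul h1 h2 (by linarith [hs.le_norm]) (norm_nonneg _)
      rw [hT0, sub_zero, one_div, inv_mul_eq_div, le_div_iff₀ (by linarith)]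
      rw [← mul_assoc] at h4
      exact le_of_mul_le_mul_right h4 ht0
    · have hs := h lam hlam
      have hni : T₁ lam ∉ innerRegion g :=
        not_mem_inner_of_outer hb hg hlam h0 hs.toIsRootTriple.root ⟨hs.re_pos.le, hs.le_norm⟩
      obtain ⟨δ, hδ, hball⟩ := Metric.isOpen_iff.1 (isClosed_innerRegion g).isOpen_compl _ hni
      have hfar : ∀ v ∈ innerRegion g, δ ≤ ‖T₁ lam - v‖ := by
        intro v hv
        by_contra! hc
        refine hball (Metric.mem_ball.2 ?_) hv
        rwa [dist_comm, dist_eq_norm]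
      refine ⟨‖T₁ lam‖ / δ ^ 2, fun lam' hlam' => ?_⟩
      have hs' := h lam' hlam'
      have hf := hs'.toIsRootTriple.factor (T₁ lam)
      rw [hs.toIsRootTriple.root, ← sub_mul] at hf
      have hn := congrArg norm hf
      rw [norm_mul, norm_mul, norm_mul] at hn
      rw [div_mul_eq_mul_div, le_div_iff₀ (by positivity), norm_sub_rev (T₁ lam'), norm_sub_rev lam',
        mul_comm ‖T₁ lam‖, hn, pow_two, mul_assoc]
      exact mul_le_mul_of_nonneg_left (mul_le_mul (hfar _ hs'.inner₂) (hfar _ hs'.inner₃) hδ.le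
        (norm_nonneg _)) (norm_nonneg _)
  intro lam hlam
  obtain ⟨C, hC⟩ := main lam hlam
  rw [ContinuousWithinAt, tendsto_iff_norm_sub_tendsto_zero]
  have hlim : Tendsto (fun lam' => C * ‖lam' - lam‖) (𝓝[rightHalfPlane] lam) (𝓝 0) := by
    have : Tendsto (fun lam' : ℂ => lam') (𝓝[rightHalfPlane] lam) (𝓝 lam) := nhdsWithin_le_nhds
    simpa using (tendsto_iff_norm_sub_tendsto_zero.1 this).const_mul C
  exact squeeze_zero' (Eventually.of_forall fun _ => norm_nonneg _)
    (eventually_mem_nhdsWithin.mono fun lam' h' => hC lam' h') hlim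

theorem exists_split_functions (hb : 0 < b) (hg : 0 < g) : ∃ T₁ T₂ T₃ : ℂ → ℂ,
    ∀ lam ∈ rightHalfPlane, IsSplitTriple b g lam (T₁ lam) (T₂ lam) (T₃ lam) ∧
      ‖T₃ lam‖ ≤ ‖T₂ lam‖ := by
  have h : ∀ lam ∈ rightHalfPlane, ∃ t₁ t₂ t₃, IsSplitTriple b g lam t₁ t₂ t₃ ∧ ‖t₃‖ ≤ ‖t₂‖ := by
    intro lam hl
    obtain ⟨t₁, t₂, t₃, h⟩ := exists_split_triple (lam := lam) hb hg hl
    rcases le_total ‖t₃‖ ‖t₂‖ with h' | h'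
    · exact ⟨t₁, t₂, t₃, h, h'⟩
    · exact ⟨t₁, t₃, t₂, h.swap, h'⟩
  choose! T₁ T₂ T₃ hT using h
  exact ⟨T₁, T₂, T₃, hT⟩

theorem continuousOn_dualVector (hb : 0 < b) (hbg : b < g) {T₁ T₂ T₃ n : ℂ → ℂ}
    (h : ∀ lam ∈ rightHalfPlane, IsSplitTriple b g lam (T₁ lam) (T₂ lam) (T₃ lam))
    (hn : ContinuousOn n rightHalfPlane) :
    ContinuousOn (fun lam => dualVector b (T₁ lam) (n lam)) rightHalfPlane := by
  have hT := continuousOn_split_root hb hbg h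
  have h0 : ∀ lam ∈ rightHalfPlane, T₁ lam ≠ 0 := fun lam hl => (h lam hl).ne_zero (hb.trans hbg)
  have h1 : ∀ lam ∈ rightHalfPlane, T₁ lam - b ≠ 0 := fun lam hl => (h lam hl).sub_ne_zero hb hbg
  refine continuousOn_pi.2 fun i => ?_
  fin_cases i
  · exact hn.mul ((continuousOn_const.div hT h0).star)
  · exact hn
  · exact hn.mul ((continuousOn_const.div (hT.mul (hT.sub continuousOn_const))
      fun lam hl => mul_ne_zero (h0 lam hl) (h1 lam hl)).star)

theorem isDualStablePair_dualVector (hb : 0 < b) (hbg : b < g) (hw : b ^ 2 = w)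
    (hf : g ^ 2 = w - f) {T₁ T₂ T₃ n : ℂ → ℂ}
    (h : ∀ lam ∈ rightHalfPlane, IsSplitTriple b g lam (T₁ lam) (T₂ lam) (T₃ lam))
    (hn : ContinuousOn n rightHalfPlane) :
    IsDualStablePair (sysMatrix w f) n (fun lam => -star ((T₁ lam + T₂ lam) * (T₁ lam + T₃ lam)))
      fun lam => dualVector b (T₁ lam) (n lam) where
  continuousOn_eigenvalue := by
    have hT := continuousOn_split_root hb hbg h
    have : ContinuousOn (fun lam => -star (T₁ lam ^ 2 - (g : ℂ) ^ 2 - lam)) rightHalfPlane :=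
      (((hT.pow 2).sub continuousOn_const).sub continuousOn_id).star.neg
    refine this.congr fun lam hl => ?_
    rw [(h lam hl).toIsRootTriple.eigenvalue_eq]
  continuousOn_eigenvector := continuousOn_dualVector hb hbg h hn
  eigen := fun lam hl => dualVector_eigen hb hbg (h lam hl) hw hf _
  re_neg := fun lam hl h0 => by
    have hg := hb.trans hbg
    have := (h lam hl).re_eigenvalue₁_pos hb hg ((h lam hl).lt_norm hg hl h0)
    rw [Complex.neg_re, Complex.star_def, Complex.conj_re]
    linarith
  normalized := fun lam _ => by simp [dualVector]

theorem zero_mem_closure_rightHalfPlane : (0 : ℂ) ∈ closure (rightHalfPlane \ {0}) := by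
  rw [Metric.mem_closure_iff]
  intro ε hε
  refine ⟨((ε / 2 : ℝ) : ℂ), ⟨?_, ?_⟩, ?_⟩
  · show 0 ≤ (((ε / 2 : ℝ) : ℂ)).re
    rw [Complex.ofReal_re]; positivity
  · simpa using hε.ne'
  · rw [dist_eq_norm, zero_sub, norm_neg, Complex.norm_real, Real.norm_of_nonneg (by positivity)]
    linarith

theorem IsDualStablePair.eqOn (hb : 0 < b) (hbg : b < g) (hw : b ^ 2 = w)
    (hf : g ^ 2 = w - f) {T₁ T₂ T₃ n μ : ℂ → ℂ} {V : ℂ → Fin 3 → ℂ}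
    (h : ∀ lam ∈ rightHalfPlane, IsSplitTriple b g lam (T₁ lam) (T₂ lam) (T₃ lam))
    (hn : IsScaling n) (hV : IsDualStablePair (sysMatrix w f) n μ V) {lam : ℂ}
    (hlam : lam ∈ rightHalfPlane) :
    μ lam = -star ((T₁ lam + T₂ lam) * (T₁ lam + T₃ lam)) ∧
      V lam = dualVector b (T₁ lam) (n lam) := by
  have hne : ∀ lam ∈ rightHalfPlane, lam ≠ 0 →
      μ lam = -star ((T₁ lam + T₂ lam) * (T₁ lam + T₃ lam)) ∧
      V lam = dualVector b (T₁ lam) (n lam) := fun lam hl h0 =>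
    eq_dualVector hb hbg hl h0 (h lam hl) hw hf (hn.2 lam hl) (hV.eigen lam hl)
      (hV.re_neg lam hl h0) (hV.normalized lam hl)
  rcases eq_or_ne lam 0 with rfl | h0
  · have hpair := isDualStablePair_dualVector hb hbg hw hf h hn.1
    have : (𝓝[rightHalfPlane \ {0}] (0 : ℂ)).NeBot :=
      mem_closure_iff_nhdsWithin_neBot.1 zero_mem_closure_rightHalfPlane
    have hsub : 𝓝[rightHalfPlane \ {0}] (0 : ℂ) ≤ 𝓝[rightHalfPlane] 0 :=
      nhdsWithin_mono _ sdiff_subset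
    have hmem : ∀ᶠ l in 𝓝[rightHalfPlane \ {0}] (0 : ℂ), l ∈ rightHalfPlane \ {0} :=
      eventually_mem_nhdsWithin
    constructor
    · refine tendsto_nhds_unique ((hV.continuousOn_eigenvalue 0 hlam).mono_left hsub)
        (((hpair.continuousOn_eigenvalue 0 hlam).mono_left hsub).congr' ?_)
      filter_upwards [hmem] with l hl
      exact ((hne l hl.1 hl.2).1).symm
    · refine tendsto_nhds_unique ((hV.continuousOn_eigenvector 0 hlam).mono_left hsub)
        (((hpair.continuousOn_eigenvector 0 hlam).mono_left hsub).congr' ?_)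
      filter_upwards [hmem] with l hl
      exact ((hne l hl.1 hl.2).2).symm
  · exact hne lam hlam h0

end Dual

section Existence

attribute [local instance] Matrix.linftyOpNormedRing Matrix.linftyOpNormedAlgebra

variable {w f : ℝ} {lam μ α β : ℂ}

/-- The eigenvalues `μ, α, β` of `sysMatrix w f lam`, with `μ` unstable and `α, β` not. -/
structure IsUnstableSplit (w f : ℝ) (lam μ α β : ℂ) : Prop where
  sum_eq : μ + α + β = f - lam
  sum_mul_eq : μ * α + μ * β + α * β = -2 * lam * w
  prod_eq : μ * α * β = lam ^ 2 * w
  re_pos : 0 < μ.re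
  re_nonpos₁ : α.re ≤ 0
  re_nonpos₂ : β.re ≤ 0

theorem IsUnstableSplit.ne_zero (h : IsUnstableSplit w f lam μ α β) : μ ≠ 0 := by
  rintro rfl
  simpa using h.re_pos

theorem IsUnstableSplit.root (h : IsUnstableSplit w f lam μ α β) :
    μ ^ 3 + (lam - f) * μ ^ 2 - 2 * lam * w * μ - lam ^ 2 * w = 0 := by
  rw [charpoly_factor h.sum_eq h.sum_mul_eq h.prod_eq]
  ring

theorem IsUnstableSplit.annihilated (h : IsUnstableSplit w f lam μ α β) :
    (-sysMatrix w f lam - (-β) • (1 : Matrix (Fin 3) (Fin 3) ℂ)) *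
      ((-sysMatrix w f lam - (-α) • (1 : Matrix (Fin 3) (Fin 3) ℂ)) *
        (-sysMatrix w f lam - (-μ) • (1 : Matrix (Fin 3) (Fin 3) ℂ))) = 0 :=
  neg_annihilated (sysMatrix_annihilated h.sum_eq h.sum_mul_eq h.prod_eq)

theorem IsUnstableSplit.eq_of_eigenvector (h : IsUnstableSplit w f lam μ α β) {n ν : ℂ}
    {V : Fin 3 → ℂ} (hn0 : n ≠ 0) (hV : sysMatrix w f lam *ᵥ V = ν • V) (hν : 0 < ν.re)
    (hn : V 1 = n) : ν = μ ∧ V = unstableVector lam μ n := by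
  have e := eq_of_charpoly h.sum_eq h.sum_mul_eq h.prod_eq h.re_nonpos₁ h.re_nonpos₂ hν
    (charpoly_eq_zero_of_eigenvector hn0 hV hn)
  subst e
  exact ⟨rfl, eq_unstableVector h.ne_zero hV hn⟩

theorem IsSplitTriple.isUnstableSplit {b g : ℝ} {t₁ t₂ t₃ : ℂ} (hb : 0 < b) (hg : 0 < g)
    (hlam : 0 ≤ lam.re) (h : IsSplitTriple b g lam t₁ t₂ t₃) (hlt : g < ‖t₁‖) (hw : b ^ 2 = w)
    (hf : g ^ 2 = w - f) :
    IsUnstableSplit w f lam ((t₁ + t₂) * (t₁ + t₃)) ((t₁ + t₂) * (t₂ + t₃))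
      ((t₁ + t₃) * (t₂ + t₃)) where
  sum_eq := (eigenvalue_symmetric h.toIsRootTriple hw hf).1
  sum_mul_eq := (eigenvalue_symmetric h.toIsRootTriple hw hf).2.1
  prod_eq := (eigenvalue_symmetric h.toIsRootTriple hw hf).2.2
  re_pos := h.re_eigenvalue₁_pos hb hg hlt
  re_nonpos₁ := h.re_eigenvalue₂ hb hg hlam
  re_nonpos₂ := h.re_eigenvalue₃ hb hg hlam

theorem exists_unstableSplit_one {γ vp : ℝ} (hγ : 1 ≤ γ) (hv : vp ∈ Ioo (0 : ℝ) 1)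
    (hlam : 0 ≤ lam.re) : ∃ μ α β, IsUnstableSplit 1 (fCoeff γ vp 1) lam μ α β := by
  have ha := rhConst_pos hγ hv
  have hga := mul_rhConst_le hγ hv
  have hg : 0 < √(γ * rhConst γ vp) := Real.sqrt_pos.2 (by positivity)
  have hg1 : √(γ * rhConst γ vp) < 1 := by
    rw [Real.sqrt_lt' one_pos]; linarith [hv.2]
  obtain ⟨t₁, t₂, t₃, h⟩ := exists_split_triple (lam := lam) one_pos hg hlam
  refine ⟨_, _, _, h.isUnstableSplit one_pos hg hlam (h.lt_norm_of_lt hg hg1 hlam) (by norm_num) ?_⟩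
  rw [Real.sq_sqrt (by positivity), fCoeff_one]
  ring

theorem exists_unstableSplit_limit (hlam : 0 ≤ lam.re) :
    ∃ μ α β, IsUnstableSplit 1 1 lam μ α β := by
  obtain ⟨s, hs, hs0⟩ : ∃ s : ℂ, s ^ 2 = 1 + 4 * lam ∧ 0 ≤ s.re := by
    obtain ⟨s, hs⟩ := IsAlgClosed.exists_pow_nat_eq (1 + 4 * lam) (n := 2) (by norm_num)
    rcases le_total 0 s.re with h | h
    · exact ⟨s, hs, h⟩
    · exact ⟨-s, by rw [neg_sq, hs], by rw [Complex.neg_re]; linarith⟩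
  have hs1 : 1 ≤ s.re := by
    have h := congrArg Complex.re hs
    simp [pow_two] at h
    nlinarith [sq_nonneg s.im]
  have h2 : ∀ z : ℂ, (z / 2).re = z.re / 2 := fun z => by
    rw [show (2 : ℂ) = ((2 : ℝ) : ℂ) by norm_num, Complex.div_ofReal_re]
  refine ⟨(1 + s) / 2, (1 - s) / 2, -lam, ?_, ?_, ?_, ?_, ?_, ?_⟩
  · push_cast; ring
  · push_cast; linear_combination -hs / 4
  · push_cast; linear_combination lam * hs / 4
  · rw [h2, Complex.add_re, Complex.one_re]; linarith
  · rw [h2, Complex.sub_re, Complex.one_re]; linarith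
  · rw [Complex.neg_re]; linarith

theorem exists_isUnstablePair (hsplit : ∀ lam ∈ rightHalfPlane, ∃ μ α β, IsUnstableSplit w f lam μ α β)
    (n : ℂ → ℂ) : ∃ (μ α β : ℂ → ℂ) (V : ℂ → Fin 3 → ℂ), IsUnstablePair (sysMatrix w f) n μ V ∧
      ∀ lam ∈ rightHalfPlane, IsUnstableSplit w f lam (μ lam) (α lam) (β lam) := by
  choose! μ α β h using hsplit
  refine ⟨μ, α, β, fun lam => unstableVector lam (μ lam) (n lam),
    fun lam hl => ⟨?_, (h lam hl).re_pos, ?_⟩, h⟩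
  · exact sysMatrix_mulVec_unstableVector (h lam hl).ne_zero (h lam hl).root
  · simp [unstableVector]

theorem norm_sysMatrix_sub_le_of_abs (w' f' : ℝ) {L E : ℝ} (hf : |f - f'| ≤ L * E) (hw : |w - w'| ≤ E) :
    ‖sysMatrix w f lam - sysMatrix w' f' lam‖ ≤ (2 * ‖lam‖ + L) * E ∧
    ‖-(sysMatrix w f lam)ᴴ - -(sysMatrix w' f' lam)ᴴ‖ ≤ (2 * ‖lam‖ + L) * E := by
  have e : ‖lam * (w : ℂ) - lam * (w' : ℂ)‖ ≤ ‖lam‖ * E := by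
    rw [← mul_sub, norm_mul, ← Complex.ofReal_sub, Complex.norm_real, Real.norm_eq_abs]
    exact mul_le_mul_of_nonneg_left hw (norm_nonneg _)
  have h1 := norm_sysMatrix_sub_le w f w' f' lam lam
  have h2 := norm_sysMatrix_conjTranspose_sub_le w f w' f' lam lam
  rw [sub_self, norm_zero] at h1 h2
  constructor <;> linarith

theorem exists_modeAtBot {u φ : ℝ → ℝ} (hu : Continuous u) (hφ : Continuous φ) {L η : ℝ}
    (hη : 0 < η) (hL : 0 ≤ L) (hw : ∀ x, 0 ≤ x → |u (-x) - w| ≤ Real.exp (-η * x))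
    (hf : ∀ x, 0 ≤ x → |φ (-x) - f| ≤ L * Real.exp (-η * x))
    (h : IsUnstableSplit w f lam μ α β) {V : Fin 3 → ℂ} (hV : sysMatrix w f lam *ᵥ V = μ • V) :
    ∃ W, IsModeAtBot (fun x => sysMatrix (u x) (φ x) lam) μ V W := by
  obtain ⟨W, hW⟩ := exists_modeAtTop (N := fun x => -sysMatrix (u (-x)) (φ (-x)) lam)
    (A := -sysMatrix w f lam) (V := V) (C := 2 * ‖lam‖ + L)
    (continuous_sysMatrix (hu.comp continuous_neg) (hφ.comp continuous_neg) lam).neg hη (by positivity)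
    (fun x hx => by
      rw [neg_sub_neg, norm_sub_rev]
      exact (norm_sysMatrix_sub_le_of_abs w f (hf x hx) (hw x hx)).1)
    h.annihilated (by simpa using h.re_nonpos₁.trans h.re_pos.le)
    (by simpa using h.re_nonpos₂.trans h.re_pos.le) (by rw [Matrix.neg_mulVec, hV, neg_smul])
  exact ⟨fun x => W (-x), isModeAtBot_iff.2 (by simpa using hW)⟩

theorem exists_dualModeAtTop {u φ : ℝ → ℝ} (hu : Continuous u) (hφ : Continuous φ) {L η : ℝ}
    (hη : 0 < η) (hL : 0 ≤ L) (hw : ∀ x, 0 ≤ x → |u x - w| ≤ Real.exp (-η * x))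
    (hf : ∀ x, 0 ≤ x → |φ x - f| ≤ L * Real.exp (-η * x)) (h1 : μ + α + β = f - lam)
    (h2 : μ * α + μ * β + α * β = -2 * lam * w) (h3 : μ * α * β = lam ^ 2 * w)
    (hα : α.re ≤ μ.re) (hβ : β.re ≤ μ.re) {V : Fin 3 → ℂ}
    (hV : (-(sysMatrix w f lam)ᴴ) *ᵥ V = (-star μ) • V) :
    ∃ W, IsDualModeAtTop (fun x => sysMatrix (u x) (φ x) lam) (-star μ) V W := by
  have hre : ∀ z : ℂ, (-star z).re = -z.re := fun z => by
    rw [Complex.neg_re, Complex.star_def, Complex.conj_re]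
  exact exists_modeAtTop (N := fun x => -(sysMatrix (u x) (φ x) lam)ᴴ)
    (A := -(sysMatrix w f lam)ᴴ) (V := V) (C := 2 * ‖lam‖ + L) (α := -star α) (β := -star β)
    (continuous_sysMatrix hu hφ lam).matrix_conjTranspose.neg hη (by positivity)
    (fun x hx => (norm_sysMatrix_sub_le_of_abs w f (hf x hx) (hw x hx)).2)
    (neg_conjTranspose_annihilated (sysMatrix_annihilated (μ := β) (α := α) (β := μ)
      (by linear_combination h1) (by linear_combination h2) (by linear_combination h3)))
    (by rw [hre, hre]; linarith) (by rw [hre, hre]; linarith) hV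

end Existence

section Profiles

variable {γ vp : ℝ} {v : ℝ → ℝ}

theorem IsShockProfile.abs_sub_le_top (hγ : 1 ≤ γ) (hv : vp ∈ Ioo (0 : ℝ) 1)
    (h : IsShockProfile γ vp v) {x : ℝ} (hx : 0 ≤ x) :
    |v x - vp| ≤ Real.exp (-(1 - v 0) * x) ∧
    |fCoeff γ vp (v x) - fCoeff γ vp vp| ≤ (2 + (γ - 1) * γ / vp) * Real.exp (-(1 - v 0) * x) := by
  have h1 := sub_le_exp_of_deriv_le h.deriv_eq h.mem_Ioo (h.deriv_le hγ hv) hx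
  have h0 := h.mem_Ioo 0
  have h2 : v x - vp ≤ Real.exp (-(1 - v 0) * x) := by
    have := mul_le_mul_of_nonneg_right (by linarith [h0.2, hv.1] : v 0 - vp ≤ 1)
      (Real.exp_pos (-(1 - v 0) * x)).le
    linarith
  have h3 := (h.mem_Ioo x).1.le
  have hL : 0 ≤ 2 + (γ - 1) * γ / vp :=
    add_nonneg zero_le_two (div_nonneg (mul_nonneg (by linarith) (by linarith)) hv.1.le)
  exact ⟨by rwa [abs_of_nonneg (sub_nonneg.2 h3)], (abs_fCoeff_sub_le hγ hv le_rfl h3).trans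
    (mul_le_mul_of_nonneg_left h2 hL)⟩

theorem IsShockProfile.abs_sub_le_bot (hγ : 1 ≤ γ) (hv : vp ∈ Ioo (0 : ℝ) 1)
    (h : IsShockProfile γ vp v) {x : ℝ} (hx : 0 ≤ x) :
    |v (-x) - 1| ≤ Real.exp (-(v 0 - vp) * x) ∧
    |fCoeff γ vp (v (-x)) - fCoeff γ vp 1|
      ≤ (2 + (γ - 1) * γ / v 0) * Real.exp (-(v 0 - vp) * x) := by
  have h1 := one_sub_le_exp_of_deriv_le h.deriv_eq h.mem_Ioo (h.deriv_le hγ hv) hx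
  have h0 := h.mem_Ioo 0
  have hv0 : 0 < v 0 := hv.1.trans h0.1
  have h2 : 1 - v (-x) ≤ Real.exp (-(v 0 - vp) * x) := by
    have := mul_le_mul_of_nonneg_right (by linarith [h0.2, hv.1] : 1 - v 0 ≤ 1)
      (Real.exp_pos (-(v 0 - vp) * x)).le
    linarith
  have h3 := (h.mem_Ioo (-x)).2.le
  have hg : 0 ≤ (γ - 1) * γ := mul_nonneg (by linarith) (by linarith)
  have h4 : v 0 ≤ v (-x) := h.strictAnti.antitone (by linarith)
  rw [abs_sub_comm, abs_sub_comm (fCoeff γ vp (v (-x)))]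
  refine ⟨by rwa [abs_of_nonneg (sub_nonneg.2 h3)],
    (abs_fCoeff_sub_le hγ hv (h.mem_Ioo (-x)).1.le h3).trans ?_⟩
  refine mul_le_mul (add_le_add le_rfl (div_le_div_of_nonneg_left hg hv0 h4)) h2
    (sub_nonneg.2 h3) (add_nonneg zero_le_two (div_nonneg hg hv0.le))

theorem abs_limitProfile_le_top (x₀ : ℝ) {x : ℝ} (hx : 0 ≤ x) :
    |limitProfile x₀ x| ≤ Real.exp (-(1 - limitProfile x₀ 0) * x) := by
  have h1 := sub_le_exp_of_deriv_le (hasDerivAt_limitProfile x₀) (limitProfile_mem_Ioo x₀)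
    (limitProfile_deriv_le x₀) hx
  have h2 := mul_le_mul_of_nonneg_right (by linarith [(limitProfile_mem_Ioo x₀ 0).2] :
    limitProfile x₀ 0 - 0 ≤ 1) (Real.exp_pos (-(1 - limitProfile x₀ 0) * x)).le
  rw [abs_of_pos (limitProfile_mem_Ioo x₀ x).1]
  linarith

theorem abs_limitProfile_sub_one_le_bot (x₀ : ℝ) {x : ℝ} (hx : 0 ≤ x) :
    |limitProfile x₀ (-x) - 1| ≤ Real.exp (-(limitProfile x₀ 0) * x) := by
  have h1 := one_sub_le_exp_of_deriv_le (hasDerivAt_limitProfile x₀) (limitProfile_mem_Ioo x₀)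
    (limitProfile_deriv_le x₀) hx
  have h2 := mul_le_mul_of_nonneg_right (by linarith [(limitProfile_mem_Ioo x₀ 0).1] :
    1 - limitProfile x₀ 0 ≤ 1) (Real.exp_pos (-(limitProfile x₀ 0 - 0) * x)).le
  rw [sub_zero] at h1 h2
  rw [abs_sub_comm, abs_of_pos (sub_pos.2 (limitProfile_mem_Ioo x₀ (-x)).2)]
  linarith

theorem abs_two_mul_sub_le {u w E : ℝ} (h : |u - w| ≤ E) :
    |2 * u - 1 - (2 * w - 1)| ≤ 2 * E := by
  rw [show 2 * u - 1 - (2 * w - 1) = 2 * (u - w) by ring, abs_mul, abs_two]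
  linarith

/-- The moduli parametrising the end state at `+∞`: `b² = v₊` and `g² = v₊ - f(v₊)`. -/
theorem endpoint_moduli (hγ : 1 ≤ γ) (hv : vp ∈ Ioo (0 : ℝ) (1 / 2)) :
    0 < √vp ∧ √vp < √(vp - fCoeff γ vp vp) ∧ √vp ^ 2 = vp ∧
      √(vp - fCoeff γ vp vp) ^ 2 = vp - fCoeff γ vp vp := by
  have hv' : vp ∈ Ioo (0 : ℝ) 1 := ⟨hv.1, hv.2.trans (by norm_num)⟩
  have ha := rhConst_pos hγ hv'
  have h1 : vp < vp - fCoeff γ vp vp := by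
    rw [fCoeff_endpoint hγ hv']
    nlinarith [hv.2, hv.1]
  exact ⟨Real.sqrt_pos.2 hv.1, Real.sqrt_lt_sqrt hv.1.le h1, Real.sq_sqrt hv.1.le,
    Real.sq_sqrt (hv.1.trans h1).le⟩

theorem exists_isEvansFunction (hγ : 1 ≤ γ) (hv : vp ∈ Ioo (0 : ℝ) (1 / 2))
    (h : IsShockProfile γ vp v) (nm : ℂ → ℂ) {np : ℂ → ℂ} (hnp : IsScaling np) :
    ∃ D, IsEvansFunction γ vp v nm np D := by
  have hv' : vp ∈ Ioo (0 : ℝ) 1 := ⟨hv.1, hv.2.trans (by norm_num)⟩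
  have h0 := h.mem_Ioo 0
  have hg : 0 ≤ (γ - 1) * γ := mul_nonneg (by linarith) (by linarith)
  have hcont := continuous_fCoeff_comp (γ := γ) (vp := vp) h.continuous
    fun x => hv.1.trans (h.mem_Ioo x).1
  obtain ⟨hb, hbg, hbw, hgf⟩ := endpoint_moduli hγ hv
  obtain ⟨T₁, T₂, T₃, hT'⟩ := exists_split_functions hb (hb.trans hbg)
  have hT := fun lam hl => (hT' lam hl).1
  obtain ⟨μ, α, β, V, hμV, hsp⟩ := exists_isUnstablePair (fun lam hl => exists_unstableSplit_one hγ hv' hl) nm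
  have hdual := isDualStablePair_dualVector hb hbg hbw hgf hT hnp.1
  have hW : ∀ lam ∈ rightHalfPlane, ∃ W,
      IsModeAtBot (fun x => evansMatrix γ vp (v x) lam) (μ lam) (V lam) W := by
    intro lam hl
    refine exists_modeAtBot h.continuous hcont (L := 2 + (γ - 1) * γ / v 0) (η := v 0 - vp)
      (sub_pos.2 h0.1) (add_nonneg zero_le_two (div_nonneg hg (hv.1.trans h0.1).le))
      (fun x hx => (h.abs_sub_le_bot hγ hv' hx).1) (fun x hx => (h.abs_sub_le_bot hγ hv' hx).2)
      (hsp lam hl) (hμV lam hl).1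
  have hWt : ∀ lam ∈ rightHalfPlane, ∃ Wt,
      IsDualModeAtTop (fun x => evansMatrix γ vp (v x) lam)
        (-star ((T₁ lam + T₂ lam) * (T₁ lam + T₃ lam))) (dualVector √vp (T₁ lam) (np lam)) Wt := by
    intro lam hl
    have hs := hT lam hl
    obtain ⟨s1, s2, s3⟩ := eigenvalue_symmetric hs.toIsRootTriple hbw hgf
    have hpos := hs.re_eigenvalue₁_nonneg hb (hb.trans hbg)
    exact exists_dualModeAtTop h.continuous hcont (L := 2 + (γ - 1) * γ / vp) (η := 1 - v 0)
      (sub_pos.2 h0.2) (add_nonneg zero_le_two (div_nonneg hg hv.1.le))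
      (fun x hx => (h.abs_sub_le_top hγ hv' hx).1) (fun x hx => (h.abs_sub_le_top hγ hv' hx).2)
      s1 s2 s3 ((hs.re_eigenvalue₂ hb (hb.trans hbg) hl).trans hpos)
      ((hs.re_eigenvalue₃ hb (hb.trans hbg) hl).trans hpos) (hdual.eigen lam hl)
  choose! W hW using hW
  choose! Wt hWt using hWt
  exact ⟨fun lam => star (Wt lam 0) ⬝ᵥ W lam 0, μ, _, V, _, hμV, hdual,
    fun lam hl => ⟨W lam, Wt lam, hW lam hl, hWt lam hl, rfl⟩⟩

theorem limitDualVector_eigen {lam : ℂ} (hlam : 0 ≤ lam.re) :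
    (-(sysMatrix 0 (-1) lam)ᴴ) *ᵥ limitDualVector lam = (0 : ℂ) • limitDualVector lam := by
  have h0 : 1 + lam ≠ 0 := by
    intro h
    have := congrArg Complex.re h
    simp at this
    linarith
  rw [adjoint_eigen_iff, vecMul_sysMatrix]
  ext i
  fin_cases i
  · simp
  · simp [limitDualVector]
  · simp [limitDualVector]
    field_simp
    ring

theorem exists_isLimitEvansFunction (x₀ : ℝ) (nm : ℂ → ℂ) :
    ∃ D, IsLimitEvansFunction x₀ nm D := by
  have h0 := limitProfile_mem_Ioo x₀ 0
  have hc := continuous_limitProfile x₀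
  have hc' : Continuous fun x => 2 * limitProfile x₀ x - 1 := by fun_prop
  obtain ⟨μ, α, β, V, hμV, hsp⟩ := exists_isUnstablePair (w := 1) (f := 1)
    (fun lam hl => exists_unstableSplit_limit hl) nm
  have hlim : (fun lam => sysMatrix 1 1 lam) = limitMatrix 1 := by
    funext lam; rw [limitMatrix_eq]; norm_num
  have hW : ∀ lam ∈ rightHalfPlane, ∃ W,
      IsModeAtBot (fun x => limitMatrix (limitProfile x₀ x) lam) (μ lam) (V lam) W := by
    intro lam hl
    refine exists_modeAtBot hc hc' (w := 1) (f := 1) (L := 2) h0.1 zero_le_two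
      (fun x hx => abs_limitProfile_sub_one_le_bot x₀ hx) (fun x hx => ?_) (hsp lam hl) (hμV lam hl).1
    have := abs_two_mul_sub_le (abs_limitProfile_sub_one_le_bot x₀ hx)
    norm_num at this ⊢
    exact this
  have hWt : ∀ lam ∈ rightHalfPlane, ∃ Wt,
      IsDualModeAtTop (fun x => limitMatrix (limitProfile x₀ x) lam) 0 (limitDualVector lam) Wt := by
    intro lam hl
    have hl' : 0 ≤ lam.re := hl
    have := exists_dualModeAtTop (w := 0) (f := -1) (μ := 0) (α := 0) (β := -1 - lam) hc hc'
      (L := 2) (η := 1 - limitProfile x₀ 0)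
      (sub_pos.2 h0.2) zero_le_two (fun x hx => by simpa using abs_limitProfile_le_top x₀ hx)
      (fun x hx => by
        have := abs_two_mul_sub_le (u := limitProfile x₀ x) (w := 0)
          (by simpa using abs_limitProfile_le_top x₀ hx)
        simpa using this) (by push_cast; ring) (by simp) (by simp) le_rfl
      (by simp; linarith) (V := limitDualVector lam) (by simpa using limitDualVector_eigen hl)
    simpa [limitMatrix_eq] using this
  choose! W hW using hW
  choose! Wt hWt using hWt
  exact ⟨fun lam => star (Wt lam 0) ⬝ᵥ W lam 0, μ, V, hlim ▸ hμV,
    fun lam hl => ⟨W lam, Wt lam, hW lam hl, hWt lam hl, rfl⟩⟩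

end Profiles

section Convergence

attribute [local instance] Matrix.linftyOpNormedRing Matrix.linftyOpNormedAlgebra

variable {ι : Type*} {l : Filter ι}

theorem eventually_norm_sysMatrix_sub_le {u φ : ι → ℝ → ℝ} {u₀ φ₀ : ℝ → ℝ} {lam : ι → ℂ} {lam₀ : ℂ}
    (hlam : Tendsto lam l (𝓝 lam₀)) {S : Set ℝ} {B : ℝ} (hB : ∀ x ∈ S, |u₀ x| ≤ B)
    (hu : ∀ ε > 0, ∀ᶠ i in l, ∀ x ∈ S, |u i x - u₀ x| ≤ ε)
    (hφ : ∀ ε > 0, ∀ᶠ i in l, ∀ x ∈ S, |φ i x - φ₀ x| ≤ ε) {ε : ℝ} (hε : 0 < ε) :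
    ∀ᶠ i in l, ∀ x ∈ S,
      ‖sysMatrix (u i x) (φ i x) (lam i) - sysMatrix (u₀ x) (φ₀ x) lam₀‖ ≤ ε ∧
      ‖-(sysMatrix (u i x) (φ i x) (lam i))ᴴ - -(sysMatrix (u₀ x) (φ₀ x) lam₀)ᴴ‖ ≤ ε := by
  set δ := ε / (2 * (‖lam₀‖ + 1 + |B|) + 3) with hδ
  have hδ0 : 0 < δ := by positivity
  filter_upwards [hu δ hδ0, hφ δ hδ0, hlam.norm.eventually (gt_mem_nhds (lt_add_one ‖lam₀‖)),
    (tendsto_iff_norm_sub_tendsto_zero.1 hlam).eventually (gt_mem_nhds hδ0)] with i h1 h2 h3 h4 x hx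
  have e : ‖lam i * (u i x : ℂ) - lam₀ * (u₀ x : ℂ)‖ ≤ (‖lam₀‖ + 1) * δ + δ * |B| := by
    have e1 : lam i * (u i x : ℂ) - lam₀ * (u₀ x : ℂ)
        = lam i * ((u i x - u₀ x : ℝ) : ℂ) + (lam i - lam₀) * (u₀ x : ℝ) := by push_cast; ring
    rw [e1]
    refine (norm_add_le _ _).trans (add_le_add ?_ ?_)
    · rw [norm_mul, Complex.norm_real, Real.norm_eq_abs]
      exact mul_le_mul h3.le (h1 x hx) (abs_nonneg _) (by positivity)
    · rw [norm_mul, Complex.norm_real, Real.norm_eq_abs]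
      exact mul_le_mul h4.le ((hB x hx).trans (le_abs_self B)) (abs_nonneg _) hδ0.le
  have total : 2 * ‖lam i * (u i x : ℂ) - lam₀ * (u₀ x : ℂ)‖ + |φ i x - φ₀ x| + 2 * ‖lam i - lam₀‖ ≤ ε := by
    have : δ * (2 * (‖lam₀‖ + 1 + |B|) + 3) = ε := by rw [hδ]; field_simp
    linarith [h2 x hx]
  exact ⟨(norm_sysMatrix_sub_le _ _ _ _ _ _).trans total,
    (norm_sysMatrix_conjTranspose_sub_le _ _ _ _ _ _).trans total⟩

variable {w f : ι → ℝ} {w₀ f₀ : ℝ} {lam μ α β : ι → ℂ} {lam₀ μ₀ α₀ β₀ : ℂ}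

theorem tendsto_unstable_eigenvalue (hw : Tendsto w l (𝓝 w₀)) (hf : Tendsto f l (𝓝 f₀))
    (hlam : Tendsto lam l (𝓝 lam₀))
    (hs : ∀ᶠ i in l, IsUnstableSplit (w i) (f i) (lam i) (μ i) (α i) (β i))
    (hs₀ : IsUnstableSplit w₀ f₀ lam₀ μ₀ α₀ β₀) : Tendsto μ l (𝓝 μ₀) := by
  have hw' : Tendsto (fun i => (w i : ℂ)) l (𝓝 (w₀ : ℂ)) :=
    (Complex.continuous_ofReal.tendsto _).comp hw
  have hf' : Tendsto (fun i => (f i : ℂ)) l (𝓝 (f₀ : ℂ)) :=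
    (Complex.continuous_ofReal.tendsto _).comp hf
  have hp : Tendsto (fun i => μ₀ ^ 3 + (lam i - f i) * μ₀ ^ 2 - 2 * lam i * w i * μ₀ - lam i ^ 2 * w i)
      l (𝓝 (μ₀ ^ 3 + (lam₀ - f₀) * μ₀ ^ 2 - 2 * lam₀ * w₀ * μ₀ - lam₀ ^ 2 * w₀)) :=
    (((hlam.sub hf').mul_const _).const_add _ |>.sub (((hlam.const_mul 2).mul hw').mul_const _)).sub
      ((hlam.pow 2).mul hw')
  rw [hs₀.root] at hp
  have hr := hs₀.re_pos
  have hp' := hp.norm.div_const (μ₀.re ^ 2)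
  rw [norm_zero, zero_div] at hp'
  rw [tendsto_iff_norm_sub_tendsto_zero]
  refine squeeze_zero' (Eventually.of_forall fun _ => norm_nonneg _) ?_ hp'
  filter_upwards [hs] with i hi
  have far : ∀ z : ℂ, z.re ≤ 0 → μ₀.re ≤ ‖μ₀ - z‖ := fun z hz => by
    have := Complex.re_le_norm (μ₀ - z)
    rw [Complex.sub_re] at this
    linarith
  rw [le_div_iff₀ (by positivity), charpoly_factor hi.sum_eq hi.sum_mul_eq hi.prod_eq, norm_mul,
    norm_mul, norm_sub_rev, mul_assoc, pow_two]
  exact mul_le_mul_of_nonneg_left (mul_le_mul (far _ hi.re_nonpos₁) (far _ hi.re_nonpos₂) hr.le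
    (norm_nonneg _)) (norm_nonneg _)

theorem eventually_norm_le_of_split (hw : Tendsto w l (𝓝 w₀)) (hf : Tendsto f l (𝓝 f₀))
    (hlam : Tendsto lam l (𝓝 lam₀))
    (hs : ∀ᶠ i in l, IsUnstableSplit (w i) (f i) (lam i) (μ i) (α i) (β i)) :
    ∃ a, ∀ᶠ i in l, ‖α i‖ ≤ a := by
  have hw' : Tendsto (fun i => (w i : ℂ)) l (𝓝 (w₀ : ℂ)) :=
    (Complex.continuous_ofReal.tendsto _).comp hw
  have hf' : Tendsto (fun i => (f i : ℂ)) l (𝓝 (f₀ : ℂ)) :=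
    (Complex.continuous_ofReal.tendsto _).comp hf
  have h1 := (hf'.sub hlam).norm
  have h2 := ((hlam.const_mul (-2)).mul hw').norm
  have h3 := ((hlam.pow 2).mul hw').norm
  set M := ‖(f₀ : ℂ) - lam₀‖ + ‖-2 * lam₀ * (w₀ : ℂ)‖ + ‖lam₀ ^ 2 * (w₀ : ℂ)‖ + 1 with hM
  have n1 := norm_nonneg ((f₀ : ℂ) - lam₀)
  have n2 := norm_nonneg (-2 * lam₀ * (w₀ : ℂ))
  have n3 := norm_nonneg (lam₀ ^ 2 * (w₀ : ℂ))
  refine ⟨3 * M, ?_⟩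
  filter_upwards [hs, h1.eventually_lt_const (show ‖(f₀ : ℂ) - lam₀‖ < M by linarith),
    h2.eventually_lt_const (show ‖-2 * lam₀ * (w₀ : ℂ)‖ < M by linarith),
    h3.eventually_lt_const (show ‖lam₀ ^ 2 * (w₀ : ℂ)‖ < M by linarith)] with i hi g1 g2 g3
  refine norm_root_le (M := M) (by linarith) ?_ ?_ ?_ (μ := μ i) (β := β i)
  · rw [hi.sum_eq]; exact g1.le
  · rw [hi.sum_mul_eq]; exact g2.le
  · rw [hi.prod_eq]; exact g3.le

theorem tendsto_sysMatrix (hw : Tendsto w l (𝓝 w₀)) (hf : Tendsto f l (𝓝 f₀))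
    (hlam : Tendsto lam l (𝓝 lam₀)) :
    Tendsto (fun i => sysMatrix (w i) (f i) (lam i)) l (𝓝 (sysMatrix w₀ f₀ lam₀)) := by
  have hw' : Tendsto (fun i => (w i : ℂ)) l (𝓝 (w₀ : ℂ)) :=
    (Complex.continuous_ofReal.tendsto _).comp hw
  have h1 := tendsto_iff_norm_sub_tendsto_zero.1 (hlam.mul hw')
  have h2 := tendsto_iff_norm_sub_tendsto_zero.1 hf
  have h3 := tendsto_iff_norm_sub_tendsto_zero.1 hlam
  have h4 := ((h1.const_mul 2).add h2).add (h3.const_mul 2)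
  simp only [mul_zero, add_zero] at h4
  exact tendsto_iff_norm_sub_tendsto_zero.2 (squeeze_zero (fun _ => norm_nonneg _)
    (fun i => norm_sysMatrix_sub_le _ _ _ _ _ _) h4)

theorem tendsto_unstableVector {n : ι → ℂ} {n₀ : ℂ} (hlam : Tendsto lam l (𝓝 lam₀))
    (hμ : Tendsto μ l (𝓝 μ₀)) (hn : Tendsto n l (𝓝 n₀)) (h0 : μ₀ ≠ 0) :
    Tendsto (fun i => unstableVector (lam i) (μ i) (n i)) l (𝓝 (unstableVector lam₀ μ₀ n₀)) := by
  refine tendsto_pi_nhds.2 fun j => ?_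
  fin_cases j
  · exact ((hlam.add hμ).div hμ h0).mul hn
  · exact hn
  · exact hμ.mul hn

/-- The modes decaying at `-∞` depend continuously on the coefficients. -/
theorem tendsto_modeAtBot {u φ : ι → ℝ → ℝ} {u₀ φ₀ : ℝ → ℝ} (hu₀ : Continuous u₀)
    (hφ₀ : Continuous φ₀) {L η : ℝ} (hη : 0 < η) (hL : 0 ≤ L)
    (hw : ∀ᶠ i in l, ∀ x, 0 ≤ x → |u i (-x) - w i| ≤ Real.exp (-η * x))
    (hf : ∀ᶠ i in l, ∀ x, 0 ≤ x → |φ i (-x) - f i| ≤ L * Real.exp (-η * x))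
    (hw₀ : ∀ x, 0 ≤ x → |u₀ (-x) - w₀| ≤ Real.exp (-η * x))
    (hf₀ : ∀ x, 0 ≤ x → |φ₀ (-x) - f₀| ≤ L * Real.exp (-η * x))
    (hwlim : Tendsto w l (𝓝 w₀)) (hflim : Tendsto f l (𝓝 f₀)) (hlam : Tendsto lam l (𝓝 lam₀))
    (hs : ∀ᶠ i in l, IsUnstableSplit (w i) (f i) (lam i) (μ i) (α i) (β i))
    (hs₀ : IsUnstableSplit w₀ f₀ lam₀ μ₀ α₀ β₀) {n : ι → ℂ} {n₀ : ℂ} (hn : Tendsto n l (𝓝 n₀))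
    (hu : ∀ T, ∀ ε > 0, ∀ᶠ i in l, ∀ x ∈ Icc 0 T, |u i (-x) - u₀ (-x)| ≤ ε)
    (hφ : ∀ T, ∀ ε > 0, ∀ᶠ i in l, ∀ x ∈ Icc 0 T, |φ i (-x) - φ₀ (-x)| ≤ ε)
    {W : ι → ℝ → Fin 3 → ℂ} {W₀ : ℝ → Fin 3 → ℂ}
    (hW : ∀ᶠ i in l, IsModeAtBot (fun x => sysMatrix (u i x) (φ i x) (lam i)) (μ i)
      (unstableVector (lam i) (μ i) (n i)) (W i))
    (hW₀ : IsModeAtBot (fun x => sysMatrix (u₀ x) (φ₀ x) lam₀) μ₀ (unstableVector lam₀ μ₀ n₀) W₀) :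
    Tendsto (fun i => W i 0) l (𝓝 (W₀ 0)) := by
  have hμ := tendsto_unstable_eigenvalue hwlim hflim hlam hs hs₀
  obtain ⟨a, ha⟩ := eventually_norm_le_of_split hwlim hflim hlam hs
  have hΘ : ∀ᶠ i in l, ∀ x, 0 ≤ x → ‖-sysMatrix (u i (-x)) (φ i (-x)) (lam i)
      - -sysMatrix (w i) (f i) (lam i)‖ ≤ (2 * (‖lam₀‖ + 1) + L) * Real.exp (-η * x) := by
    filter_upwards [hw, hf, hlam.norm.eventually_lt_const (lt_add_one ‖lam₀‖)] with i h1 h2 h3 x hx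
    rw [neg_sub_neg, norm_sub_rev]
    refine (norm_sysMatrix_sub_le_of_abs _ _ (h2 x hx) (h1 x hx)).1.trans ?_
    exact mul_le_mul_of_nonneg_right (by linarith) (Real.exp_pos _).le
  have hΘ₀ : ∀ x, 0 ≤ x → ‖-sysMatrix (u₀ (-x)) (φ₀ (-x)) lam₀ - -sysMatrix w₀ f₀ lam₀‖
      ≤ (2 * (‖lam₀‖ + 1) + L) * Real.exp (-η * x) := by
    intro x hx
    rw [neg_sub_neg, norm_sub_rev]
    refine (norm_sysMatrix_sub_le_of_abs _ _ (hf₀ x hx) (hw₀ x hx)).1.trans ?_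
    exact mul_le_mul_of_nonneg_right (by linarith) (Real.exp_pos _).le
  have hloc : ∀ T, ∀ ε > 0, ∀ᶠ i in l, ∀ x ∈ Icc 0 T, ‖-sysMatrix (u i (-x)) (φ i (-x)) (lam i)
      - -sysMatrix (u₀ (-x)) (φ₀ (-x)) lam₀‖ ≤ ε := by
    intro T ε hε
    have hB : ∀ x ∈ Icc 0 T, |u₀ (-x)| ≤ |w₀| + 1 := fun x hx => by
      have h1 := hw₀ x hx.1
      have h2 : Real.exp (-η * x) ≤ 1 := Real.exp_le_one_iff.2 (by nlinarith [hx.1])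
      have h3 := abs_sub_abs_le_abs_sub (u₀ (-x)) w₀
      linarith
    have := eventually_norm_sysMatrix_sub_le (u := fun i x => u i (-x))
      (φ := fun i x => φ i (-x)) (u₀ := fun x => u₀ (-x)) (φ₀ := fun x => φ₀ (-x)) (S := Icc 0 T)
      hlam hB (hu T) (hφ T) hε
    filter_upwards [this] with i hi x hx
    rw [neg_sub_neg, norm_sub_rev]
    exact (hi x hx).1
  have hV : ∀ᶠ i in l, -sysMatrix (w i) (f i) (lam i) *ᵥ unstableVector (lam i) (μ i) (n i)
      = -μ i • unstableVector (lam i) (μ i) (n i) := hs.mono fun i hi => by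
    rw [Matrix.neg_mulVec, sysMatrix_mulVec_unstableVector hi.ne_zero hi.root, neg_smul]
  have hV₀ : -sysMatrix w₀ f₀ lam₀ *ᵥ unstableVector lam₀ μ₀ n₀
      = -μ₀ • unstableVector lam₀ μ₀ n₀ := by
    rw [Matrix.neg_mulVec, sysMatrix_mulVec_unstableVector hs₀.ne_zero hs₀.root, neg_smul]
  have hα : ∀ᶠ i in l, (-μ i).re ≤ (-α i).re := hs.mono fun i hi => by
    simpa using hi.re_nonpos₁.trans hi.re_pos.le
  have hβ : ∀ᶠ i in l, (-μ i).re ≤ (-β i).re := hs.mono fun i hi => by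
    simpa using hi.re_nonpos₂.trans hi.re_pos.le
  have hα₀ : (-μ₀).re ≤ (-α₀).re := by simpa using hs₀.re_nonpos₁.trans hs₀.re_pos.le
  have hβ₀ : (-μ₀).re ≤ (-β₀).re := by simpa using hs₀.re_nonpos₂.trans hs₀.re_pos.le
  have hN₀ : Continuous fun x => -sysMatrix (u₀ (-x)) (φ₀ (-x)) lam₀ :=
    (continuous_sysMatrix (hu₀.comp continuous_neg) (hφ₀.comp continuous_neg) lam₀).neg
  have ha' : ∀ᶠ i in l, ‖-α i‖ ≤ a := ha.mono fun i hi => by rwa [norm_neg]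
  have hW' := hW.mono fun i hi => isModeAtBot_iff.1 hi
  have hC : 0 ≤ 2 * (‖lam₀‖ + 1) + L := by positivity
  have hann := hs.mono fun i hi => hi.annihilated
  have hA := (tendsto_sysMatrix hwlim hflim hlam).neg
  have hVlim := tendsto_unstableVector hlam hμ hn hs₀.ne_zero
  have hW₀' := isModeAtBot_iff.1 hW₀
  have hannt := hs₀.annihilated
  have hμn := hμ.neg
  have main := tendsto_modeAtTop (l := l) (N := fun i x => -sysMatrix (u i (-x)) (φ i (-x)) (lam i))
    (N₀ := fun x => -sysMatrix (u₀ (-x)) (φ₀ (-x)) lam₀)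
    (A := fun i => -sysMatrix (w i) (f i) (lam i)) (A₀ := -sysMatrix w₀ f₀ lam₀)
    (μ := fun i => -μ i) (α := fun i => -α i)
    (β := fun i => -β i) (V := fun i => unstableVector (lam i) (μ i) (n i)) (μ₀ := -μ₀) (α₀ := -α₀)
    (β₀ := -β₀) (C := 2 * (‖lam₀‖ + 1) + L) (η := η) (a := a)
    (V₀ := unstableVector lam₀ μ₀ n₀) (W₀ := fun x => W₀ (-x))
    (W := fun i x => W i (-x)) hN₀ hη hC hΘ hΘ₀ ?k1 hannt hα hβ hα₀ hβ₀ ?k2 ?k3 ?k4 ?k5 ?k6 ?k7 ?k8 ?k9 ?k10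
  case k1 => exact hann
  case k2 => exact ha'
  case k3 => exact hV
  case k4 => exact hV₀
  case k5 => exact hA
  case k6 => exact hμn
  case k7 => exact hVlim
  case k8 => exact hloc
  case k9 => exact hW'
  case k10 => exact hW₀'
  simp only [neg_zero] at main
  exact main

end Convergence

section Limits

variable {ι : Type*} {l : Filter ι} {γ : ℝ}

theorem tendsto_rhConst (hγ : 1 ≤ γ) : Tendsto (rhConst γ) (𝓝[>] 0) (𝓝 0) := by
  have h1 : ∀ᶠ vp in 𝓝[>] (0 : ℝ), vp ∈ Ioo (0 : ℝ) 1 := Ioo_mem_nhdsGT one_pos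
  have h2 : Tendsto (fun vp : ℝ => vp) (𝓝[>] 0) (𝓝 0) := nhdsWithin_le_nhds
  exact squeeze_zero' (h1.mono fun vp h => (rhConst_pos hγ h).le)
    (h1.mono fun vp h => rhConst_le hγ h) h2

/-- A shock profile matched to the limiting profile converges to it locally uniformly. -/
theorem eventually_abs_sub_limitProfile_le (hγ : 1 ≤ γ) {x₀ : ℝ} {vhat : ℝ → ℝ → ℝ}
    (hv : ∀ vp ∈ Ioo (0 : ℝ) 1, IsShockProfile γ vp (vhat vp))
    (h0 : Tendsto (fun vp => vhat vp 0) (𝓝[>] 0) (𝓝 (limitProfile x₀ 0))) (T : ℝ) {ε : ℝ}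
    (hε : 0 < ε) : ∀ᶠ vp in 𝓝[>] (0 : ℝ), ∀ x ∈ Icc (-T) T, |vhat vp x - limitProfile x₀ x| ≤ ε := by
  have h2 : Tendsto (fun vp : ℝ => vp) (𝓝[>] 0) (𝓝 0) := nhdsWithin_le_nhds
  have h3 : Tendsto (fun vp => (|vhat vp 0 - limitProfile x₀ 0| + vp) * Real.exp T) (𝓝[>] 0) (𝓝 0) := by
    have := (((h0.sub_const (limitProfile x₀ 0)).abs.add h2).mul_const (Real.exp T))
    simpa using this
  have h4 : ∀ᶠ vp in 𝓝[>] (0 : ℝ), vp ∈ Ioo (0 : ℝ) 1 := Ioo_mem_nhdsGT one_pos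
  filter_upwards [h4, h3.eventually_lt_const hε] with vp hvp h x hx
  refine ((hv vp hvp).abs_sub_limitProfile_le hγ hvp x₀ x).trans (le_trans ?_ h.le)
  exact mul_le_mul_of_nonneg_left (Real.exp_le_exp.2 (abs_le.2 hx))
    (add_nonneg (abs_nonneg _) hvp.1.le)

/-- Away from the vanishing end state, `f(v̂)` converges to `2 v̂₀ - 1`. -/
theorem eventually_abs_fCoeff_sub_le (hγ : 1 ≤ γ) {x₀ : ℝ} {vhat : ℝ → ℝ → ℝ}
    (hv : ∀ vp ∈ Ioo (0 : ℝ) 1, IsShockProfile γ vp (vhat vp))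
    (h0 : Tendsto (fun vp => vhat vp 0) (𝓝[>] 0) (𝓝 (limitProfile x₀ 0))) (T : ℝ) {ε : ℝ}
    (hε : 0 < ε) : ∀ᶠ vp in 𝓝[>] (0 : ℝ), ∀ x ∈ Icc (-T) T,
      |fCoeff γ vp (vhat vp x) - (2 * limitProfile x₀ x - 1)| ≤ ε := by
  have hpos := limitProfile_mem_Ioo x₀
  obtain ⟨m, hm, hmT⟩ : ∃ m > 0, ∀ x ∈ Icc (-T) T, m ≤ limitProfile x₀ x := by
    rcases (Icc (-T) T).eq_empty_or_nonempty with he | hne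
    · exact ⟨1, one_pos, fun x hx => by simp [he] at hx⟩
    · obtain ⟨y, -, hy⟩ := isCompact_Icc.exists_isMinOn hne (continuous_limitProfile x₀).continuousOn
      exact ⟨_, (hpos y).1, fun x hx => hy hx⟩
  have ha := tendsto_rhConst hγ
  have hb : Tendsto (fun vp => rhConst γ vp + (γ - 1) * (rhConst γ vp * (m / 2) ^ (-γ))) (𝓝[>] 0) (𝓝 0) := by
    have := ha.add ((ha.mul_const ((m / 2) ^ (-γ))).const_mul (γ - 1))
    simpa using this
  have h4 : ∀ᶠ vp in 𝓝[>] (0 : ℝ), vp ∈ Ioo (0 : ℝ) 1 := Ioo_mem_nhdsGT one_pos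
  filter_upwards [h4, hb.eventually_lt_const (half_pos hε),
    eventually_abs_sub_limitProfile_le hγ hv h0 T (half_pos hm),
    eventually_abs_sub_limitProfile_le hγ hv h0 T (ε := ε / 4) (by positivity)] with vp hvp h1 h2 h3 x hx
  have hmem := (hv vp hvp).mem_Ioo x
  have hlow : m / 2 ≤ vhat vp x := by linarith [(abs_le.1 (h2 x hx)).1, hmT x hx]
  have hvx : 0 < vhat vp x := hvp.1.trans hmem.1
  have hap := rhConst_pos hγ hvp
  have hpow : vhat vp x ^ (-γ) ≤ (m / 2) ^ (-γ) :=
    Real.rpow_le_rpow_of_nonpos (by positivity) hlow (by linarith)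
  have hpow0 := Real.rpow_nonneg hvx.le (-γ)
  have h5 : (γ - 1) * (rhConst γ vp * vhat vp x ^ (-γ)) ≤ (γ - 1) * (rhConst γ vp * (m / 2) ^ (-γ)) :=
    mul_le_mul_of_nonneg_left (mul_le_mul_of_nonneg_left hpow hap.le) (by linarith)
  have h6 : 0 ≤ (γ - 1) * (rhConst γ vp * vhat vp x ^ (-γ)) :=
    mul_nonneg (by linarith) (mul_nonneg hap.le hpow0)
  have h7 := abs_le.1 (h3 x hx)
  rw [fCoeff_eq hvx, abs_le]
  constructor <;> linarith [h7.1, h7.2]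

/-- The unstable modes at `-∞` converge in the high-Mach-number limit. -/
theorem tendsto_unstable_mode (hγ : 1 ≤ γ) {x₀ : ℝ} {vhat : ℝ → ℝ → ℝ}
    (hv : ∀ vp ∈ Ioo (0 : ℝ) 1, IsShockProfile γ vp (vhat vp))
    (h0 : Tendsto (fun vp => vhat vp 0) (𝓝[>] 0) (𝓝 (limitProfile x₀ 0)))
    {vp : ι → ℝ} (hvp : Tendsto vp l (𝓝[>] 0)) {lam : ι → ℂ} {lam₀ : ℂ}
    (hre : ∀ᶠ i in l, 0 ≤ (lam i).re) (hre₀ : 0 ≤ lam₀.re) (hlam : Tendsto lam l (𝓝 lam₀))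
    {n μ : ι → ℂ} {n₀ μ₀ : ℂ} (hn : Tendsto n l (𝓝 n₀)) (hn0 : n₀ ≠ 0) {V : ι → Fin 3 → ℂ}
    {V₀ : Fin 3 → ℂ}
    (hV : ∀ᶠ i in l, evansMatrix γ (vp i) 1 (lam i) *ᵥ V i = μ i • V i ∧ 0 < (μ i).re ∧ V i 1 = n i)
    (hV₀ : limitMatrix 1 lam₀ *ᵥ V₀ = μ₀ • V₀ ∧ 0 < μ₀.re ∧ V₀ 1 = n₀)
    {W : ι → ℝ → Fin 3 → ℂ} {W₀ : ℝ → Fin 3 → ℂ}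
    (hW : ∀ᶠ i in l, IsModeAtBot (fun x => evansMatrix γ (vp i) (vhat (vp i) x) (lam i)) (μ i) (V i) (W i))
    (hW₀ : IsModeAtBot (fun x => limitMatrix (limitProfile x₀ x) lam₀) μ₀ V₀ W₀) :
    Tendsto (fun i => W i 0) l (𝓝 (W₀ 0)) := by
  have hlim1 : ∀ lam, limitMatrix 1 lam = sysMatrix 1 1 lam := fun lam => by
    rw [limitMatrix_eq]; norm_num
  have hsmall : ∀ᶠ i in l, vp i ∈ Ioo (0 : ℝ) 1 := hvp.eventually (Ioo_mem_nhdsGT one_pos)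
  have hsplit : ∀ i, ∃ μ α β, vp i ∈ Ioo (0 : ℝ) 1 → 0 ≤ (lam i).re →
      IsUnstableSplit 1 (fCoeff γ (vp i) 1) (lam i) μ α β := by
    intro i
    by_cases h : vp i ∈ Ioo (0 : ℝ) 1 ∧ 0 ≤ (lam i).re
    · obtain ⟨μ, α, β, hs⟩ := exists_unstableSplit_one hγ h.1 h.2
      exact ⟨μ, α, β, fun _ _ => hs⟩
    · exact ⟨0, 0, 0, fun h1 h2 => absurd ⟨h1, h2⟩ h⟩
  choose μ' α β hs using hsplit
  have hs' : ∀ᶠ i in l, IsUnstableSplit 1 (fCoeff γ (vp i) 1) (lam i) (μ' i) (α i) (β i) := by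
    filter_upwards [hsmall, hre] with i h1 h2 using hs i h1 h2
  obtain ⟨μ₀', α₀, β₀, hs₀⟩ := exists_unstableSplit_limit hre₀
  rw [hlim1] at hV₀
  obtain ⟨rfl, rfl⟩ := hs₀.eq_of_eigenvector hn0 hV₀.1 hV₀.2.1 hV₀.2.2
  have hne : ∀ᶠ i in l, n i ≠ 0 := hn.eventually_ne hn0
  have hW' : ∀ᶠ i in l, IsModeAtBot
      (fun x => sysMatrix (vhat (vp i) x) (fCoeff γ (vp i) (vhat (vp i) x)) (lam i)) (μ' i)
      (unstableVector (lam i) (μ' i) (n i)) (W i) := by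
    filter_upwards [hW, hV, hne, hs'] with i h1 h2 h3 h4
    obtain ⟨e1, e2⟩ := h4.eq_of_eigenvector h3 h2.1 h2.2.1 h2.2.2
    rw [e1, e2] at h1
    exact h1
  have hl0 := limitProfile_mem_Ioo x₀ 0
  set c := limitProfile x₀ 0 with hc
  have hc0 : Tendsto (fun i => vhat (vp i) 0) l (𝓝 c) := h0.comp hvp
  have hc1 : Tendsto (fun i => vhat (vp i) 0 - vp i) l (𝓝 c) := by
    simpa using hc0.sub (hvp.mono_right nhdsWithin_le_nhds)
  have hg : 0 ≤ (γ - 1) * γ := mul_nonneg (by linarith) (by linarith)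
  have hweak : ∀ {η x : ℝ}, c / 2 ≤ η → 0 ≤ x → Real.exp (-η * x) ≤ Real.exp (-(c / 2) * x) :=
    fun h hx => Real.exp_le_exp.2 (by nlinarith)
  have hbds : ∀ᶠ i in l, vp i ∈ Ioo (0 : ℝ) 1 ∧ c / 2 < vhat (vp i) 0 ∧ c / 2 < vhat (vp i) 0 - vp i := by
    filter_upwards [hsmall, hc0.eventually_const_lt (half_lt_self hl0.1),
      hc1.eventually_const_lt (half_lt_self hl0.1)] with i h1 h2 h3 using ⟨h1, h2, h3⟩
  have hL : 0 ≤ 2 + (γ - 1) * γ / (c / 2) := add_nonneg zero_le_two (div_nonneg hg (half_pos hl0.1).le)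
  have hw : ∀ᶠ i in l, ∀ x, 0 ≤ x → |vhat (vp i) (-x) - 1| ≤ Real.exp (-(c / 2) * x) := by
    filter_upwards [hbds] with i hi x hx
    exact ((hv _ hi.1).abs_sub_le_bot hγ hi.1 hx).1.trans (hweak hi.2.2.le hx)
  have hf : ∀ᶠ i in l, ∀ x, 0 ≤ x → |fCoeff γ (vp i) (vhat (vp i) (-x)) - fCoeff γ (vp i) 1|
      ≤ (2 + (γ - 1) * γ / (c / 2)) * Real.exp (-(c / 2) * x) := by
    filter_upwards [hbds] with i hi x hx
    refine ((hv _ hi.1).abs_sub_le_bot hγ hi.1 hx).2.trans ?_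
    exact mul_le_mul (add_le_add le_rfl (div_le_div_of_nonneg_left hg (half_pos hl0.1) hi.2.1.le))
      (hweak hi.2.2.le hx) (Real.exp_pos _).le hL
  have hw₀ : ∀ x, 0 ≤ x → |limitProfile x₀ (-x) - 1| ≤ Real.exp (-(c / 2) * x) := fun x hx =>
    (abs_limitProfile_sub_one_le_bot x₀ hx).trans (hweak (half_le_self hl0.1.le) hx)
  have hf₀ : ∀ x, 0 ≤ x → |2 * limitProfile x₀ (-x) - 1 - 1|
      ≤ (2 + (γ - 1) * γ / (c / 2)) * Real.exp (-(c / 2) * x) := by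
    intro x hx
    have h1 := abs_two_mul_sub_le (hw₀ x hx)
    have h2 : 0 ≤ (γ - 1) * γ / (c / 2) * Real.exp (-(c / 2) * x) :=
      mul_nonneg (div_nonneg hg (half_pos hl0.1).le) (Real.exp_pos _).le
    rw [show (2 * 1 - 1 : ℝ) = 1 by norm_num] at h1
    linarith
  have hflim : Tendsto (fun i => fCoeff γ (vp i) 1) l (𝓝 1) := by
    have := (((tendsto_rhConst hγ).comp hvp).const_mul γ).const_sub 1
    simp only [fCoeff_one]
    simpa using this
  have hu : ∀ T, ∀ ε > 0, ∀ᶠ i in l, ∀ x ∈ Icc 0 T,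
      |vhat (vp i) (-x) - limitProfile x₀ (-x)| ≤ ε := by
    intro T ε hε
    filter_upwards [hvp.eventually (eventually_abs_sub_limitProfile_le hγ hv h0 T hε)] with i hi x hx
    exact hi _ ⟨by linarith [hx.2], by linarith [hx.1, hx.2]⟩
  have hφ : ∀ T, ∀ ε > 0, ∀ᶠ i in l, ∀ x ∈ Icc 0 T,
      |fCoeff γ (vp i) (vhat (vp i) (-x)) - (2 * limitProfile x₀ (-x) - 1)| ≤ ε := by
    intro T ε hε
    filter_upwards [hvp.eventually (eventually_abs_fCoeff_sub_le hγ hv h0 T hε)] with i hi x hx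
    exact hi _ ⟨by linarith [hx.2], by linarith [hx.1, hx.2]⟩
  have hcont := continuous_limitProfile x₀
  have hcont' : Continuous fun x => 2 * limitProfile x₀ x - 1 := by fun_prop
  exact tendsto_modeAtBot (u := fun i x => vhat (vp i) x)
    (φ := fun i x => fCoeff γ (vp i) (vhat (vp i) x)) (w := fun _ => 1)
    (f := fun i => fCoeff γ (vp i) 1) hcont hcont' (half_pos hl0.1) hL hw hf hw₀ hf₀
    tendsto_const_nhds hflim hlam hs' hs₀ hn hu hφ hW' hW₀

end Limits

section WeightedContraction

/-- The constant of the weighted contraction estimate. -/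
noncomputable def contractionConst (D η : ℝ) : ℝ := 4 * (1 / η + 2 * ((D / η + 1) / η))

theorem contractionConst_pos {D η : ℝ} (hD : 0 ≤ D) (hη : 0 < η) : 0 < contractionConst D η := by
  unfold contractionConst; positivity

/-- In a linear system with a neutral, a nilpotent and an unstable direction, coupled by
exponentially decaying coefficients, solutions tending to small data at `+∞` are small. -/
theorem norm_le_of_weighted_contraction {X η C D G : ℝ} (hX : 0 ≤ X) (hη : 0 < η) (hη4 : η ≤ 1 / 4)
    (hC : 0 ≤ C) (hD : 0 ≤ D) (hG : 0 ≤ G)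
    (hsmall : contractionConst D η * (C * Real.exp (-η * X)) ≤ 1 / 2)
    {q ζ y p₁ p₂ p₃ : ℝ → ℂ} {a₁ ζ₁ : ℂ} {k : ℝ → ℂ} (hk : Continuous k)
    (ha : 0 ≤ a₁.re) (hkre : ∀ x ∈ Ici X, 1 / 2 ≤ (k x).re)
    (hq : ∀ x ∈ Ici X, HasDerivAt q (a₁ * q x + p₁ x) x)
    (hζ : ∀ x ∈ Ici X, HasDerivAt ζ (p₂ x) x)
    (hy : ∀ x ∈ Ici X, HasDerivAt y (k x * y x + p₃ x) x)
    (hp₁ : ∀ x ∈ Ici X, ‖p₁ x‖ ≤ C * Real.exp (-(3 * η) * x) * ‖y x‖ + G * Real.exp (-η * x))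
    (hp₂ : ∀ x ∈ Ici X, ‖p₂ x‖ ≤ D * ‖q x‖ + C * Real.exp (-(3 * η) * x) * ‖y x‖
      + G * Real.exp (-η * x))
    (hp₃ : ∀ x ∈ Ici X, ‖p₃ x‖ ≤ ‖q x‖ + 2 * ‖ζ x‖ + G * Real.exp (η * x))
    (hqlim : Tendsto q atTop (𝓝 0)) (hζlim : Tendsto ζ atTop (𝓝 ζ₁)) (hζ₁ : ‖ζ₁‖ ≤ G)
    (hybd : ∃ S, ∀ x ∈ Ici X, ‖y x‖ ≤ S) :
    ‖q X‖ ≤ (2 * contractionConst D η + 12) * G ∧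
    ‖ζ X‖ ≤ (2 * contractionConst D η + 13) * G ∧
    ‖y X‖ ≤ (2 * contractionConst D η + 24) * G * Real.exp (η * X) := by
  obtain ⟨S, hS⟩ := hybd
  set K := contractionConst D η with hK
  have hK0 : 0 < K := contractionConst_pos hD hη
  set θ := C * Real.exp (-η * X) with hθ
  have hθ0 : 0 ≤ θ := by positivity
  have zlim : ∀ {κ : ℝ}, 0 < κ → Tendsto (fun s => Real.exp (-κ * s) * ‖y s‖) atTop (𝓝 0) := by
    intro κ hκ
    have h1 : Tendsto (fun s => Real.exp (-κ * s) * S) atTop (𝓝 0) := by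
      simpa using (tendsto_exp_neg_mul hκ).mul_const S
    refine squeeze_zero' (Eventually.of_forall fun s => by positivity) ?_ h1
    filter_upwards [eventually_ge_atTop X] with s hs
    exact mul_le_mul_of_nonneg_left (hS s hs) (Real.exp_pos _).le
  have bounds : ∀ Y, (∀ x ∈ Ici X, ‖y x‖ ≤ Y * Real.exp (η * x)) →
      (∀ x ∈ Ici X, ‖q x‖ ≤ (θ * Y + G) / η * Real.exp (-η * x)) ∧
      (∀ x ∈ Ici X, ‖ζ x‖ ≤ G + (D * ((θ * Y + G) / η) + (θ * Y + G)) / η) ∧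
      ∀ x ∈ Ici X, ‖y x‖ ≤ (K * (θ * Y + G) + 12 * G) * Real.exp (η * x) := by
    intro Y hY
    have hY0 : 0 ≤ Y := by
      have := (norm_nonneg _).trans (hY X self_mem_Ici)
      exact nonneg_of_mul_nonneg_left this (Real.exp_pos _)
    set P := θ * Y + G with hP
    have hP0 : 0 ≤ P := by positivity
    have hCY : ∀ x ∈ Ici X, C * Real.exp (-(3 * η) * x) * ‖y x‖ ≤ θ * Y * Real.exp (-η * x) := by
      intro x hx
      have h1 : C * Real.exp (-(3 * η) * x) * ‖y x‖ ≤
          C * Real.exp (-(3 * η) * x) * (Y * Real.exp (η * x)) :=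
        mul_le_mul_of_nonneg_left (hY x hx) (by positivity)
      have h2 : C * Real.exp (-(3 * η) * x) * (Y * Real.exp (η * x))
          = C * Y * Real.exp (-η * x) * Real.exp (-η * x) := by
        have : Real.exp (-(3 * η) * x) * Real.exp (η * x)
            = Real.exp (-η * x) * Real.exp (-η * x) := by
          rw [← Real.exp_add, ← Real.exp_add]; ring_nf
        linear_combination C * Y * this
      have h3 : Real.exp (-η * x) ≤ Real.exp (-η * X) := Real.exp_le_exp.2 (by nlinarith [mem_Ici.1 hx])
      have h4 : C * Y * Real.exp (-η * x) ≤ C * Y * Real.exp (-η * X) :=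
        mul_le_mul_of_nonneg_left h3 (by positivity)
      have h5 := mul_le_mul_of_nonneg_right h4 (Real.exp_pos (-η * x)).le
      rw [hθ]
      linarith
    have hqb : ∀ x ∈ Ici X, ‖q x‖ ≤ P / η * Real.exp (-η * x) := by
      have := norm_le_of_forcing (κ := 0) (η := η) (G := P) (k := fun _ => a₁) continuous_const
        (reachesLimit_Ici X) (y := q) (p := p₁) (by simpa using hq) (fun _ _ => ha)
        (fun x hx => by
          refine (hp₁ x hx).trans ?_
          rw [hP, add_mul]
          exact add_le_add_left (hCY x hx) _) (by linarith) (by simpa using hqlim.norm)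
      simpa using this
    set Q := P / η with hQ
    have hQ0 : 0 ≤ Q := by positivity
    have hζb : ∀ x ∈ Ici X, ‖ζ x‖ ≤ G + (D * Q + P) / η := by
      have h1 := norm_le_of_forcing (κ := 0) (η := η) (G := D * Q + P) (k := fun _ => 0)
        continuous_const (reachesLimit_Ici X) (y := fun x => ζ x - ζ₁) (p := p₂)
        (fun x hx => ((hζ x hx).sub_const ζ₁).congr_deriv (by simp)) (fun _ _ => by simp)
        (fun x hx => by
          refine (hp₂ x hx).trans ?_
          have h2 := mul_le_mul_of_nonneg_left (hqb x hx) hD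
          have h3 := hCY x hx
          have h4 : (D * Q + P) * Real.exp (-η * x) = D * (Q * Real.exp (-η * x))
              + θ * Y * Real.exp (-η * x) + G * Real.exp (-η * x) := by rw [hP]; ring
          linarith)
        (by linarith) (by
          have := (hζlim.sub_const ζ₁).norm
          simpa using this)
      intro x hx
      have h2 := h1 x hx
      rw [zero_add] at h2
      have h3 : Real.exp (-η * x) ≤ 1 := Real.exp_le_one_iff.2 (by nlinarith [mem_Ici.1 hx])
      have h4 : (D * Q + P) / η * Real.exp (-η * x) ≤ (D * Q + P) / η :=
        mul_le_of_le_one_right (by positivity) h3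
      have h5 : ‖ζ x‖ ≤ ‖ζ x - ζ₁‖ + ‖ζ₁‖ := by
        simpa using norm_add_le (ζ x - ζ₁) ζ₁
      linarith
    set Z := (D * Q + P) / η with hZ
    have hZ0 : 0 ≤ Z := by positivity
    refine ⟨hqb, hζb, ?_⟩
    have h1 := norm_le_of_forcing (κ := 1 / 2) (η := -η) (G := Q + 2 * Z + 3 * G) hk
      (reachesLimit_Ici X) (y := y) (p := p₃) (by simpa using hy) hkre
      (fun x hx => by
        refine (hp₃ x hx).trans ?_
        have hx0 : 0 ≤ x := hX.trans hx
        have h2 : 1 ≤ Real.exp (η * x) := Real.one_le_exp (by positivity)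
        have h3 : Real.exp (-η * x) ≤ 1 := Real.exp_le_one_iff.2 (by nlinarith)
        have h4 := mul_le_of_le_one_right hQ0 h3
        have h5 : Q + 2 * (G + Z) ≤ (Q + 2 * (G + Z)) * Real.exp (η * x) :=
          le_mul_of_one_le_right (by positivity) h2
        rw [neg_neg]
        linarith [hqb x hx, hζb x hx])
      (by linarith) (zlim (by norm_num))
    intro x hx
    refine (h1 x hx).trans ?_
    rw [neg_neg]
    refine mul_le_mul_of_nonneg_right ?_ (Real.exp_pos _).le
    have h6 : (Q + 2 * Z + 3 * G) / (1 / 2 + -η) ≤ 4 * (Q + 2 * Z + 3 * G) := by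
      rw [div_le_iff₀ (by linarith)]
      have : 0 ≤ Q + 2 * Z + 3 * G := by positivity
      nlinarith
    have h7 : 4 * (Q + 2 * Z) = K * P := by
      rw [hZ, hQ, hK, contractionConst]; field_simp
    linarith
  set T : Set ℝ := (fun x => ‖y x‖ * Real.exp (-η * x)) '' Ici X with hT
  have hTb : BddAbove T := by
    refine ⟨S, ?_⟩
    rintro _ ⟨x, hx, rfl⟩
    have h3 : Real.exp (-η * x) ≤ 1 := Real.exp_le_one_iff.2 (by nlinarith [mem_Ici.1 hx])
    exact (mul_le_of_le_one_right (norm_nonneg _) h3).trans (hS x hx)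
  have hTne : T.Nonempty := ⟨_, X, self_mem_Ici, rfl⟩
  set Y := sSup T with hYdef
  have hconv : ∀ {x B : ℝ}, ‖y x‖ * Real.exp (-η * x) ≤ B ↔ ‖y x‖ ≤ B * Real.exp (η * x) := by
    intro x B
    rw [neg_mul, Real.exp_neg, ← div_eq_mul_inv, div_le_iff₀ (Real.exp_pos _)]
  have hY : ∀ x ∈ Ici X, ‖y x‖ ≤ Y * Real.exp (η * x) := fun x hx =>
    hconv.1 (le_csSup hTb ⟨x, hx, rfl⟩)
  obtain ⟨b1, b2, b3⟩ := bounds Y hY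
  have hYle : Y ≤ K * (θ * Y + G) + 12 * G := by
    refine csSup_le hTne ?_
    rintro _ ⟨x, hx, rfl⟩
    exact hconv.2 (b3 x hx)
  have hY0 : 0 ≤ Y := by
    have := (norm_nonneg _).trans (hY X self_mem_Ici)
    exact nonneg_of_mul_nonneg_left this (Real.exp_pos _)
  have hθY : K * θ * Y ≤ 1 / 2 * Y := mul_le_mul_of_nonneg_right hsmall hY0
  have hYG : Y ≤ (2 * K + 24) * G := by linarith
  have hKP : K * (θ * Y + G) ≤ (2 * K + 12) * G := by linarith
  have hP0 : 0 ≤ θ * Y + G := by positivity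
  have e : K * (θ * Y + G) = 4 * ((θ * Y + G) / η)
      + 8 * ((D * ((θ * Y + G) / η) + (θ * Y + G)) / η) := by
    rw [hK, contractionConst]; field_simp; ring
  have n1 : 0 ≤ (θ * Y + G) / η := by positivity
  have n2 : 0 ≤ (D * ((θ * Y + G) / η) + (θ * Y + G)) / η := by positivity
  refine ⟨?_, ?_, (hY X self_mem_Ici).trans (mul_le_mul_of_nonneg_right hYG (Real.exp_pos _).le)⟩
  · have h3 : Real.exp (-η * X) ≤ 1 := Real.exp_le_one_iff.2 (by nlinarith)
    have := mul_le_of_le_one_right n1 h3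
    linarith [b1 X self_mem_Ici]
  · linarith [b2 X self_mem_Ici]

end WeightedContraction

section DualCoordinates

variable {b g : ℝ} {lam t₁ t₂ t₃ : ℂ}

/-- Identities behind the near-diagonalisation of the adjoint system at the degenerate end state:
`ε` is `b / t₂`, and `e` and `ρ` are the coefficients of the adapted coordinates. -/
theorem IsRootTriple.dual_identities (h : IsRootTriple b g lam t₁ t₂ t₃) (h2 : t₂ ≠ 0) {ε e ρ : ℂ}
    (hε : ε * t₂ = b) (he : e = b ^ 2 - g ^ 2 * ε ^ 2) (hρ : ρ = t₃ * (t₁ + t₂)) :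
    (t₁ + t₂) * (t₂ + t₃) = ε * lam + e ∧ e = (t₁ + t₂) * (t₂ + t₃) * ε ∧
    e * (lam - b ^ 2 + g ^ 2 + (t₁ + t₂) * (t₂ + t₃)) = lam * b ^ 2 * (1 + ε) ∧
    (t₁ + t₂) * (t₁ + t₃) - ρ = -(lam + ρ) * ε ∧
    -lam * b ^ 2 + ρ * (lam - b ^ 2 + g ^ 2 + (t₁ + t₂) * (t₁ + t₃)) = -(lam + ρ) * e := by
  have hr := h.rotate.eigenvalue_eq
  have hr' := h.rotate.mul_eigenvalue_eq
  have hs := h.eigenvalue_eq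
  have hμ : (t₁ + t₂) * (t₂ + t₃) = t₂ ^ 2 - (g : ℂ) ^ 2 - lam := by linear_combination hr
  have hμ' : (t₁ + t₂) * (t₂ + t₃) * (t₂ - b) = b * lam := by linear_combination hr'
  set m := (t₁ + t₂) * (t₂ + t₃) with hm
  have s1 : lam + ρ = -(t₁ * t₂) - g ^ 2 := by rw [hρ]; linear_combination h.sum_mul_eq
  have r1 : (t₁ * t₂ + g ^ 2) * b = (t₁ + t₂) * t₁ * t₂ := by
    linear_combination -t₁ * t₂ * h.sum_eq + h.prod_eq
  have e1 : e = m * ε := by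
    refine mul_right_cancel₀ (pow_ne_zero 2 h2) ?_
    rw [he]
    linear_combination (-(g : ℂ) ^ 2 * (ε * t₂ + b) - m * t₂) * hε - b ^ 2 * hμ - b * hμ'
  refine ⟨?_, e1, ?_, ?_, ?_⟩
  · refine mul_right_cancel₀ h2 ?_
    rw [e1]
    linear_combination hμ' - (lam + m) * hε
  · rw [e1]
    linear_combination m * ε * hμ + ε * (t₂ + b) * hμ' + lam * b * hε
  · refine mul_right_cancel₀ h2 ?_
    linear_combination -t₂ * hρ + (lam + ρ) * hε + b * s1 + t₁ * t₂ * h.sum_eq - h.prod_eq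
  · refine mul_right_cancel₀ (pow_ne_zero 2 h2) ?_
    linear_combination t₂ ^ 2 * ρ * hs + (lam + ρ) * t₂ ^ 2 * he
      - (lam + ρ) * g ^ 2 * (ε * t₂ + b) * hε - g ^ 2 * b ^ 2 * s1 + g ^ 2 * b * r1
      + (t₁ + t₂) * t₁ * t₂ * h.prod_eq + t₁ ^ 2 * t₂ ^ 2 * hρ

/-- The adapted coordinate `q` annihilates the dual vector. -/
theorem IsRootTriple.dual_orthogonality (h : IsRootTriple b g lam t₁ t₂ t₃) (h1 : t₁ ≠ 0)
    (h1b : t₁ - b ≠ 0) (h2 : t₂ ≠ 0) :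
    (b : ℂ) / t₁ + b / t₂ + (b ^ 2 - g ^ 2 * (b / t₂) ^ 2) * (1 / (t₁ * (t₁ - b))) = 0 := by
  field_simp
  linear_combination b * t₁ * t₂ * h.sum_eq - b * h.prod_eq

/-- The coefficients of the adjoint system in adapted coordinates are small with `b`. -/
theorem exists_bound_dual_coefficients (gmax L : ℝ) : ∃ M > 0, ∃ b₀ > 0, ∀ (b g : ℝ) (lam t₁ t₂ t₃ : ℂ),
    0 < b → b < b₀ → 1 / 2 ≤ g → g ≤ gmax → 0 ≤ lam.re → ‖lam‖ ≤ L →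
    IsSplitTriple b g lam t₁ t₂ t₃ → ‖t₃‖ ≤ ‖t₂‖ →
    t₁ ≠ 0 ∧ t₁ - b ≠ 0 ∧ t₂ ≠ 0 ∧ ‖1 / (t₁ * (t₁ - b))‖ ≤ M ∧ ‖(b : ℂ) / t₂‖ ≤ M * b ∧
    ‖(b : ℂ) ^ 2 - g ^ 2 * (b / t₂) ^ 2‖ ≤ M * b ^ 2 ∧ ‖t₃ * (t₁ + t₂)‖ ≤ M * b ^ 2 ∧
    ‖(t₁ + t₂) * (t₁ + t₃)‖ ≤ M * b ∧ ‖(t₁ + t₂) * (t₁ - t₂)‖ ≤ M * b := by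
  set R := 1 + 1 + (gmax ^ 2 + |L|) + gmax ^ 2 * 1 with hR
  have hR0 : 0 ≤ R := by positivity
  set m := 8 * gmax ^ 2 with hm
  have hm0 : 0 ≤ m := by positivity
  have hM1 : 0 ≤ m * (1 + m) := by positivity
  have hM2 : 0 ≤ (1 + m) * (2 * R) := by positivity
  have hM3 := sq_nonneg gmax
  set M := 6 + 16 * gmax ^ 2 + m * (1 + m) + (1 + m) * (2 * R) with hM
  refine ⟨M, by positivity, 1 / (128 * (gmax ^ 2 + 1)), by positivity, ?_⟩
  intro b g lam t₁ t₂ t₃ hb hb₀ hg hgm hlam hL h h32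
  have hg0 : 0 < g := by linarith
  rw [lt_div_iff₀ (by positivity)] at hb₀
  have hb8 : b < 1 / 8 := by nlinarith [mul_nonneg hb.le hM3]
  have hg2 : g ^ 2 ≤ gmax ^ 2 := pow_le_pow_left₀ hg0.le hgm 2
  have n1 : 1 / 2 ≤ ‖t₁‖ := hg.trans h.le_norm
  have nb : ‖(b : ℂ)‖ = b := by rw [Complex.norm_real, Real.norm_of_nonneg hb.le]
  have ng : ‖(g : ℂ)‖ = g := by rw [Complex.norm_real, Real.norm_of_nonneg hg0.le]
  have root_le : ∀ t : ℂ, (t ^ 2 - (g : ℂ) ^ 2) * (t - b) = lam * t → ‖t‖ ≤ R := fun t ht => by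
    refine (norm_le_of_root hb ht).trans ?_
    have : g ^ 2 * b ≤ gmax ^ 2 * 1 := mul_le_mul hg2 (by linarith) hb.le hM3
    linarith [le_abs_self L]
  have r1 := root_le _ h.toIsRootTriple.root
  have r2 := root_le _ h.toIsRootTriple.rotate.root
  have r3 := root_le _ h.toIsRootTriple.rotate.rotate.root
  have hprod : ‖t₁‖ * ‖t₂‖ * ‖t₃‖ ≤ gmax ^ 2 * b := by
    rw [← norm_mul, ← norm_mul, h.prod_eq, norm_neg, norm_mul, norm_pow, ng, nb]
    exact mul_le_mul_of_nonneg_right hg2 hb.le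
  have h23 : ‖t₂‖ * ‖t₃‖ ≤ 2 * gmax ^ 2 * b := by
    have := mul_le_mul_of_nonneg_right n1 (mul_nonneg (norm_nonneg t₂) (norm_nonneg t₃))
    linarith
  have h3 : ‖t₃‖ < 1 / 8 := by
    by_contra! hc
    have := mul_le_mul (hc.trans h32) hc (by norm_num) (norm_nonneg _)
    linarith
  have e12 : t₁ + t₂ = b - t₃ := by linear_combination h.sum_eq
  have hsum : ‖t₁ + t₂‖ ≤ b + ‖t₃‖ := by
    rw [e12]
    exact (norm_sub_le _ _).trans (by rw [nb])
  have n2 : 1 / 4 ≤ ‖t₂‖ := by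
    have := norm_sub_le (t₁ + t₂) t₂
    rw [add_sub_cancel_right] at this
    linarith
  have h3b : ‖t₃‖ ≤ m * b := by
    have := mul_le_mul_of_nonneg_right n2 (norm_nonneg t₃)
    linarith
  have hsumb : ‖t₁ + t₂‖ ≤ (1 + m) * b := by linarith
  have n1b : 3 / 8 ≤ ‖t₁ - b‖ := by
    have := norm_sub_norm_le t₁ (b : ℂ)
    rw [nb] at this
    linarith
  have hε : ‖(b : ℂ) / t₂‖ ≤ 4 * b := by
    rw [norm_div, nb, div_le_iff₀ (by linarith)]
    nlinarith
  have two : ∀ s t : ℂ, ‖s‖ ≤ R → ‖t‖ ≤ R → ‖(t₁ + t₂) * (s + t)‖ ≤ M * b := by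
    intro s t hs ht
    rw [norm_mul]
    have := mul_le_mul hsumb ((norm_add_le s t).trans (by linarith : ‖s‖ + ‖t‖ ≤ 2 * R))
      (norm_nonneg _) (by positivity)
    have h5 : (1 + m) * (2 * R) * b ≤ M * b := mul_le_mul_of_nonneg_right (by linarith) hb.le
    linarith
  refine ⟨norm_pos_iff.1 (by linarith), norm_pos_iff.1 (by linarith), norm_pos_iff.1 (by linarith),
    ?_, hε.trans (mul_le_mul_of_nonneg_right (by linarith) hb.le), ?_, ?_, two _ _ r1 r3, ?_⟩
  · rw [norm_div, norm_one, norm_mul]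
    have := mul_le_mul n1 n1b (by norm_num) (norm_nonneg _)
    rw [div_le_iff₀ (by linarith)]
    nlinarith
  · refine (norm_sub_le _ _).trans ?_
    rw [norm_mul, norm_pow, norm_pow, norm_pow, nb, ng]
    have := mul_le_mul hg2 (pow_le_pow_left₀ (norm_nonneg _) hε 2) (by positivity) hM3
    have h5 : (1 + 16 * gmax ^ 2) * b ^ 2 ≤ M * b ^ 2 :=
      mul_le_mul_of_nonneg_right (by linarith) (by positivity)
    linarith
  · rw [norm_mul]
    have := mul_le_mul h3b hsumb (norm_nonneg _) (by positivity)
    have h5 : m * (1 + m) * b ^ 2 ≤ M * b ^ 2 :=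
      mul_le_mul_of_nonneg_right (by linarith) (by positivity)
    linarith
  · have := two t₁ (-t₂) r1 (by rwa [norm_neg])
    rwa [← sub_eq_add_neg] at this

end DualCoordinates

section AdaptedConvergence

variable {ι : Type*} {l : Filter ι}

/-- Convergence, at a fixed large abscissa, of the solutions of adapted systems that are prescribed
at `+∞`. The unstable component is allowed to have a boundary layer at `+∞`. -/
theorem exists_tendsto_of_adapted_systems {q ζ y : ι → ℝ → ℂ} {q₀ ζ₀ y₀ : ℝ → ℂ} {a₁ δ ε : ι → ℂ}
    {R₁ R₂ k : ι → ℝ → ℂ} {r k₀ : ℝ → ℂ} {δ₀ : ℂ} {C B η X₁ : ℝ} (hη : 0 < η) (hη4 : η ≤ 1 / 4)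
    (hq : ∀ᶠ i in l, ∀ x, HasDerivAt (q i) (a₁ i * q i x - R₁ i x * y i x) x)
    (hζ : ∀ᶠ i in l, ∀ x, HasDerivAt (ζ i) (-δ i * q i x - R₂ i x * y i x) x)
    (hy : ∀ᶠ i in l, ∀ x, HasDerivAt (y i) (k i x * y i x - q i x - (1 - ε i) * ζ i x) x)
    (hq₀ : ∀ x, HasDerivAt q₀ (-r x * y₀ x) x)
    (hζ₀ : ∀ x, HasDerivAt ζ₀ (-δ₀ * q₀ x - r x * y₀ x) x)
    (hy₀ : ∀ x, HasDerivAt y₀ (k₀ x * y₀ x - q₀ x - ζ₀ x) x)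
    (hR₁ : ∀ᶠ i in l, ∀ x, 0 ≤ x → ‖R₁ i x‖ ≤ C * Real.exp (-(3 * η) * x))
    (hR₂ : ∀ᶠ i in l, ∀ x, 0 ≤ x → ‖R₂ i x‖ ≤ C * Real.exp (-(3 * η) * x))
    (hr : ∀ x, 0 ≤ x → ‖r x‖ ≤ C * Real.exp (-(3 * η) * x))
    (hkB : ∀ᶠ i in l, ∀ x, 0 ≤ x → ‖k i x - k₀ x‖ ≤ B)
    (hR₁loc : ∀ T, ∀ τ > 0, ∀ᶠ i in l, ∀ x ∈ Icc 0 T, ‖R₁ i x - r x‖ ≤ τ)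
    (hR₂loc : ∀ T, ∀ τ > 0, ∀ᶠ i in l, ∀ x ∈ Icc 0 T, ‖R₂ i x - r x‖ ≤ τ)
    (hkloc : ∀ T, ∀ τ > 0, ∀ᶠ i in l, ∀ x ∈ Icc 0 T, ‖k i x - k₀ x‖ ≤ τ)
    (hare : ∀ᶠ i in l, 0 ≤ (a₁ i).re) (ha : Tendsto a₁ l (𝓝 0)) (hδ : Tendsto δ l (𝓝 δ₀))
    (hε : Tendsto ε l (𝓝 0)) (hk : ∀ᶠ i in l, Continuous (k i))
    (hkre : ∀ᶠ i in l, ∀ x, X₁ ≤ x → 1 / 2 ≤ (k i x).re) {ζ₁ : ι → ℂ} {ζ₂ : ℂ} {y₁ : ι → ℂ} {y₂ : ℂ}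
    (hqlim : ∀ᶠ i in l, Tendsto (q i) atTop (𝓝 0)) (hq₀lim : Tendsto q₀ atTop (𝓝 0))
    (hζlim : ∀ᶠ i in l, Tendsto (ζ i) atTop (𝓝 (ζ₁ i))) (hζ₀lim : Tendsto ζ₀ atTop (𝓝 ζ₂))
    (hζ₁ : Tendsto ζ₁ l (𝓝 ζ₂)) (hylim : ∀ᶠ i in l, Tendsto (y i) atTop (𝓝 (y₁ i)))
    (hy₀lim : Tendsto y₀ atTop (𝓝 y₂)) :
    ∃ X, 0 ≤ X ∧ Tendsto (fun i => q i X) l (𝓝 (q₀ X)) ∧ Tendsto (fun i => ζ i X) l (𝓝 (ζ₀ X)) ∧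
      Tendsto (fun i => y i X) l (𝓝 (y₀ X)) := by
  have hC : 0 ≤ C := by
    have := (norm_nonneg _).trans (hr 0 le_rfl)
    simpa using this
  have hcont : ∀ {d d' : ℝ → ℂ}, (∀ x, HasDerivAt d (d' x) x) → ContinuousOn d (Ici 0) :=
    fun h x _ => (h x).continuousAt.continuousWithinAt
  obtain ⟨Sy, hSy⟩ := exists_bound_Ici (hcont hy₀) hy₀lim
  obtain ⟨Sζ, hSζ⟩ := exists_bound_Ici (hcont hζ₀) hζ₀lim
  have hSy0 : 0 ≤ Sy := (norm_nonneg _).trans (hSy 0 self_mem_Ici)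
  have hSζ0 : 0 ≤ Sζ := (norm_nonneg _).trans (hSζ 0 self_mem_Ici)
  have hq₀b : ∀ x ∈ Ici (0 : ℝ), ‖q₀ x‖ ≤ C * Sy / (3 * η) * Real.exp (-(3 * η) * x) := by
    have := norm_le_of_forcing (κ := 0) (η := 3 * η) (G := C * Sy) (k := fun _ => 0) continuous_const
      (reachesLimit_Ici 0) (y := q₀) (p := fun x => -r x * y₀ x)
      (fun x _ => (hq₀ x).congr_deriv (by simp)) (fun _ _ => by simp)
      (fun x hx => by
        rw [norm_mul, norm_neg, mul_right_comm]
        exact mul_le_mul (hr x hx) (hSy x hx) (norm_nonneg _) (by positivity)) (by linarith)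
      (by simpa using hq₀lim.norm)
    simpa using this
  set Sq := C * Sy / (3 * η) with hSq
  have hSq0 : 0 ≤ Sq := by positivity
  set D := ‖δ₀‖ + 1 with hD
  have hD0 : 0 ≤ D := by positivity
  set K := contractionConst D η with hK
  have hK0 : 0 < K := contractionConst_pos hD0 hη
  obtain ⟨X, hX₁, hX0, hX⟩ := exists_nonneg_exp_le hη (K * C) (by norm_num : (0 : ℝ) < 1 / 2) X₁
  have hsmall : K * (C * Real.exp (-η * X)) ≤ 1 / 2 := by
    rw [← mul_assoc]; exact hX X le_rfl
  have hsub : ∀ {x}, x ∈ Ici X → x ∈ Ici (0 : ℝ) := fun hx => hX0.trans hx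
  have key : ∀ G > 0, ∀ᶠ i in l, ‖q i X - q₀ X‖ ≤ (2 * K + 12) * G ∧
      ‖ζ i X - ζ₀ X‖ ≤ (2 * K + 13) * G ∧ ‖y i X - y₀ X‖ ≤ (2 * K + 24) * G * Real.exp (η * X) := by
    intro G hG
    set τ := G / (2 * (Sq + Sy + Sζ + 1)) with hτ
    have hτ0 : 0 < τ := by positivity
    have hτG : τ * (Sq + Sy + Sζ + 1) = G / 2 := by rw [hτ]; field_simp
    have hτ1 : τ * Sq ≤ G / 2 := by nlinarith [mul_nonneg hτ0.le hSy0, mul_nonneg hτ0.le hSζ0]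
    have hτ2 : τ * Sy ≤ G / 2 := by nlinarith [mul_nonneg hτ0.le hSq0, mul_nonneg hτ0.le hSζ0]
    have hτ3 : τ * Sζ ≤ G / 2 := by nlinarith [mul_nonneg hτ0.le hSq0, mul_nonneg hτ0.le hSy0]
    have hw : ∀ {R : ι → ℝ → ℂ}, (∀ᶠ i in l, ∀ x, 0 ≤ x → ‖R i x‖ ≤ C * Real.exp (-(3 * η) * x)) →
        (∀ T, ∀ τ > 0, ∀ᶠ i in l, ∀ x ∈ Icc 0 T, ‖R i x - r x‖ ≤ τ) →
        ∀ᶠ i in l, ∀ x, 0 ≤ x → ‖R i x - r x‖ ≤ τ * Real.exp (-η * x) := by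
      intro R h1 h2
      refine eventually_weighted_le (C := 2 * C) (η := 3 * η) (by linarith) ?_ h2 hτ0
      filter_upwards [h1] with i hi x hx
      linarith [norm_sub_le (R i x) (r x), hi x hx, hr x hx]
    have hkw : ∀ᶠ i in l, ∀ x, 0 ≤ x → ‖k i x - k₀ x‖ ≤ τ * Real.exp (-(-η) * x) := by
      refine eventually_weighted_le (C := B) (η := 0) (by linarith) ?_ hkloc hτ0
      filter_upwards [hkB] with i hi x hx
      simpa using hi x hx
    have hδ' := tendsto_iff_norm_sub_tendsto_zero.1 hδ
    have hζ' := tendsto_iff_norm_sub_tendsto_zero.1 hζ₁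
    filter_upwards [hq, hζ, hy, hR₁, hR₂, hare, hk, hkre, hqlim, hζlim, hylim, hw hR₁ hR₁loc,
      hw hR₂ hR₂loc, hkw, (norm_zero (E := ℂ) ▸ ha.norm).eventually_lt_const hτ0,
      hδ'.eventually_lt_const hτ0, hδ'.eventually_lt_const one_pos,
      (norm_zero (E := ℂ) ▸ hε.norm).eventually_lt_const hτ0,
      (norm_zero (E := ℂ) ▸ hε.norm).eventually_lt_const one_pos,
      hζ'.eventually_lt_const hG] with i hq hζ hy hR₁ hR₂ hare hk hkre hqlim hζlim hylim hw₁ hw₂ hkw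
        ha hδτ hδ1 hετ hε1 hζ₁
    have hδD : ‖δ i‖ ≤ D := by
      have := norm_add_le (δ i - δ₀) δ₀
      rw [sub_add_cancel] at this
      linarith
    have hε2 : ‖1 - ε i‖ ≤ 2 := (norm_sub_le _ _).trans (by rw [norm_one]; linarith)
    have hq₀w : ∀ x ∈ Ici X, ‖q₀ x‖ ≤ Sq * Real.exp (-η * x) := fun x hx => by
      refine (hq₀b x (hsub hx)).trans (mul_le_mul_of_nonneg_left (Real.exp_le_exp.2 ?_) hSq0)
      nlinarith [mem_Ici.1 (hsub hx), mul_nonneg hη.le (mem_Ici.1 (hsub hx))]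
    have small : ∀ {c : ℂ} {R : ℝ → ℂ}, ‖c‖ ≤ τ → (∀ x, 0 ≤ x → ‖R x - r x‖ ≤ τ * Real.exp (-η * x)) →
        ∀ x ∈ Ici X, ‖c * q₀ x‖ + ‖(R x - r x) * y₀ x‖ ≤ G * Real.exp (-η * x) := by
      intro c R hc hR x hx
      rw [norm_mul, norm_mul]
      have h1 := mul_le_mul hc (hq₀w x hx) (norm_nonneg _) hτ0.le
      have h2 := mul_le_mul (hR x (hsub hx)) (hSy x (hsub hx)) (norm_nonneg _) (by positivity)
      have h3 := mul_le_mul_of_nonneg_right hτ1 (Real.exp_pos (-η * x)).le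
      have h4 := mul_le_mul_of_nonneg_right hτ2 (Real.exp_pos (-η * x)).le
      linarith
    refine norm_le_of_weighted_contraction (q := fun x => q i x - q₀ x) (ζ := fun x => ζ i x - ζ₀ x)
      (y := fun x => y i x - y₀ x) (a₁ := a₁ i) (ζ₁ := ζ₁ i - ζ₂) (k := k i)
      (p₁ := fun x => a₁ i * q₀ x - R₁ i x * (y i x - y₀ x) - (R₁ i x - r x) * y₀ x)
      (p₂ := fun x => -δ i * (q i x - q₀ x) - (δ i - δ₀) * q₀ x - R₂ i x * (y i x - y₀ x)
        - (R₂ i x - r x) * y₀ x)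
      (p₃ := fun x => (k i x - k₀ x) * y₀ x - (q i x - q₀ x) - (1 - ε i) * (ζ i x - ζ₀ x)
        + ε i * ζ₀ x) hX0 hη hη4 hC hD0 hG.le hsmall hk hare (fun x hx => hkre x (hX₁.trans hx))
      (fun x _ => ((hq x).sub (hq₀ x)).congr_deriv (by ring))
      (fun x _ => ((hζ x).sub (hζ₀ x)).congr_deriv (by ring))
      (fun x _ => ((hy x).sub (hy₀ x)).congr_deriv (by ring)) ?_ ?_ ?_
      (by simpa using hqlim.sub hq₀lim) (hζlim.sub hζ₀lim) hζ₁.le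
      (exists_bound_Ici (fun x _ => ((hy x).continuousAt.sub (hy₀ x).continuousAt).continuousWithinAt)
        (hylim.sub hy₀lim))
    · intro x hx
      have h1 : ‖R₁ i x * (y i x - y₀ x)‖ ≤ C * Real.exp (-(3 * η) * x) * ‖y i x - y₀ x‖ := by
        rw [norm_mul]; exact mul_le_mul_of_nonneg_right (hR₁ x (hsub hx)) (norm_nonneg _)
      have h2 := small ha.le hw₁ x hx
      have h3 := norm_sub_le (a₁ i * q₀ x - R₁ i x * (y i x - y₀ x)) ((R₁ i x - r x) * y₀ x)
      have h4 := norm_sub_le (a₁ i * q₀ x) (R₁ i x * (y i x - y₀ x))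
      linarith
    · intro x hx
      have h1 : ‖R₂ i x * (y i x - y₀ x)‖ ≤ C * Real.exp (-(3 * η) * x) * ‖y i x - y₀ x‖ := by
        rw [norm_mul]; exact mul_le_mul_of_nonneg_right (hR₂ x (hsub hx)) (norm_nonneg _)
      have h2 := small hδτ.le hw₂ x hx
      have h5 : ‖-δ i * (q i x - q₀ x)‖ ≤ D * ‖q i x - q₀ x‖ := by
        rw [norm_mul, norm_neg]; exact mul_le_mul_of_nonneg_right hδD (norm_nonneg _)
      have h3 := norm_sub_le (-δ i * (q i x - q₀ x) - (δ i - δ₀) * q₀ x - R₂ i x * (y i x - y₀ x))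
        ((R₂ i x - r x) * y₀ x)
      have h4 := norm_sub_le (-δ i * (q i x - q₀ x) - (δ i - δ₀) * q₀ x) (R₂ i x * (y i x - y₀ x))
      have h6 := norm_sub_le (-δ i * (q i x - q₀ x)) ((δ i - δ₀) * q₀ x)
      linarith
    · intro x hx
      have hx0 : 0 ≤ x := hsub hx
      have h1 : ‖(k i x - k₀ x) * y₀ x‖ ≤ τ * Real.exp (η * x) * Sy := by
        have := hkw x hx0
        rw [neg_neg] at this
        rw [norm_mul]
        exact mul_le_mul this (hSy x hx0) (norm_nonneg _) (by positivity)
      have h2 : ‖ε i * ζ₀ x‖ ≤ τ * Sζ := by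
        rw [norm_mul]; exact mul_le_mul hετ.le (hSζ x hx0) (norm_nonneg _) hτ0.le
      have h3 : ‖(1 - ε i) * (ζ i x - ζ₀ x)‖ ≤ 2 * ‖ζ i x - ζ₀ x‖ := by
        rw [norm_mul]; exact mul_le_mul_of_nonneg_right hε2 (norm_nonneg _)
      have h4 : 1 ≤ Real.exp (η * x) := Real.one_le_exp (by positivity)
      have h5 := norm_add_le ((k i x - k₀ x) * y₀ x - (q i x - q₀ x) - (1 - ε i) * (ζ i x - ζ₀ x))
        (ε i * ζ₀ x)
      have h6 := norm_sub_le ((k i x - k₀ x) * y₀ x - (q i x - q₀ x)) ((1 - ε i) * (ζ i x - ζ₀ x))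
      have h7 := norm_sub_le ((k i x - k₀ x) * y₀ x) (q i x - q₀ x)
      have h8 := mul_le_mul_of_nonneg_right hτ2 (Real.exp_pos (η * x)).le
      nlinarith
  have conclude : ∀ {c : ℝ} {d : ι → ℂ}, 0 < c → (∀ G > 0, ∀ᶠ i in l, ‖d i‖ ≤ c * G) →
      Tendsto d l (𝓝 0) := by
    intro c d hc h
    rw [Metric.tendsto_nhds]
    intro e he
    filter_upwards [h (e / (2 * c)) (by positivity)] with i hi
    rw [dist_zero_right]
    refine hi.trans_lt ?_
    rw [show c * (e / (2 * c)) = e / 2 by field_simp]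
    linarith
  refine ⟨X, hX0, ?_, ?_, ?_⟩
  · exact tendsto_sub_nhds_zero_iff.1 (conclude (c := 2 * K + 12) (by positivity)
      fun G hG => (key G hG).mono fun i hi => hi.1)
  · exact tendsto_sub_nhds_zero_iff.1 (conclude (c := 2 * K + 13) (by positivity)
      fun G hG => (key G hG).mono fun i hi => hi.2.1)
  · exact tendsto_sub_nhds_zero_iff.1 (conclude (c := (2 * K + 24) * Real.exp (η * X)) (by positivity)
      fun G hG => (key G hG).mono fun i hi => by linarith [hi.2.2])

end AdaptedConvergence

section RowCoordinates

variable {u φ : ℝ → ℝ} {lam ν : ℂ} {V : Fin 3 → ℂ} {Wt : ℝ → Fin 3 → ℂ}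

/-- The row form of an adjoint solution, with the exponential factor removed. -/
noncomputable def rowMode (ν : ℂ) (Wt : ℝ → Fin 3 → ℂ) (x : ℝ) : Fin 3 → ℂ :=
  Complex.exp (ν * x) • star (Wt x)

theorem eq_star_rowMode (ν : ℂ) (Wt : ℝ → Fin 3 → ℂ) (x : ℝ) :
    Wt x = star (Complex.exp (-ν * x) • rowMode ν Wt x) := by
  rw [rowMode, smul_smul, ← Complex.exp_add]
  simp

theorem IsModeAtTop.rowMode_hasDerivAt
    (h : IsModeAtTop (fun x => -(sysMatrix (u x) (φ x) lam)ᴴ) (-star ν) V Wt) (x : ℝ) :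
    HasDerivAt (fun x => rowMode ν Wt x 0) (ν * rowMode ν Wt x 0 - lam * u x * rowMode ν Wt x 2) x ∧
    HasDerivAt (fun x => rowMode ν Wt x 1)
      (ν * rowMode ν Wt x 1 - lam * rowMode ν Wt x 0 - lam * u x * rowMode ν Wt x 2) x ∧
    HasDerivAt (fun x => rowMode ν Wt x 2)
      ((lam - φ x + ν) * rowMode ν Wt x 2 - rowMode ν Wt x 0 - rowMode ν Wt x 1) x := by
  have h1 : HasDerivAt (fun x => star (Wt x)) (-(star (Wt x) ᵥ* sysMatrix (u x) (φ x) lam)) x := by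
    refine (h.1 x).star.congr_deriv ?_
    rw [Matrix.star_mulVec, Matrix.conjTranspose_neg, Matrix.conjTranspose_conjTranspose,
      Matrix.vecMul_neg]
  have h2 : HasDerivAt (fun x : ℝ => Complex.exp (ν * (x : ℂ))) (Complex.exp (ν * x) * ν) x := by
    have := ((Complex.ofRealCLM.hasDerivAt (x := x)).const_mul ν).cexp
    simpa using this
  have h3 := hasDerivAt_pi.1 (h2.smul h1)
  rw [vecMul_sysMatrix] at h3
  refine ⟨(h3 0).congr_deriv ?_, (h3 1).congr_deriv ?_, (h3 2).congr_deriv ?_⟩ <;>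
  · simp [rowMode]
    ring

theorem IsModeAtTop.tendsto_rowMode {N : ℝ → Matrix (Fin 3) (Fin 3) ℂ}
    (h : IsModeAtTop N (-star ν) V Wt) : Tendsto (rowMode ν Wt) atTop (𝓝 (star V)) := by
  refine ((continuous_star.tendsto V).comp h.2).congr fun x => ?_
  rw [Function.comp_apply, star_smul, rowMode]
  congr 1
  rw [Complex.star_def, ← Complex.exp_conj]
  simp

end RowCoordinates

section DualConvergence

attribute [local instance] Matrix.linftyOpNormedRing Matrix.linftyOpNormedAlgebra

/-- The adjoint system in adapted coordinates. -/
theorem IsRootTriple.adapted_hasDerivAt {b g w f : ℝ} {lam t₁ t₂ t₃ : ℂ}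
    (h : IsRootTriple b g lam t₁ t₂ t₃) (h2 : t₂ ≠ 0) (hw : b ^ 2 = w) (hf : g ^ 2 = w - f)
    {ε e ρ ν : ℂ} (hε : ε = b / t₂) (he : e = b ^ 2 - g ^ 2 * (b / t₂) ^ 2) (hρ : ρ = t₃ * (t₁ + t₂))
    (hν : ν = (t₁ + t₂) * (t₁ + t₃)) {z₁ z₂ z₃ : ℝ → ℂ} {u φ x : ℝ}
    (hz₁ : HasDerivAt z₁ (ν * z₁ x - lam * u * z₃ x) x)
    (hz₂ : HasDerivAt z₂ (ν * z₂ x - lam * z₁ x - lam * u * z₃ x) x)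
    (hz₃ : HasDerivAt z₃ ((lam - φ + ν) * z₃ x - z₁ x - z₂ x) x) :
    HasDerivAt (fun x => z₁ x + ε * z₂ x + e * z₃ x)
      ((t₁ + t₂) * (t₁ - t₂) * (z₁ x + ε * z₂ x + e * z₃ x)
        - (lam * (1 + ε) * ((u - w : ℝ) : ℂ) + ((φ - f : ℝ) : ℂ) * e) * z₃ x) x ∧
    HasDerivAt (fun x => z₂ x + ρ * z₃ x)
      (-(lam + ρ) * (z₁ x + ε * z₂ x + e * z₃ x)
        - (lam * ((u - w : ℝ) : ℂ) + ((φ - f : ℝ) : ℂ) * ρ) * z₃ x) x ∧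
    HasDerivAt z₃ ((lam - φ + (ν + (1 - ε) * ρ + e)) * z₃ x - (z₁ x + ε * z₂ x + e * z₃ x)
      - (1 - ε) * (z₂ x + ρ * z₃ x)) x := by
  have hw' : (b : ℂ) ^ 2 = w := by exact_mod_cast hw
  have hf' : (g : ℂ) ^ 2 = w - f := by exact_mod_cast hf
  obtain ⟨i1, i2, i3, i4, i5⟩ := h.dual_identities h2 (ε := ε) (e := e) (ρ := ρ)
    (by rw [hε]; field_simp) (by rw [he, hε]) hρ
  refine ⟨((hz₁.add (hz₂.const_mul ε)).add (hz₃.const_mul e)).congr_deriv ?_,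
    (hz₂.add (hz₃.const_mul ρ)).congr_deriv ?_, hz₃.congr_deriv ?_⟩
  · rw [hν]
    push_cast
    linear_combination z₁ x * i1 - z₂ x * i2 + z₃ x * i3 + z₃ x * (e + lam * (1 + ε)) * hw'
      - z₃ x * e * hf'
  · rw [hν]
    push_cast
    linear_combination z₂ x * i4 + z₃ x * i5 + z₃ x * (lam + ρ) * hw' - z₃ x * ρ * hf'
  · ring

variable {ι : Type*} {l : Filter ι} {γ : ℝ}

theorem eventually_coupling_sub_le (hγ : 1 ≤ γ) {x₀ : ℝ} {vhat : ℝ → ℝ → ℝ}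
    (hv : ∀ vp ∈ Ioo (0 : ℝ) 1, IsShockProfile γ vp (vhat vp))
    (h0 : Tendsto (fun vp => vhat vp 0) (𝓝[>] 0) (𝓝 (limitProfile x₀ 0)))
    {vp : ι → ℝ} (hvp : Tendsto vp l (𝓝[>] 0)) {A e : ι → ℂ} {A₀ : ℂ} (hA : Tendsto A l (𝓝 A₀))
    (he : Tendsto e l (𝓝 0)) (T : ℝ) {τ : ℝ} (hτ : 0 < τ) :
    ∀ᶠ i in l, ∀ x ∈ Icc 0 T, ‖A i * ((vhat (vp i) x - vp i : ℝ) : ℂ)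
      + ((fCoeff γ (vp i) (vhat (vp i) x) - fCoeff γ (vp i) (vp i) : ℝ) : ℂ) * e i
      - A₀ * (limitProfile x₀ x : ℂ)‖ ≤ τ := by
  have hvp0 : Tendsto vp l (𝓝 0) := hvp.mono_right nhdsWithin_le_nhds
  have hsmall : ∀ᶠ i in l, vp i ∈ Ioo (0 : ℝ) 1 := hvp.eventually (Ioo_mem_nhdsGT one_pos)
  have hrest : Tendsto (fun i => ‖A i‖ * vp i + ‖A i - A₀‖ + 2 * (γ + 3) * ‖e i‖) l (𝓝 0) := by
    have := ((hA.norm.mul hvp0).add (tendsto_iff_norm_sub_tendsto_zero.1 hA)).add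
      (he.norm.const_mul (2 * (γ + 3)))
    simpa using this
  filter_upwards [hsmall, hrest.eventually_lt_const (half_pos hτ),
    hA.norm.eventually_lt_const (lt_add_one ‖A₀‖),
    hvp.eventually (eventually_abs_sub_limitProfile_le hγ hv h0 T
      (ε := τ / 2 / (‖A₀‖ + 1)) (by positivity))] with i h1 h2 h3 h4 x hx
  have hm := (hv _ h1).mem_Ioo x
  have hl := limitProfile_mem_Ioo x₀ x
  have e1 : A i * ((vhat (vp i) x - vp i : ℝ) : ℂ)
      + ((fCoeff γ (vp i) (vhat (vp i) x) - fCoeff γ (vp i) (vp i) : ℝ) : ℂ) * e i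
      - A₀ * (limitProfile x₀ x : ℂ)
      = A i * ((vhat (vp i) x - limitProfile x₀ x : ℝ) : ℂ) - A i * ((vp i : ℝ) : ℂ)
        + (A i - A₀) * ((limitProfile x₀ x : ℝ) : ℂ)
        + ((fCoeff γ (vp i) (vhat (vp i) x) - fCoeff γ (vp i) (vp i) : ℝ) : ℂ) * e i := by
    push_cast; ring
  have n1 : ‖A i * ((vhat (vp i) x - limitProfile x₀ x : ℝ) : ℂ)‖ ≤ τ / 2 := by
    rw [norm_mul, Complex.norm_real, Real.norm_eq_abs]
    have := mul_le_mul h3.le (h4 x ⟨by linarith [hx.1, hx.2], hx.2⟩) (abs_nonneg _) (by positivity)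
    rwa [mul_div_cancel₀ _ (by positivity : ‖A₀‖ + 1 ≠ 0)] at this
  have n2 : ‖A i * ((vp i : ℝ) : ℂ)‖ = ‖A i‖ * vp i := by
    rw [norm_mul, Complex.norm_real, Real.norm_of_nonneg h1.1.le]
  have n3 : ‖(A i - A₀) * ((limitProfile x₀ x : ℝ) : ℂ)‖ ≤ ‖A i - A₀‖ := by
    rw [norm_mul, Complex.norm_real, Real.norm_of_nonneg hl.1.le]
    exact mul_le_of_le_one_right (norm_nonneg _) hl.2.le
  have n4 : ‖((fCoeff γ (vp i) (vhat (vp i) x) - fCoeff γ (vp i) (vp i) : ℝ) : ℂ) * e i‖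
      ≤ 2 * (γ + 3) * ‖e i‖ := by
    rw [norm_mul, Complex.norm_real, Real.norm_eq_abs]
    refine mul_le_mul_of_nonneg_right ?_ (norm_nonneg _)
    have f1 := abs_fCoeff_le hγ h1 (w := vhat (vp i) x) ⟨hm.1.le, hm.2.le⟩
    have f2 := abs_fCoeff_le hγ h1 (w := vp i) ⟨le_rfl, h1.2.le⟩
    linarith [abs_sub (fCoeff γ (vp i) (vhat (vp i) x)) (fCoeff γ (vp i) (vp i))]
  rw [e1]
  linarith [norm_add_le (A i * ((vhat (vp i) x - limitProfile x₀ x : ℝ) : ℂ) - A i * ((vp i : ℝ) : ℂ)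
        + (A i - A₀) * ((limitProfile x₀ x : ℝ) : ℂ))
      (((fCoeff γ (vp i) (vhat (vp i) x) - fCoeff γ (vp i) (vp i) : ℝ) : ℂ) * e i),
    norm_add_le (A i * ((vhat (vp i) x - limitProfile x₀ x : ℝ) : ℂ) - A i * ((vp i : ℝ) : ℂ))
      ((A i - A₀) * ((limitProfile x₀ x : ℝ) : ℂ)),
    norm_sub_le (A i * ((vhat (vp i) x - limitProfile x₀ x : ℝ) : ℂ)) (A i * ((vp i : ℝ) : ℂ))]

theorem norm_coupling_le (hγ : 1 ≤ γ) {vp : ℝ} (hvp : vp ∈ Ioo (0 : ℝ) 1) {u E L M : ℝ}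
    (hu : vp ≤ u) (huE : u - vp ≤ E) {A e : ℂ} (hA : ‖A‖ ≤ L) (he : ‖e‖ ≤ M * vp) (hM : 0 ≤ M) :
    ‖A * ((u - vp : ℝ) : ℂ) + ((fCoeff γ vp u - fCoeff γ vp vp : ℝ) : ℂ) * e‖
      ≤ (L + (2 + (γ - 1) * γ) * M) * E := by
  have hu0 : 0 ≤ u - vp := sub_nonneg.2 hu
  have hg : 0 ≤ (γ - 1) * γ := mul_nonneg (by linarith) (by linarith)
  have hL := (norm_nonneg A).trans hA
  refine (norm_add_le _ _).trans ?_
  rw [norm_mul, norm_mul, Complex.norm_real, Complex.norm_real, Real.norm_of_nonneg hu0,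
    Real.norm_eq_abs]
  have h1 := mul_le_mul hA huE hu0 hL
  have h2 := mul_le_mul (abs_fCoeff_sub_le hγ hvp le_rfl hu) he (norm_nonneg _)
    (mul_nonneg (add_nonneg zero_le_two (div_nonneg hg hvp.1.le)) hu0)
  have h3 : (2 + (γ - 1) * γ / vp) * (u - vp) * (M * vp) = (2 * vp + (γ - 1) * γ) * M * (u - vp) := by
    have := hvp.1.ne'
    field_simp
  have h4 : (2 * vp + (γ - 1) * γ) * M * (u - vp) ≤ (2 + (γ - 1) * γ) * M * E :=
    mul_le_mul (mul_le_mul_of_nonneg_right (by linarith [hvp.2]) hM) huE hu0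
      (mul_nonneg (by linarith) hM)
  linarith

theorem endpoint_modulus_bounds (hγ : 1 ≤ γ) {vp : ℝ} (hv : vp ∈ Ioo (0 : ℝ) (1 / 2)) :
    1 / 2 ≤ √(vp - fCoeff γ vp vp) ∧ √(vp - fCoeff γ vp vp) ≤ √γ := by
  have hv' : vp ∈ Ioo (0 : ℝ) 1 := ⟨hv.1, hv.2.trans (by norm_num)⟩
  have h1 := rhConst_pos hγ hv'
  have h2 := rhConst_le hγ hv'
  have e : vp - fCoeff γ vp vp = γ * (1 + rhConst γ vp - vp) := by
    rw [fCoeff_endpoint hγ hv']; ring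
  rw [e]
  constructor
  · refine Real.le_sqrt_of_sq_le ?_
    nlinarith [hv.2]
  · exact Real.sqrt_le_sqrt (by nlinarith)

end DualConvergence

section DualLimit

attribute [local instance] Matrix.linftyOpNormedRing Matrix.linftyOpNormedAlgebra

variable {ι : Type*} {l : Filter ι} {γ : ℝ}

theorem star_dualVector (b : ℝ) (t n : ℂ) : star (dualVector b t n)
    = ![star n * ((b : ℂ) / t), star n, star n * (1 / (t * (t - b)))] := by
  ext i
  fin_cases i <;> simp [dualVector]

/-- The adjoint modes at `+∞` converge in the high-Mach-number limit. -/
theorem tendsto_dual_mode (hγ : 1 ≤ γ) {x₀ : ℝ} {vhat : ℝ → ℝ → ℝ}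
    (hv : ∀ vp ∈ Ioo (0 : ℝ) 1, IsShockProfile γ vp (vhat vp))
    (h0 : Tendsto (fun vp => vhat vp 0) (𝓝[>] 0) (𝓝 (limitProfile x₀ 0)))
    {vp : ι → ℝ} (hvp : Tendsto vp l (𝓝[>] 0)) {lam : ι → ℂ} {lam₀ : ℂ}
    (hre : ∀ᶠ i in l, 0 ≤ (lam i).re) (hlam : Tendsto lam l (𝓝 lam₀))
    {n : ι → ℂ} (hn : Tendsto n l (𝓝 1)) {t₁ t₂ t₃ : ι → ℂ}
    (ht : ∀ᶠ i in l, IsSplitTriple √(vp i) √(vp i - fCoeff γ (vp i) (vp i)) (lam i)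
      (t₁ i) (t₂ i) (t₃ i) ∧ ‖t₃ i‖ ≤ ‖t₂ i‖)
    {Wt : ι → ℝ → Fin 3 → ℂ} {Wt₀ : ℝ → Fin 3 → ℂ}
    (hW : ∀ᶠ i in l, IsDualModeAtTop (fun x => evansMatrix γ (vp i) (vhat (vp i) x) (lam i))
      (-star ((t₁ i + t₂ i) * (t₁ i + t₃ i))) (dualVector √(vp i) (t₁ i) (n i)) (Wt i))
    (hW₀ : IsDualModeAtTop (fun x => limitMatrix (limitProfile x₀ x) lam₀) 0
      (limitDualVector lam₀) Wt₀) :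
    Tendsto (fun i => Wt i 0) l (𝓝 (Wt₀ 0)) := by
  have hl0 := limitProfile_mem_Ioo x₀ 0
  set c := limitProfile x₀ 0 with hc
  set η := (1 - c) / 6 with hη
  have hη0 : 0 < η := by rw [hη]; linarith [hl0.2]
  have hη4 : η ≤ 1 / 4 := by rw [hη]; linarith [hl0.1]
  have hvp0 : Tendsto vp l (𝓝 0) := hvp.mono_right nhdsWithin_le_nhds
  have hb0 : Tendsto (fun i => √(vp i)) l (𝓝 0) := by
    simpa [Function.comp_def] using (Real.continuous_sqrt.tendsto 0).comp hvp0
  obtain ⟨M, hM, b₀, hb₀, hbound⟩ := exists_bound_dual_coefficients √γ (‖lam₀‖ + 1)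
  set ε : ι → ℂ := fun i => (√(vp i) : ℂ) / t₂ i with hε
  set e : ι → ℂ := fun i => (√(vp i) : ℂ) ^ 2
    - (√(vp i - fCoeff γ (vp i) (vp i)) : ℂ) ^ 2 * ((√(vp i) : ℂ) / t₂ i) ^ 2 with he
  set ρ : ι → ℂ := fun i => t₃ i * (t₁ i + t₂ i) with hρ
  set ν : ι → ℂ := fun i => (t₁ i + t₂ i) * (t₁ i + t₃ i) with hν
  set a₁ : ι → ℂ := fun i => (t₁ i + t₂ i) * (t₁ i - t₂ i) with ha₁
  set m : ι → ℂ := fun i => 1 / (t₁ i * (t₁ i - √(vp i))) with hm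
  have hmem : ∀ᶠ i in l, vp i ∈ Ioo (0 : ℝ) (1 / 2) := hvp.eventually (Ioo_mem_nhdsGT (by norm_num))
  have good : ∀ᶠ i in l, vp i ∈ Ioo (0 : ℝ) (1 / 2) ∧ vp i ∈ Ioo (0 : ℝ) 1 ∧
      IsSplitTriple √(vp i) √(vp i - fCoeff γ (vp i) (vp i)) (lam i) (t₁ i) (t₂ i) (t₃ i) ∧
      0 ≤ (lam i).re ∧ ‖lam i‖ ≤ ‖lam₀‖ + 1 ∧
      t₁ i ≠ 0 ∧ t₁ i - √(vp i) ≠ 0 ∧ t₂ i ≠ 0 ∧ ‖m i‖ ≤ M ∧ ‖ε i‖ ≤ M * √(vp i) ∧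
      ‖e i‖ ≤ M * vp i ∧ ‖ρ i‖ ≤ M * vp i ∧ ‖ν i‖ ≤ M * √(vp i) ∧ ‖a₁ i‖ ≤ M * √(vp i) := by
    filter_upwards [hmem, ht, hre, hb0.eventually_lt_const hb₀,
      hlam.norm.eventually_lt_const (lt_add_one ‖lam₀‖)] with i h1 h2 h3 h4 h5
    obtain ⟨hb, -, hbw, -⟩ := endpoint_moduli hγ h1
    obtain ⟨hg1, hg2⟩ := endpoint_modulus_bounds hγ h1
    have := hbound √(vp i) √(vp i - fCoeff γ (vp i) (vp i)) (lam i) (t₁ i) (t₂ i) (t₃ i) hb h4 hg1 hg2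
      h3 h5.le h2.1 h2.2
    rw [hbw] at this
    exact ⟨h1, ⟨h1.1, h1.2.trans (by norm_num)⟩, h2.1, h3, h5.le, this⟩
  have lim_b : ∀ {d : ι → ℂ}, (∀ᶠ i in l, ‖d i‖ ≤ M * √(vp i)) → Tendsto d l (𝓝 0) := fun h =>
    squeeze_zero_norm' h (by simpa using hb0.const_mul M)
  have lim_v : ∀ {d : ι → ℂ}, (∀ᶠ i in l, ‖d i‖ ≤ M * vp i) → Tendsto d l (𝓝 0) := fun h =>
    squeeze_zero_norm' h (by simpa using hvp0.const_mul M)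
  have hε0 : Tendsto ε l (𝓝 0) := lim_b (good.mono fun i h => h.2.2.2.2.2.2.2.2.2.1)
  have he0 : Tendsto e l (𝓝 0) := lim_v (good.mono fun i h => h.2.2.2.2.2.2.2.2.2.2.1)
  have hρ0 : Tendsto ρ l (𝓝 0) := lim_v (good.mono fun i h => h.2.2.2.2.2.2.2.2.2.2.2.1)
  have hν0 : Tendsto ν l (𝓝 0) := lim_b (good.mono fun i h => h.2.2.2.2.2.2.2.2.2.2.2.2.1)
  have ha0 : Tendsto a₁ l (𝓝 0) := lim_b (good.mono fun i h => h.2.2.2.2.2.2.2.2.2.2.2.2.2)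
  set s : ι → ℂ := fun i => ν i + (1 - ε i) * ρ i + e i with hs
  have hs0 : Tendsto s l (𝓝 0) := by
    have := (hν0.add ((hε0.const_sub 1).mul hρ0)).add he0
    simpa using this
  -- the exponential decay of the profile towards its end state
  have hdecay : ∀ᶠ i in l, ∀ x, 0 ≤ x → vhat (vp i) x - vp i ≤ Real.exp (-(3 * η) * x) := by
    have hc0 : Tendsto (fun i => vhat (vp i) 0) l (𝓝 c) := h0.comp hvp
    filter_upwards [good, hc0.eventually_lt_const (show c < (1 + c) / 2 by linarith [hl0.2])]
      with i hi h2 x hx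
    refine (le_abs_self _).trans (((hv _ hi.2.1).abs_sub_le_top hγ hi.2.1 hx).1.trans ?_)
    refine Real.exp_le_exp.2 (mul_le_mul_of_nonneg_right ?_ hx)
    rw [hη]; linarith
  have hdecay₀ : ∀ x, 0 ≤ x → limitProfile x₀ x ≤ Real.exp (-(3 * η) * x) := fun x hx => by
    refine (le_abs_self _).trans ((abs_limitProfile_le_top x₀ hx).trans (Real.exp_le_exp.2
      (mul_le_mul_of_nonneg_right ?_ hx)))
    rw [hη, ← hc]; linarith [hl0.2]
  set L := 2 * (‖lam₀‖ + 1) with hL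
  set C := L + (2 + (γ - 1) * γ) * M with hC
  have hCL : ‖lam₀‖ ≤ C := by
    have : 0 ≤ (2 + (γ - 1) * γ) * M :=
      mul_nonneg (add_nonneg zero_le_two (mul_nonneg (by linarith) (by linarith))) hM.le
    linarith [norm_nonneg lam₀]
  set R : (ι → ℂ) → (ι → ℂ) → ι → ℝ → ℂ := fun A d i x => A i * ((vhat (vp i) x - vp i : ℝ) : ℂ)
      + ((fCoeff γ (vp i) (vhat (vp i) x) - fCoeff γ (vp i) (vp i) : ℝ) : ℂ) * d i with hR
  have hRb : ∀ {A d : ι → ℂ}, (∀ᶠ i in l, ‖A i‖ ≤ L) → (∀ᶠ i in l, ‖d i‖ ≤ M * vp i) →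
      ∀ᶠ i in l, ∀ x, 0 ≤ x → ‖R A d i x‖ ≤ C * Real.exp (-(3 * η) * x) := by
    intro A d hA hd
    filter_upwards [good, hA, hd, hdecay] with i hi h1 h2 h3 x hx
    exact norm_coupling_le hγ hi.2.1 ((hv _ hi.2.1).mem_Ioo x).1.le (h3 x hx) h1 h2 hM.le
  have hA1 : Tendsto (fun i => lam i * (1 + ε i)) l (𝓝 lam₀) := by
    simpa using hlam.mul (hε0.const_add 1)
  have hA1b : ∀ᶠ i in l, ‖lam i * (1 + ε i)‖ ≤ L := by
    filter_upwards [hA1.norm.eventually_lt_const (lt_add_one ‖lam₀‖)] with i hi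
    linarith [norm_nonneg lam₀]
  have hA2b : ∀ᶠ i in l, ‖lam i‖ ≤ L := good.mono fun i hi => by
    linarith [norm_nonneg lam₀, hi.2.2.2.2.1]
  set z : ι → ℝ → Fin 3 → ℂ := fun i => rowMode (ν i) (Wt i) with hz
  set z₀ : ℝ → Fin 3 → ℂ := rowMode 0 Wt₀ with hz₀
  have hW' : ∀ᶠ i in l, IsModeAtTop
      (fun x => -(sysMatrix (vhat (vp i) x) (fCoeff γ (vp i) (vhat (vp i) x)) (lam i))ᴴ)
      (-star (ν i)) (dualVector √(vp i) (t₁ i) (n i)) (Wt i) := hW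
  have hW₀' : IsModeAtTop
      (fun x => -(sysMatrix (limitProfile x₀ x) (2 * limitProfile x₀ x - 1) lam₀)ᴴ)
      (-star 0) (limitDualVector lam₀) Wt₀ := by
    rw [star_zero, neg_zero]; exact hW₀
  set q : ι → ℝ → ℂ := fun i x => z i x 0 + ε i * z i x 1 + e i * z i x 2 with hq
  set ζ : ι → ℝ → ℂ := fun i x => z i x 1 + ρ i * z i x 2 with hζ
  have hder : ∀ᶠ i in l, ∀ x,
      HasDerivAt (q i) (a₁ i * q i x - R (fun i => lam i * (1 + ε i)) e i x * z i x 2) x ∧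
      HasDerivAt (ζ i) (-(lam i + ρ i) * q i x - R lam ρ i x * z i x 2) x ∧
      HasDerivAt (fun x => z i x 2) ((lam i - (fCoeff γ (vp i) (vhat (vp i) x) : ℂ) + s i) * z i x 2
        - q i x - (1 - ε i) * ζ i x) x := by
    filter_upwards [hW', good] with i h1 hi x
    obtain ⟨-, -, hbw, hgf⟩ := endpoint_moduli hγ hi.1
    obtain ⟨d1, d2, d3⟩ := h1.rowMode_hasDerivAt x
    exact hi.2.2.1.toIsRootTriple.adapted_hasDerivAt hi.2.2.2.2.2.2.2.1 hbw hgf (ε := ε i) (e := e i)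
      (ρ := ρ i) (ν := ν i) rfl rfl rfl rfl d1 d2 d3
  have hder₀ := fun x => hW₀'.rowMode_hasDerivAt x
  have hlimz : ∀ᶠ i in l, Tendsto (z i) atTop (𝓝 (star (dualVector √(vp i) (t₁ i) (n i)))) :=
    hW'.mono fun i h => h.tendsto_rowMode
  have hlimz₀ : Tendsto z₀ atTop (𝓝 (star (limitDualVector lam₀))) := hW₀'.tendsto_rowMode
  have hk : ∀ᶠ i in l, Continuous fun x => lam i - (fCoeff γ (vp i) (vhat (vp i) x) : ℂ) + s i := by
    filter_upwards [good] with i hi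
    have := continuous_fCoeff_comp (γ := γ) (vp := vp i) (hv _ hi.2.1).continuous
      fun x => hi.1.1.trans ((hv _ hi.2.1).mem_Ioo x).1
    fun_prop
  obtain ⟨X₁, -, hX₁0, hX₁⟩ := exists_nonneg_exp_le (η := 3 * η) (by positivity) 1
    (by norm_num : (0 : ℝ) < 1 / 16) 0
  have hkre : ∀ᶠ i in l, ∀ x, X₁ ≤ x →
      1 / 2 ≤ (lam i - (fCoeff γ (vp i) (vhat (vp i) x) : ℂ) + s i).re := by
    filter_upwards [good, hdecay, hvp0.eventually_lt_const (show (0 : ℝ) < 1 / 16 by norm_num),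
      (norm_zero (E := ℂ) ▸ hs0.norm).eventually_lt_const (show (0 : ℝ) < 1 / 8 by norm_num)]
      with i hi h1 h2 h3 x hx
    have h4 := h1 x (hX₁0.trans hx)
    have h5 := hX₁ x hx
    have h6 := fCoeff_le hγ hi.2.1 ((hv _ hi.2.1).mem_Ioo x).1.le
    have h7 := (abs_le.1 (Complex.abs_re_le_norm (s i))).1
    rw [Complex.add_re, Complex.sub_re, Complex.ofReal_re]
    linarith [hi.2.2.2.1]
  have hksub : ∀ i x, lam i - (fCoeff γ (vp i) (vhat (vp i) x) : ℂ) + s i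
      - (lam₀ - ((2 * limitProfile x₀ x - 1 : ℝ) : ℂ)) = (lam i - lam₀ + s i)
        - ((fCoeff γ (vp i) (vhat (vp i) x) - (2 * limitProfile x₀ x - 1) : ℝ) : ℂ) := by
    intro i x; push_cast; ring
  have hs1 : Tendsto (fun i => lam i - lam₀ + s i) l (𝓝 0) := by
    simpa using (hlam.sub_const lam₀).add hs0
  have hkB : ∀ᶠ i in l, ∀ x, 0 ≤ x → ‖lam i - (fCoeff γ (vp i) (vhat (vp i) x) : ℂ) + s i
      - (lam₀ - ((2 * limitProfile x₀ x - 1 : ℝ) : ℂ))‖ ≤ 1 + (γ + 4) := by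
    filter_upwards [good, (norm_zero (E := ℂ) ▸ hs1.norm).eventually_lt_const one_pos] with i hi h1 x _
    rw [hksub]
    refine (norm_sub_le _ _).trans (add_le_add h1.le ?_)
    rw [Complex.norm_real, Real.norm_eq_abs]
    have hmx := (hv _ hi.2.1).mem_Ioo x
    have h2 := abs_le.1 (abs_fCoeff_le hγ hi.2.1 ⟨hmx.1.le, hmx.2.le⟩)
    have h3 := limitProfile_mem_Ioo x₀ x
    rw [abs_le]
    constructor <;> linarith [h2.1, h2.2, h3.1, h3.2]
  have hkloc : ∀ T, ∀ τ > 0, ∀ᶠ i in l, ∀ x ∈ Icc 0 T,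
      ‖lam i - (fCoeff γ (vp i) (vhat (vp i) x) : ℂ) + s i
      - (lam₀ - ((2 * limitProfile x₀ x - 1 : ℝ) : ℂ))‖ ≤ τ := by
    intro T τ hτ
    filter_upwards [(norm_zero (E := ℂ) ▸ hs1.norm).eventually_lt_const (half_pos hτ),
      hvp.eventually (eventually_abs_fCoeff_sub_le hγ hv h0 T (half_pos hτ))] with i h1 h2 x hx
    rw [hksub]
    refine (norm_sub_le _ _).trans ?_
    rw [Complex.norm_real, Real.norm_eq_abs]
    linarith [h2 x ⟨by linarith [hx.1, hx.2], hx.2⟩]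
  have hare : ∀ᶠ i in l, 0 ≤ (a₁ i).re := by
    filter_upwards [good] with i hi
    obtain ⟨hb, hbg, -, -⟩ := endpoint_moduli hγ hi.1
    have h1 := hi.2.2.1.re_eigenvalue₁_nonneg hb (hb.trans hbg)
    have h2 := hi.2.2.1.re_eigenvalue₂ hb (hb.trans hbg) hi.2.2.2.1
    have : a₁ i = (t₁ i + t₂ i) * (t₁ i + t₃ i) - (t₁ i + t₂ i) * (t₂ i + t₃ i) := by
      rw [ha₁]; ring
    rw [this, Complex.sub_re]
    linarith
  have hnstar : Tendsto (fun i => star (n i)) l (𝓝 1) := by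
    simpa [Function.comp_def] using (continuous_star.tendsto (1 : ℂ)).comp hn
  have hr : ∀ x, 0 ≤ x → ‖lam₀ * (limitProfile x₀ x : ℂ)‖ ≤ C * Real.exp (-(3 * η) * x) := by
    intro x hx
    rw [norm_mul, Complex.norm_real, Real.norm_of_nonneg (limitProfile_mem_Ioo x₀ x).1.le]
    exact mul_le_mul hCL (hdecay₀ x hx) (limitProfile_mem_Ioo x₀ x).1.le ((norm_nonneg _).trans hCL)
  have hqlim : ∀ᶠ i in l, Tendsto (q i) atTop (𝓝 0) := by
    filter_upwards [hlimz, good] with i h1 hi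
    have h2 := tendsto_pi_nhds.1 h1
    have h3 := ((h2 0).add ((h2 1).const_mul (ε i))).add ((h2 2).const_mul (e i))
    convert h3 using 2
    have := hi.2.2.1.toIsRootTriple.dual_orthogonality hi.2.2.2.2.2.1 hi.2.2.2.2.2.2.1
      hi.2.2.2.2.2.2.2.1
    simp only [star_dualVector, hε, he, Matrix.cons_val]
    linear_combination -star (n i) * this
  have hq₀lim : Tendsto (fun x => z₀ x 0) atTop (𝓝 0) := by
    have := tendsto_pi_nhds.1 hlimz₀ 0
    simpa [limitDualVector] using this
  have hζlim : ∀ᶠ i in l, Tendsto (ζ i) atTop (𝓝 (star (n i) * (1 + ρ i * m i))) := by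
    filter_upwards [hlimz] with i h1
    have h2 := tendsto_pi_nhds.1 h1
    have h3 := (h2 1).add ((h2 2).const_mul (ρ i))
    convert h3 using 2
    simp only [star_dualVector, hm, Matrix.cons_val]
    ring
  have hζ₀lim : Tendsto (fun x => z₀ x 1) atTop (𝓝 1) := by
    have := tendsto_pi_nhds.1 hlimz₀ 1
    simpa [limitDualVector] using this
  have hζ₁ : Tendsto (fun i => star (n i) * (1 + ρ i * m i)) l (𝓝 1) := by
    have hρm : Tendsto (fun i => ρ i * m i) l (𝓝 0) := by
      refine squeeze_zero_norm' (a := fun i => M * vp i * M) (good.mono fun i hi => ?_)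
        (by simpa using (hvp0.const_mul M).mul_const M)
      rw [norm_mul]
      exact mul_le_mul hi.2.2.2.2.2.2.2.2.2.2.2.1 hi.2.2.2.2.2.2.2.2.1 (norm_nonneg _)
        (mul_nonneg hM.le hi.1.1.le)
    simpa using hnstar.mul (hρm.const_add 1)
  have hylim : ∀ᶠ i in l, Tendsto (fun x => z i x 2) atTop (𝓝 (star (n i) * m i)) := by
    filter_upwards [hlimz] with i h1
    have h2 := tendsto_pi_nhds.1 h1 2
    simpa only [star_dualVector, hm, Matrix.cons_val] using h2
  have hy₀lim : Tendsto (fun x => z₀ x 2) atTop (𝓝 (star (limitDualVector lam₀) 2)) := by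
    exact tendsto_pi_nhds.1 hlimz₀ 2
  obtain ⟨X, hX0, hqX, hζX, hyX⟩ := exists_tendsto_of_adapted_systems (l := l)
    (q := q) (ζ := ζ)
    (y := fun i x => z i x 2) (q₀ := fun x => z₀ x 0) (ζ₀ := fun x => z₀ x 1) (y₀ := fun x => z₀ x 2)
    (a₁ := a₁) (δ := fun i => lam i + ρ i) (ε := ε) (R₁ := R (fun i => lam i * (1 + ε i)) e)
    (R₂ := R lam ρ) (k := fun i x => lam i - (fCoeff γ (vp i) (vhat (vp i) x) : ℂ) + s i)
    (r := fun x => lam₀ * (limitProfile x₀ x : ℂ))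
    (k₀ := fun x => lam₀ - ((2 * limitProfile x₀ x - 1 : ℝ) : ℂ)) (δ₀ := lam₀) (C := C)
    (B := 1 + (γ + 4)) (X₁ := X₁) (ζ₁ := fun i => star (n i) * (1 + ρ i * m i)) (ζ₂ := 1)
    (y₁ := fun i => star (n i) * m i) (y₂ := star (limitDualVector lam₀) 2) hη0 hη4
    (hder.mono fun i h x => (h x).1) (hder.mono fun i h x => (h x).2.1)
    (hder.mono fun i h x => (h x).2.2)
    (fun x => (hder₀ x).1.congr_deriv (by simp [hz₀])) (fun x => (hder₀ x).2.1.congr_deriv (by simp [hz₀]))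
    (fun x => (hder₀ x).2.2.congr_deriv (by simp [hz₀]))
    (hRb hA1b (good.mono fun i h => h.2.2.2.2.2.2.2.2.2.2.1))
    (hRb hA2b (good.mono fun i h => h.2.2.2.2.2.2.2.2.2.2.2.1)) hr hkB
    (fun T τ hτ => eventually_coupling_sub_le hγ hv h0 hvp hA1 he0 T hτ)
    (fun T τ hτ => eventually_coupling_sub_le hγ hv h0 hvp hlam hρ0 T hτ) hkloc hare ha0
    (by simpa using hlam.add hρ0) hε0 hk hkre hqlim hq₀lim hζlim hζ₀lim hζ₁ hylim hy₀lim
  have hX : Tendsto (fun i => z i X) l (𝓝 (z₀ X)) := by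
    refine tendsto_pi_nhds.2 fun j => ?_
    fin_cases j
    · have := (hqX.sub (hε0.mul (hζX.sub (hρ0.mul hyX)))).sub (he0.mul hyX)
      simp only [zero_mul, sub_zero] at this
      refine this.congr fun i => ?_
      show _ = z i X 0
      simp only [hq, hζ]
      ring
    · have := hζX.sub (hρ0.mul hyX)
      simp only [zero_mul, sub_zero] at this
      refine this.congr fun i => ?_
      show _ = z i X 1
      simp only [hζ]
      ring
    · exact hyX
  have hexp : Tendsto (fun i => Complex.exp (-ν i * (X : ℂ))) l (𝓝 (Complex.exp (-0 * (X : ℂ)))) :=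
    (Complex.continuous_exp.tendsto _).comp (hν0.neg.mul_const _)
  have hWX : Tendsto (fun i => Wt i X) l (𝓝 (Wt₀ X)) := by
    have := (continuous_star.tendsto _).comp (hexp.smul hX)
    rw [hz₀, ← eq_star_rowMode] at this
    exact this.congr fun i => (eq_star_rowMode (ν i) (Wt i) X).symm
  have hcont := continuous_limitProfile x₀
  have hcont' : Continuous fun x => 2 * limitProfile x₀ x - 1 := by fun_prop
  have hu : ∀ τ > 0, ∀ᶠ i in l, ∀ x ∈ Icc 0 X, |vhat (vp i) x - limitProfile x₀ x| ≤ τ :=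
    fun τ hτ => (hvp.eventually (eventually_abs_sub_limitProfile_le hγ hv h0 X hτ)).mono
      fun i hi x hx => hi x ⟨by linarith [hx.1, hx.2], hx.2⟩
  have hφ : ∀ τ > 0, ∀ᶠ i in l, ∀ x ∈ Icc 0 X,
      |fCoeff γ (vp i) (vhat (vp i) x) - (2 * limitProfile x₀ x - 1)| ≤ τ :=
    fun τ hτ => (hvp.eventually (eventually_abs_fCoeff_sub_le hγ hv h0 X hτ)).mono
      fun i hi x hx => hi x ⟨by linarith [hx.1, hx.2], hx.2⟩
  have hB : ∀ x ∈ Icc 0 X, |limitProfile x₀ x| ≤ 1 := fun x _ => by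
    have := limitProfile_mem_Ioo x₀ x
    rw [abs_of_pos this.1]; exact this.2.le
  exact tendsto_solution_of_approx (A := 0) (B := X)
    (continuous_sysMatrix hcont hcont' lam₀).matrix_conjTranspose.neg
    (hW'.mono fun i h => h.1) hW₀'.1
    (fun τ hτ => (eventually_norm_sysMatrix_sub_le (u := fun i x => vhat (vp i) x)
      (φ := fun i x => fCoeff γ (vp i) (vhat (vp i) x)) hlam hB hu hφ hτ).mono
      fun i hi x hx => (hi x hx).2) ⟨le_rfl, hX0⟩ ⟨hX0, le_rfl⟩ hWX

end DualLimit

section Main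

variable {γ : ℝ}

theorem IsEvansFunction.exists_modes (hγ : 1 ≤ γ) {vp : ℝ} (hvp : vp ∈ Ioo (0 : ℝ) (1 / 2)) {v : ℝ → ℝ}
    {nm np D : ℂ → ℂ} (hnp : IsScaling np) (h : IsEvansFunction γ vp v nm np D) {lam : ℂ}
    (hlam : lam ∈ rightHalfPlane) :
    ∃ (μ : ℂ) (V : Fin 3 → ℂ) (W Wt : ℝ → Fin 3 → ℂ) (t₁ t₂ t₃ : ℂ),
      (evansMatrix γ vp 1 lam *ᵥ V = μ • V ∧ 0 < μ.re ∧ V 1 = nm lam) ∧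
      IsModeAtBot (fun x => evansMatrix γ vp (v x) lam) μ V W ∧
      (IsSplitTriple √vp √(vp - fCoeff γ vp vp) lam t₁ t₂ t₃ ∧ ‖t₃‖ ≤ ‖t₂‖) ∧
      IsDualModeAtTop (fun x => evansMatrix γ vp (v x) lam) (-star ((t₁ + t₂) * (t₁ + t₃)))
        (dualVector √vp t₁ (np lam)) Wt ∧
      D lam = star (Wt 0) ⬝ᵥ W 0 := by
  obtain ⟨μm, μp, Vm, Vp, h1, h2, h3⟩ := h
  obtain ⟨W, Wt, hW, hWt, hD⟩ := h3 lam hlam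
  obtain ⟨hb, hbg, hbw, hgf⟩ := endpoint_moduli hγ hvp
  obtain ⟨T₁, T₂, T₃, hT⟩ := exists_split_functions hb (hb.trans hbg)
  obtain ⟨e1, e2⟩ := IsDualStablePair.eqOn hb hbg hbw hgf (fun lam hl => (hT lam hl).1) hnp h2 hlam
  rw [e1, e2] at hWt
  exact ⟨μm lam, Vm lam, W, Wt, T₁ lam, T₂ lam, T₃ lam, h1 lam hlam, hW, hT lam hlam, hWt, hD⟩

theorem tendsto_of_tendstoLocallyUniformlyOn {F : ℝ → ℂ → ℂ} {f : ℂ → ℂ} {s : Set ℂ} {p : Filter ℝ}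
    (h : TendstoLocallyUniformlyOn F f p s) (hf : ContinuousOn f s) {x : ℂ} (hx : x ∈ s) :
    Tendsto (fun y : ℝ × ℂ => F y.1 y.2) (p ×ˢ 𝓝[s] x) (𝓝 (f x)) := by
  refine tendsto_comp_of_locally_uniform_limit_within (F := fun y : ℝ × ℂ => F y.1)
    (g := fun y : ℝ × ℂ => y.2) (hf x hx) tendsto_snd fun u hu => ?_
  obtain ⟨t, ht, ht'⟩ := h u hu x hx
  exact ⟨t, ht, ht'.prod_inl _⟩

/-- Joint convergence at every point of a set yields locally uniform convergence on it. -/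
theorem tendstoLocallyUniformlyOn_of_tendsto_prod {F : ℝ → ℂ → ℂ} {f : ℂ → ℂ} {s : Set ℂ}
    {p : Filter ℝ} [p.NeBot]
    (h : ∀ x ∈ s, Tendsto (fun y : ℝ × ℂ => F y.1 y.2) (p ×ˢ 𝓝[s] x) (𝓝 (f x))) :
    TendstoLocallyUniformlyOn F f p s := by
  have hpt : ∀ x ∈ s, Tendsto (fun n => F n x) p (𝓝 (f x)) := fun x hx =>
    (h x hx).comp (tendsto_id.prodMk (tendsto_const_pure.mono_right (pure_le_nhdsWithin hx)))
  have hf : ∀ x ∈ s, Tendsto f (𝓝[s] x) (𝓝 (f x)) := by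
    intro x hx
    rw [Metric.nhds_basis_closedBall.tendsto_right_iff]
    intro ε hε
    have h1 : ∀ᶠ y : ℝ × ℂ in p ×ˢ 𝓝[s] x, F y.1 y.2 ∈ Metric.closedBall (f x) ε :=
      (h x hx).eventually (Metric.closedBall_mem_nhds _ hε)
    have h2 : ∀ᶠ z in 𝓝[s] x, ∀ᶠ n in p, F n z ∈ Metric.closedBall (f x) ε :=
      (eventually_swap_iff.1 h1).curry
    filter_upwards [h2, eventually_mem_nhdsWithin] with z hz hzs
    exact Metric.isClosed_closedBall.mem_of_tendsto (hpt z hzs) hz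
  rw [tendstoLocallyUniformlyOn_iff_forall_tendsto]
  intro x hx
  exact (((hf x hx).comp tendsto_snd).prodMk_nhds (h x hx)).mono_right (nhds_le_uniformity _)

theorem tendsto_evans (hγ : 1 ≤ γ) {x₀ : ℝ} {vhat : ℝ → ℝ → ℝ}
    (hv : ∀ vp ∈ Ioo (0 : ℝ) 1, IsShockProfile γ vp (vhat vp))
    (h0 : Tendsto (fun vp => vhat vp 0) (𝓝[>] 0) (𝓝 (limitProfile x₀ 0))) {nm np : ℝ → ℂ → ℂ}
    {nm0 : ℂ → ℂ} (hsc : ∀ vp ∈ Ioo (0 : ℝ) 1, IsScaling (nm vp) ∧ IsScaling (np vp))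
    (hsc0 : IsScaling nm0) (hnm : TendstoLocallyUniformlyOn nm nm0 (𝓝[>] 0) rightHalfPlane)
    (hnp : TendstoLocallyUniformlyOn np (fun _ => 1) (𝓝[>] 0) rightHalfPlane) {D : ℝ → ℂ → ℂ}
    {D0 : ℂ → ℂ}
    (hD : ∀ᶠ vp in 𝓝[>] (0 : ℝ), IsEvansFunction γ vp (vhat vp) (nm vp) (np vp) (D vp))
    (hD0 : IsLimitEvansFunction x₀ nm0 D0) {lam₀ : ℂ} (hlam₀ : lam₀ ∈ rightHalfPlane) :
    Tendsto (fun y : ℝ × ℂ => D y.1 y.2) (𝓝[>] 0 ×ˢ 𝓝[rightHalfPlane] lam₀) (𝓝 (D0 lam₀)) := by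
  obtain ⟨μm, Vm, hV₀, h3⟩ := hD0
  obtain ⟨W₀, Wt₀, hW₀, hWt₀, hD₀⟩ := h3 lam₀ hlam₀
  have hsmall : ∀ᶠ vp in 𝓝[>] (0 : ℝ), vp ∈ Ioo (0 : ℝ) (1 / 2) := Ioo_mem_nhdsGT (by norm_num)
  have hgood : ∀ᶠ y : ℝ × ℂ in 𝓝[>] 0 ×ˢ 𝓝[rightHalfPlane] lam₀, y.1 ∈ Ioo (0 : ℝ) (1 / 2) ∧
      IsEvansFunction γ y.1 (vhat y.1) (nm y.1) (np y.1) (D y.1) ∧ y.2 ∈ rightHalfPlane := by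
    filter_upwards [hsmall.prod_inl _, hD.prod_inl _,
      (eventually_mem_nhdsWithin (s := rightHalfPlane) (a := lam₀)).prod_inr _] with y h1 h2 h3
      using ⟨h1, h2, h3⟩
  have hex := fun (y : ℝ × ℂ) (h : y.1 ∈ Ioo (0 : ℝ) (1 / 2) ∧
      IsEvansFunction γ y.1 (vhat y.1) (nm y.1) (np y.1) (D y.1) ∧ y.2 ∈ rightHalfPlane) =>
    h.2.1.exists_modes hγ h.1 (hsc y.1 ⟨h.1.1, h.1.2.trans (by norm_num)⟩).2 h.2.2
  choose! μ V W Wt t₁ t₂ t₃ hV hW ht hWt hDeq using hex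
  have hvp : Tendsto (fun y : ℝ × ℂ => y.1) (𝓝[>] (0 : ℝ) ×ˢ 𝓝[rightHalfPlane] lam₀) (𝓝[>] 0) :=
    tendsto_fst
  have hlam : Tendsto (fun y : ℝ × ℂ => y.2) (𝓝[>] (0 : ℝ) ×ˢ 𝓝[rightHalfPlane] lam₀) (𝓝 lam₀) :=
    tendsto_snd.mono_right nhdsWithin_le_nhds
  have hre : ∀ᶠ y : ℝ × ℂ in 𝓝[>] (0 : ℝ) ×ˢ 𝓝[rightHalfPlane] lam₀, 0 ≤ y.2.re :=
    hgood.mono fun y h => h.2.2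
  have k1 := tendsto_unstable_mode hγ hv h0 hvp hre hlam₀ hlam
    (tendsto_of_tendstoLocallyUniformlyOn hnm hsc0.1 hlam₀) (hsc0.2 _ hlam₀) (hgood.mono hV)
    (hV₀ lam₀ hlam₀) (hgood.mono hW) hW₀
  have k2 := tendsto_dual_mode hγ hv h0 hvp hre hlam
    (tendsto_of_tendstoLocallyUniformlyOn hnp continuousOn_const hlam₀) (hgood.mono ht)
    (hgood.mono hWt) hWt₀
  have hc : Continuous fun p : (Fin 3 → ℂ) × (Fin 3 → ℂ) => star p.1 ⬝ᵥ p.2 :=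
    (continuous_star.comp continuous_fst).dotProduct continuous_snd
  rw [hD₀]
  exact ((hc.tendsto (Wt₀ 0, W₀ 0)).comp (k2.prodMk_nhds k1)).congr'
    (hgood.mono fun y h => (hDeq y h).symm)

end Main

end HighMach

theorem theorem3p1 (γ : ℝ) (hγ : 1 ≤ γ) :
    -- shock profiles exist, with any prescribed value between the end states at `x = 0`
    (∀ vp ∈ Ioo (0 : ℝ) 1, ∀ c ∈ Ioo vp 1,
      ∃ v : ℝ → ℝ, HighMach.IsShockProfile γ vp v ∧ v 0 = c) ∧
    -- for every family of profiles whose translates are matched to the limiting profile, and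
    -- every scaling of the asymptotic eigenvectors that converges to that of the limit
    (∀ (x₀ : ℝ) (vhat : ℝ → ℝ → ℝ),
      (∀ vp ∈ Ioo (0 : ℝ) 1, HighMach.IsShockProfile γ vp (vhat vp)) →
      Tendsto (fun vp => vhat vp 0) (𝓝[>] 0) (𝓝 (HighMach.limitProfile x₀ 0)) →
      ∀ (nm np : ℝ → ℂ → ℂ) (nm0 : ℂ → ℂ),
      (∀ vp ∈ Ioo (0 : ℝ) 1, HighMach.IsScaling (nm vp) ∧ HighMach.IsScaling (np vp)) →
      HighMach.IsScaling nm0 →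
      TendstoLocallyUniformlyOn nm nm0 (𝓝[>] 0) HighMach.rightHalfPlane →
      TendstoLocallyUniformlyOn np (fun _ => 1) (𝓝[>] 0) HighMach.rightHalfPlane →
      -- the Evans functions exist
      (∀ᶠ vp in 𝓝[>] (0 : ℝ),
        ∃ D : ℂ → ℂ, HighMach.IsEvansFunction γ vp (vhat vp) (nm vp) (np vp) D) ∧
      (∃ D0 : ℂ → ℂ, HighMach.IsLimitEvansFunction x₀ nm0 D0) ∧
      -- and converge
      (∀ (D : ℝ → ℂ → ℂ) (D0 : ℂ → ℂ),
        (∀ᶠ vp in 𝓝[>] (0 : ℝ),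
          HighMach.IsEvansFunction γ vp (vhat vp) (nm vp) (np vp) (D vp)) →
        HighMach.IsLimitEvansFunction x₀ nm0 D0 →
        ∀ K : Set ℂ, IsCompact K → K ⊆ HighMach.rightHalfPlane →
          TendstoUniformlyOn D D0 (𝓝[>] 0) K)) := by
  refine ⟨fun vp hvp c hc => HighMach.exists_shockProfile hγ hvp hc, ?_⟩
  intro x₀ vhat hv h0 nm np nm0 hsc hsc0 hnm hnp
  refine ⟨?_, HighMach.exists_isLimitEvansFunction x₀ nm0, ?_⟩
  · have hsmall : ∀ᶠ vp in 𝓝[>] (0 : ℝ), vp ∈ Ioo (0 : ℝ) (1 / 2) := Ioo_mem_nhdsGT (by norm_num)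
    filter_upwards [hsmall] with vp hvp
    have hvp' : vp ∈ Ioo (0 : ℝ) 1 := ⟨hvp.1, hvp.2.trans (by norm_num)⟩
    exact HighMach.exists_isEvansFunction hγ hvp (hv vp hvp') (nm vp) (hsc vp hvp').2
  · intro D D0 hD hD0 K hK hKs
    exact (tendstoLocallyUniformlyOn_iff_tendstoUniformlyOn_of_compact hK).1
      ((HighMach.tendstoLocallyUniformlyOn_of_tendsto_prod fun lam hlam =>
        HighMach.tendsto_evans hγ hv h0 hsc hsc0 hnm hnp hD hD0 hlam).mono hKs)
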